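/- **Theorem (Hybrid DEC upper bound for regret).** *Setting.* Let $\Pi$ (decisions), $\Phi$ (measurements), $\mathcal O$ (observations) be measurable spaces, $\Pi\neq\emptyset$, and $\mathbf\Pi=\Pi\times\Phi$; assume that $\mathbf\Pi$ is countable or that the $\sigma$-algebra of $\mathcal O$ is countably generated. A model is a Markov kernel $M$ from $\mathbf\Pi$ to $\mathcal O$. Let $\mathscr P$ be a finite non-empty collection of non-empty sets of models and $\mathcal M_{\mathscr P}=\bigcup_{\mathcal P\in\mathscr P}\mathrm{co}(\mathcal P)$. $D_{\rm H}^2(P,Q)=\frac12\int(\sqrt{dP}-\sqrt{dQ})^2$ is the squared Hellinger distance. Let $V^M(\pi)\in\mathbb R$ be a value function and $V^M_{\max}=\sup_\pi V^M(\pi)$. A $T$-round algorithm is given by kernels $q^t(\cdot\mid\mathcal H^{t-1})\in\Delta(\mathbf\Pi)$, $\mathcal H^{t-1}=(\pi^s,\phi^s,o^s)_{s<t}$. An adaptive environment is given by kernels $\mu^t$ that choose a model $M^t$ given $(M^s,\pi^s,\phi^s,o^s)_{s<t}$; it is constrained by $\mathscr P$ if for some $\mathcal P^\star\in\mathscr P$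 all its models lie in $\mathcal P^\star$. In round $t$, $M^t\sim\mu^t$ and $(\pi^t,\phi^t)\sim q^t$ are drawn independently given the past, and then $o^t\sim M^t(\pi^t,\phi^t)$. The regret is $\mathbf{Reg}(T)=\sup_{\pi^\star\in\Pi}\sum_{t=1}^T V^{M^t}(\pi^\star)-\sum_{t=1}^T\mathbb E_{\pi\sim q^t}V^{M^t}(\pi)$. The regret DEC is $$\textsf{r-dec}^{\rm c}_\varepsilon(\mathcal M)=\sup_{\bar M\in\mathrm{co}(\mathcal M)}\ \inf_{p\in\Delta(\mathbf\Pi)}\ \sup\Big\{\mathbb E_{\pi\sim p}[V^M_{\max}-V^M(\pi)]\ :\ M\in\mathcal M\cup\{\bar M\},\ \mathbb E_{x\sim p}D_{\rm H}^2(M(x),\bar M(x))\le\varepsilon^2\Big\},$$ and the fractional covering number is $N_{\rm frac}(\mathcal M;\Delta)=\inf_{p\in\Delta(\Pi)}\sup_{M\in\mathcal M}1/p(\pi:V^M_{\max}-V^M(\pi)\le\Delta)$. *ExO$^+$ (regret option).* Take $\Psi=\mathscr P\times\Pi$; $\psi=(\mathcal P,\pi)$ has $\mathcal M_\psi=\mathcal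 P$, $\pi_\psi=\pi$. Parameters are $\gamma>0$, a prior $w^1\in\Delta(\Psi)$ and a tolerance $\eta>0$. For $w\in\Delta(\Psi)$, $q\in\Delta(\mathbf\Pi)$ and bounded measurable $\xi:\Psi\times\mathbf\Pi\times\mathcal O\to\mathbb R$ let $$\Gamma_{w,\gamma}(q,\xi)=\sup_{\psi,\,M\in\mathcal M_\psi}\Big\{\mathbb E_{(\pi,\phi)\sim q}[V^M(\pi_\psi)-V^M(\pi)]-\gamma\,\mathbb E_{x\sim q}\mathbb E_{o\sim M(x)}\mathbb E_{\psi'\sim w}\big[1-e^{\xi(\psi';x,o)-\xi(\psi;x,o)}\big]\Big\}.$$ In round $t$, ExO$^+$ picks $(q^t,\xi^t)$, measurably in the history, that minimizes $\Gamma_{w^t,\gamma}$ up to $\eta$, draws $(\pi^t,\phi^t)\sim q^t$, observes $o^t$, and sets $w^{t+1}(\psi)\propto w^t(\psi)\exp(\xi^t(\psi;(\pi^t,\phi^t),o^t))$. The prior is chosen to minimize, up to a factor $2$, $$w\mapsto\sup_{\mathcal P\in\mathscr P,\ \bar M\in\mathrm{co}(\mathcal P)}1/w\big(\psi:\mathcal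 P\subseteq\mathcal M_\psi,\ V^{\bar M}_{\max}-V^{\bar M}(\pi_\psi)\le\Delta\big).$$ *Assumptions.* Let $T\ge1$, $\delta\in(0,1)$, $\Delta\ge0$, $C_V>0$, $N_{\rm frac}(\mathcal M_{\mathscr P};\Delta)<\infty$, and: 1. (Compactness) for every $\varepsilon>0$ there is a finite $S\subseteq\mathcal M_{\mathscr P}$ such that each $M\in\mathcal M_{\mathscr P}$ has an $M'\in S$ with $D_{\rm H}(M(x),M'(x))\le\varepsilon$ for all $x\in\mathbf\Pi$. 2. (Observability) $V^M(\pi)\in[0,V_{\max}]$ for $M\in\mathcal M_{\mathscr P}$; $M\mapsto V^M(\pi)$ is affine on $\mathcal M_{\mathscr P}$ (it respects all finite convex combinations inside $\mathcal M_{\mathscr P}$); $V^M$ is measurable for $M\in\mathrm{co}(\mathcal M_{\mathscr P})$; and there is a measurable $\pi\mapsto\phi_\pi\in\Phi$ with $|V^M(\pi)-V^{\bar M}(\pi)|\le C_V D_{\rm H}(M(\pi,\phi_\pi),\bar M(\pi,\phi_\pi))$ for all $\pi$, $M\in\mathcal M_{\mathscr P}$, $\bar M\in\mathrm{co}(\mathcal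 M_{\mathscr P})$. 3. (Moderate decay, with constant $c\ge1$) $\textsf{r-dec}^{\rm c}_{\varepsilon'}(\mathcal M_{\mathscr P})/\varepsilon'\le c\,\textsf{r-dec}^{\rm c}_{\varepsilon}(\mathcal M_{\mathscr P})/\varepsilon$ for $0<\varepsilon\le\varepsilon'\le1$. *Conclusion.* Let $\bar\varepsilon(T)=\sqrt{\dfrac{\log(|\mathscr P|/\delta)+\log N_{\rm frac}(\mathcal M_{\mathscr P};\Delta)}{T}}$. For every $\delta_0<1$ and $c\ge 1$ there is a constant $C$, depending only on $\delta_0$ and $c$, such that whenever $\delta\le\delta_0$ there are $\gamma>0$ and $\eta>0$ for which, for every prior $w^1$ chosen as above: ExO$^+$ exists (the optimization steps can be carried out measurably, for any positive tolerance), and every run of ExO$^+$ with parameters $\gamma$, $w^1$, $\eta$ satisfies, in every adaptive environment constrained by $\mathscr P$, with probability at least $1-\delta$, $$\frac1T\mathbf{Reg}(T)\ \le\ \Delta+C\sqrt{\log(T+1)}\,\Big[\textsf{r-dec}^{\rm c}_{\bar\varepsilon(T)}(\mathcal M_{\mathscr P})+C_V\,\bar\varepsilon(T)\Big].$$ -/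

import Mathlib

open MeasureTheory ProbabilityTheory

noncomputable section

namespace HybridDMSO

/-! ### Models, mixtures, Hellinger distance -/

/-- A model: a conditional distribution (Markov kernel) of the observation given a joint decision
`(π, φ)`, where `π` is a decision and `φ` is a measurement. -/
abbrev Model (Dec Meas Obs : Type*) [MeasurableSpace Dec] [MeasurableSpace Meas]
    [MeasurableSpace Obs] :=
  {M : Kernel (Dec × Meas) Obs // IsMarkovKernel M}

instance instMarkovModel {Dec Meas Obs : Type*} [MeasurableSpace Dec] [MeasurableSpace Meas]
    [MeasurableSpace Obs] (M : Model Dec Meas Obs) : IsMarkovKernel M.1 := M.2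

/-- `N` is the mixture `∑ i, a i • M i` of finitely many models, with convex weights `a`. -/
def IsMixture {Dec Meas Obs : Type*} [MeasurableSpace Dec] [MeasurableSpace Meas]
    [MeasurableSpace Obs] {n : ℕ} (a : Fin n → NNReal) (M : Fin n → Model Dec Meas Obs)
    (N : Model Dec Meas Obs) : Prop :=
  ∑ i, a i = 1 ∧ ∀ x, N.1 x = ∑ i, a i • (M i).1 x

/-- The convex hull `co(S)` of a class of models. -/
def co {Dec Meas Obs : Type*} [MeasurableSpace Dec] [MeasurableSpace Meas]
    [MeasurableSpace Obs] (S : Set (Model Dec Meas Obs)) : Set (Model Dec Meas Obs) :=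
  {N | ∃ (n : ℕ) (a : Fin n → NNReal) (M : Fin n → Model Dec Meas Obs),
    (∀ i, M i ∈ S) ∧ IsMixture a M N}

/-- The model class `⋃_{P ∈ Ps} co(P)` of a constraint class `Ps`. -/
def powClass {Dec Meas Obs : Type*} [MeasurableSpace Dec] [MeasurableSpace Meas]
    [MeasurableSpace Obs] (Ps : Finset (Set (Model Dec Meas Obs))) : Set (Model Dec Meas Obs) :=
  ⋃ P ∈ Ps, co P

/-- Squared Hellinger distance `½ ∫ (√(dP/dν) - √(dQ/dν))² dν`, with `ν = P + Q`
(so it lies in `[0, 1]` for probability measures). -/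
def hellingerSq {Obs : Type*} [MeasurableSpace Obs] (P Q : Measure Obs) : ENNReal :=
  2⁻¹ * ∫⁻ o, ENNReal.ofReal
    ((Real.sqrt (P.rnDeriv (P + Q) o).toReal - Real.sqrt (Q.rnDeriv (P + Q) o).toReal) ^ 2)
    ∂(P + Q)

/-- Hellinger distance. -/
def hellinger {Obs : Type*} [MeasurableSpace Obs] (P Q : Measure Obs) : ℝ :=
  Real.sqrt (hellingerSq P Q).toReal

/-- Compactness of a model class: for every `ε > 0` it has a finite `ε`-covering in Hellinger
distance, uniformly over joint decisions. -/
def IsCompactClass {Dec Meas Obs : Type*} [MeasurableSpace Dec] [MeasurableSpace Meas]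
    [MeasurableSpace Obs] (𝓜 : Set (Model Dec Meas Obs)) : Prop :=
  ∀ ε : ℝ, 0 < ε → ∃ S : Finset (Model Dec Meas Obs), (↑S : Set (Model Dec Meas Obs)) ⊆ 𝓜 ∧
    ∀ M ∈ 𝓜, ∃ M' ∈ S, ∀ x, hellinger (M.1 x) (M'.1 x) ≤ ε

/-! ### Value functions, observability, regret DEC, fractional covering number -/

/-- The optimal value `sup_π V^M(π)` of a model. -/
def bestValue {Dec Meas Obs : Type*} [MeasurableSpace Dec] [MeasurableSpace Meas]
    [MeasurableSpace Obs] (V : Model Dec Meas Obs → Dec → ℝ) (M : Model Dec Meas Obs) : ℝ :=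
  ⨆ π, V M π

/-- Observability: `V` takes values in `[0, Vmax]` and is affine over `⋃_{P ∈ Ps} co(P)`, and each
decision `π` has a measurement `φ π` for which the value of `π` is `CV`-Lipschitz in the Hellinger
distance of the observation laws. -/
structure Observable {Dec Meas Obs : Type*} [MeasurableSpace Dec] [MeasurableSpace Meas]
    [MeasurableSpace Obs] (Ps : Finset (Set (Model Dec Meas Obs)))
    (V : Model Dec Meas Obs → Dec → ℝ) (Vmax CV : ℝ) : Prop where
  measurable : ∀ M ∈ co (powClass Ps), Measurable (V M)
  mem_Icc : ∀ M ∈ powClass Ps, ∀ π, V M π ∈ Set.Icc 0 Vmax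
  affine : ∀ (n : ℕ) (a : Fin n → NNReal) (M : Fin n → Model Dec Meas Obs)
    (N : Model Dec Meas Obs), (∀ i, M i ∈ powClass Ps) → N ∈ powClass Ps → IsMixture a M N →
    ∀ π, V N π = ∑ i, (a i : ℝ) * V (M i) π
  lipschitz : ∃ φ : Dec → Meas, Measurable φ ∧
    ∀ π, ∀ M ∈ powClass Ps, ∀ Mbar ∈ co (powClass Ps),
      |V M π - V Mbar π| ≤ CV * hellinger (M.1 (π, φ π)) (Mbar.1 (π, φ π))

/-- The regret DEC at scale `ε` of `𝓜` with reference model `Mbar`: the infimum over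
distributions `p` of joint decisions of the largest expected suboptimality
`𝔼_{π∼p}[max V^M - V^M(π)]` over those `M ∈ 𝓜` with `𝔼_{x∼p} D_H²(M(x), Mbar(x)) ≤ ε²`. -/
def rDecRef {Dec Meas Obs : Type*} [MeasurableSpace Dec] [MeasurableSpace Meas]
    [MeasurableSpace Obs] (V : Model Dec Meas Obs → Dec → ℝ) (𝓜 : Set (Model Dec Meas Obs))
    (ε : ℝ) (Mbar : Model Dec Meas Obs) : ENNReal :=
  ⨅ p : ProbabilityMeasure (Dec × Meas),
    ⨆ M ∈ {M ∈ 𝓜 | ∫⁻ x, hellingerSq (M.1 x) (Mbar.1 x) ∂(p : Measure (Dec × Meas))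
        ≤ ENNReal.ofReal (ε ^ 2)},
      ∫⁻ x, ENNReal.ofReal (bestValue V M - V M x.1) ∂(p : Measure (Dec × Meas))

/-- The regret DEC of `𝓜` at scale `ε`: the supremum over reference models `Mbar ∈ co(𝓜)` of the
regret DEC of `𝓜 ∪ {Mbar}` with reference model `Mbar`. -/
def rDec {Dec Meas Obs : Type*} [MeasurableSpace Dec] [MeasurableSpace Meas]
    [MeasurableSpace Obs] (V : Model Dec Meas Obs → Dec → ℝ) (𝓜 : Set (Model Dec Meas Obs))
    (ε : ℝ) : ENNReal :=
  ⨆ Mbar ∈ co 𝓜, rDecRef V (𝓜 ∪ {Mbar}) ε Mbar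

/-- `d : [0, 1] → ℝ≥0` is of moderate decay with constant `c`. -/
def ModerateDecay (c : ℝ) (d : ℝ → ℝ) : Prop :=
  ∀ ε ε' : ℝ, 0 < ε → ε ≤ ε' → ε' ≤ 1 → d ε' / ε' ≤ c * (d ε / ε)

/-- The fractional covering number `N_frac(𝓜; Δ)` for the loss `max V^M - V^M(π)`. -/
def fracCover {Dec Meas Obs : Type*} [MeasurableSpace Dec] [MeasurableSpace Meas]
    [MeasurableSpace Obs] (V : Model Dec Meas Obs → Dec → ℝ) (𝓜 : Set (Model Dec Meas Obs))
    (Δ : ℝ) : ENNReal :=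
  ⨅ p : ProbabilityMeasure Dec, ⨆ M ∈ 𝓜,
    ((p : Measure Dec) {π | bestValue V M - V M π ≤ Δ})⁻¹

/-- `ε̄(T) = √((log(|Ps|/δ) + log N_frac(𝓜_Ps; Δ)) / T)`. -/
def epsBar {Dec Meas Obs : Type*} [MeasurableSpace Dec] [MeasurableSpace Meas]
    [MeasurableSpace Obs] (Ps : Finset (Set (Model Dec Meas Obs)))
    (V : Model Dec Meas Obs → Dec → ℝ) (Δ δ : ℝ) (T : ℕ) : ℝ :=
  Real.sqrt ((Real.log (Ps.card / δ) + Real.log (fracCover V (powClass Ps) Δ).toReal) / T)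

/-! ### Algorithms, adaptive environments and their interaction -/

/-- The learner's history `(π^s, φ^s, o^s)_{s < t}` of the first `t` rounds. -/
abbrev Hist (Dec Meas Obs : Type*) (t : ℕ) := Fin t → (Dec × Meas) × Obs

/-- A no-regret algorithm: for each round, the distribution of the joint decision given the
learner's history. Rounds are numbered from `0`; a `T`-round interaction uses `q 0, …, q (T-1)`. -/
structure Alg (Dec Meas Obs : Type*) [MeasurableSpace Dec] [MeasurableSpace Meas]
    [MeasurableSpace Obs] where
  q : ∀ t : ℕ, Kernel (Hist Dec Meas Obs t) (Dec × Meas)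
  markov : ∀ t, IsMarkovKernel (q t)

/-- An adaptive environment. The models it can play are named by labels `e : Label` (`Label` is
thus the space of models together with a σ-algebra that makes sampling measurable), `model` maps
labels to models, and `choice t` is the distribution of the model of round `t` given the
full-information history `(M^s, π^s, φ^s, o^s)_{s < t}`. -/
structure Env (Dec Meas Obs Label : Type*) [MeasurableSpace Dec] [MeasurableSpace Meas]
    [MeasurableSpace Obs] [MeasurableSpace Label] where
  model : Kernel (Label × (Dec × Meas)) Obs
  markov_model : IsMarkovKernel model
  choice : ∀ t : ℕ, Kernel (Fin t → Label × (Dec × Meas) × Obs) Label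
  markov_choice : ∀ t, IsMarkovKernel (choice t)

attribute [instance] Alg.markov Env.markov_model Env.markov_choice

/-- The model with label `e`. -/
def Env.modelOf {Dec Meas Obs Label : Type*} [MeasurableSpace Dec] [MeasurableSpace Meas]
    [MeasurableSpace Obs] [MeasurableSpace Label] (𝓔 : Env Dec Meas Obs Label) (e : Label) :
    Model Dec Meas Obs :=
  ⟨𝓔.model.sectR e, inferInstance⟩

/-- The environment is constrained by `Ps`: for some `P ∈ Ps` it only plays models in `P`. -/
def Env.ConstrainedBy {Dec Meas Obs Label : Type*} [MeasurableSpace Dec] [MeasurableSpace Meas]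
    [MeasurableSpace Obs] [MeasurableSpace Label] (𝓔 : Env Dec Meas Obs Label)
    (Ps : Finset (Set (Model Dec Meas Obs))) : Prop :=
  ∃ P ∈ Ps, ∀ e, 𝓔.modelOf e ∈ P

/-- The learner's part of the first `t` rounds of a full-information history of `n` rounds. -/
def learnerHist {Dec Meas Obs Label : Type*} {n : ℕ} (h : Fin n → Label × (Dec × Meas) × Obs)
    (t : ℕ) (ht : t ≤ n) : Hist Dec Meas Obs t :=
  fun s => (h (s.castLE ht)).2

/-- The learner's part of a full-information history. -/
lemma measurable_learnerHist {Dec Meas Obs Label : Type*} [MeasurableSpace Dec]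
    [MeasurableSpace Meas] [MeasurableSpace Obs] [MeasurableSpace Label] {n : ℕ} (t : ℕ)
    (ht : t ≤ n) :
    Measurable fun h : Fin n → Label × (Dec × Meas) × Obs => learnerHist h t ht :=
  measurable_pi_lambda _ fun s => (measurable_pi_apply (s.castLE ht)).snd

/-- One round: given the full-information history, the model `M^t ∼ μ^t` and the decision
`(π^t, φ^t) ∼ q^t` are drawn independently, and then `o^t ∼ M^t(π^t, φ^t)`. -/
def roundKernel {Dec Meas Obs Label : Type*} [MeasurableSpace Dec] [MeasurableSpace Meas]
    [MeasurableSpace Obs] [MeasurableSpace Label] (A : Alg Dec Meas Obs)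
    (𝓔 : Env Dec Meas Obs Label) (t : ℕ) :
    Kernel (Fin t → Label × (Dec × Meas) × Obs) (Label × (Dec × Meas) × Obs) :=
  (((𝓔.choice t) ×ₖ ((A.q t).comap (fun h => learnerHist h t le_rfl)
      (measurable_learnerHist t le_rfl))) ⊗ₖ
    (𝓔.model.comap (fun z : (Fin t → Label × (Dec × Meas) × Obs) × Label × (Dec × Meas) => z.2)
      measurable_snd)).map MeasurableEquiv.prodAssoc

/-- The law of the first `t` rounds `(M^s, π^s, φ^s, o^s)_{s < t}` of the interaction. -/
def law {Dec Meas Obs Label : Type*} [MeasurableSpace Dec] [MeasurableSpace Meas]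
    [MeasurableSpace Obs] [MeasurableSpace Label] (A : Alg Dec Meas Obs)
    (𝓔 : Env Dec Meas Obs Label) : ∀ t : ℕ, Measure (Fin t → Label × (Dec × Meas) × Obs)
  | 0 => Measure.dirac Fin.elim0
  | t + 1 => ((law A 𝓔 t) ⊗ₘ (roundKernel A 𝓔 t)).map
      fun z => (Fin.snoc (α := fun _ => Label × (Dec × Meas) × Obs) z.1 z.2)

/-- The regret `sup_{π*} ∑_t V^{M^t}(π*) - ∑_t 𝔼_{π∼q^t} V^{M^t}(π)` on a `T`-round history. -/
def regret {Dec Meas Obs Label : Type*} [MeasurableSpace Dec] [MeasurableSpace Meas]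
    [MeasurableSpace Obs] [MeasurableSpace Label] (V : Model Dec Meas Obs → Dec → ℝ)
    (A : Alg Dec Meas Obs) (𝓔 : Env Dec Meas Obs Label) (T : ℕ)
    (h : Fin T → Label × (Dec × Meas) × Obs) : ℝ :=
  (⨆ π : Dec, ∑ t : Fin T, V (𝓔.modelOf (h t).1) π) -
    ∑ t : Fin T, ∫ x, V (𝓔.modelOf (h t).1) x.1 ∂(A.q t (learnerHist h t t.isLt.le))

/-! ### The algorithm ExO⁺ (option `reg`) -/

/-- An information set structure: each `ψ` has a model class and a decision. -/
structure InfoStructure (Dec Meas Obs Ψ : Type*) [MeasurableSpace Dec] [MeasurableSpace Meas]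
    [MeasurableSpace Obs] where
  models : Ψ → Set (Model Dec Meas Obs)
  dec : Ψ → Dec

/-- The elements of a constraint class, with the discrete σ-algebra. -/
def Constraint {Dec Meas Obs : Type*} [MeasurableSpace Dec] [MeasurableSpace Meas]
    [MeasurableSpace Obs] (Ps : Finset (Set (Model Dec Meas Obs))) : Type _ :=
  {P : Set (Model Dec Meas Obs) // P ∈ Ps}

instance instMeasurableSpaceConstraint {Dec Meas Obs : Type*} [MeasurableSpace Dec]
    [MeasurableSpace Meas] [MeasurableSpace Obs] (Ps : Finset (Set (Model Dec Meas Obs))) :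
    MeasurableSpace (Constraint Ps) := ⊤

/-- The information set structure `Ψ = Ps × Π`: the pair `ψ = (P, π)` has model class `P` and
decision `π`. -/
def hybridInfo {Dec Meas Obs : Type*} [MeasurableSpace Dec] [MeasurableSpace Meas]
    [MeasurableSpace Obs] (Ps : Finset (Set (Model Dec Meas Obs))) :
    InfoStructure Dec Meas Obs (Constraint Ps × Dec) where
  models ψ := ψ.1.1
  dec ψ := ψ.2

/-- `sup_{(P, Mbar)} 1 / w{ψ : P ⊆ 𝓜_ψ, max V^Mbar - V^Mbar(π_ψ) ≤ Δ}` over `P ∈ Ps`,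
`Mbar ∈ co(P)`. -/
def priorCover {Dec Meas Obs Ψ : Type*} [MeasurableSpace Dec] [MeasurableSpace Meas]
    [MeasurableSpace Obs] [MeasurableSpace Ψ] (Ps : Finset (Set (Model Dec Meas Obs)))
    (V : Model Dec Meas Obs → Dec → ℝ) (I : InfoStructure Dec Meas Obs Ψ) (Δ : ℝ)
    (w : Measure Ψ) : ENNReal :=
  ⨆ P ∈ Ps, ⨆ Mbar ∈ co P,
    (w {ψ | P ⊆ I.models ψ ∧ bestValue V Mbar - V Mbar (I.dec ψ) ≤ Δ})⁻¹

/-- A weight function of ExO⁺: measurable and uniformly bounded. -/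
def IsWeight {Dec Meas Obs Ψ : Type*} [MeasurableSpace Dec] [MeasurableSpace Meas]
    [MeasurableSpace Obs] [MeasurableSpace Ψ] (ξ : Ψ → Dec × Meas → Obs → ℝ) : Prop :=
  (Measurable fun z : Ψ × (Dec × Meas) × Obs => ξ z.1 z.2.1 z.2.2) ∧
    ∃ B : ℝ, ∀ ψ x o, |ξ ψ x o| ≤ B

/-- The exploration-by-optimization objective `Γ_{w,γ}(q|_Π, q, ξ; M, ψ)`. -/
def exoObjAt {Dec Meas Obs Ψ : Type*} [MeasurableSpace Dec] [MeasurableSpace Meas]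
    [MeasurableSpace Obs] [MeasurableSpace Ψ] (V : Model Dec Meas Obs → Dec → ℝ)
    (I : InfoStructure Dec Meas Obs Ψ) (γ : ℝ) (w : Measure Ψ) (q : Measure (Dec × Meas))
    (ξ : Ψ → Dec × Meas → Obs → ℝ) (M : Model Dec Meas Obs) (ψ : Ψ) : ℝ :=
  (∫ x, (V M (I.dec ψ) - V M x.1) ∂q) -
    γ * ∫ x, ∫ o, ∫ ψ', (1 - Real.exp (ξ ψ' x o - ξ ψ x o)) ∂w ∂(M.1 x) ∂q

/-- The exploration-by-optimization objective
`Γ_{w,γ}(q|_Π, q, ξ) = sup_{ψ, M ∈ 𝓜_ψ} Γ_{w,γ}(q|_Π, q, ξ; M, ψ)`. -/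
def exoObj {Dec Meas Obs Ψ : Type*} [MeasurableSpace Dec] [MeasurableSpace Meas]
    [MeasurableSpace Obs] [MeasurableSpace Ψ] (V : Model Dec Meas Obs → Dec → ℝ)
    (I : InfoStructure Dec Meas Obs Ψ) (γ : ℝ) (w : Measure Ψ) (q : Measure (Dec × Meas))
    (ξ : Ψ → Dec × Meas → Obs → ℝ) : EReal :=
  ⨆ ψ, ⨆ M ∈ I.models ψ, (exoObjAt V I γ w q ξ M ψ : EReal)

/-- The reference distribution `w^t ∝ w¹ · exp(∑_{s < t} ξ^s(·; π^s, φ^s, o^s))` after the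
exponential-weight updates of the first `t` rounds; `ξ^s` may depend on the history. -/
def expWeights {Dec Meas Obs Ψ : Type*} [MeasurableSpace Ψ] (w₁ : Measure Ψ)
    (ξ : ∀ t : ℕ, Hist Dec Meas Obs t → Ψ → Dec × Meas → Obs → ℝ) (t : ℕ)
    (h : Hist Dec Meas Obs t) : Measure Ψ :=
  w₁.tilted fun ψ =>
    ∑ s : Fin t, ξ s (fun r => h (r.castLE s.isLt.le)) ψ (h s).1 (h s).2

/-- `A` is a run of ExO⁺ (option `reg`) for `T` rounds with information set structure `I`, prior
`w₁` and parameter `γ`: in each round, after each history, the pair `(q^t, ξ^t)` minimizes the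
objective `Γ_{w^t,γ}` up to `η` over all distributions of joint decisions and all weight functions,
and `w^t` comes from the exponential-weight updates. Exact minimization is `η = 0`. -/
def IsExOPlus {Dec Meas Obs Ψ : Type*} [MeasurableSpace Dec] [MeasurableSpace Meas]
    [MeasurableSpace Obs] [MeasurableSpace Ψ] (V : Model Dec Meas Obs → Dec → ℝ)
    (I : InfoStructure Dec Meas Obs Ψ) (w₁ : Measure Ψ) (γ η : ℝ) (T : ℕ)
    (A : Alg Dec Meas Obs) : Prop :=
  ∃ ξ : ∀ t : ℕ, Hist Dec Meas Obs t → Ψ → Dec × Meas → Obs → ℝ,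
    ∀ t < T,
      (Measurable fun z : Hist Dec Meas Obs t × Ψ × (Dec × Meas) × Obs =>
        ξ t z.1 z.2.1 z.2.2.1 z.2.2.2) ∧
      ∀ h : Hist Dec Meas Obs t, IsWeight (ξ t h) ∧
        ∀ (q' : Measure (Dec × Meas)) (ξ' : Ψ → Dec × Meas → Obs → ℝ),
          IsProbabilityMeasure q' → IsWeight ξ' →
          exoObj V I γ (expWeights w₁ ξ t h) (A.q t h) (ξ t h) ≤
            exoObj V I γ (expWeights w₁ ξ t h) q' ξ' + (η : EReal)

end HybridDMSO

end

/-! Two facts carry the proof. For every reference distribution `w`, some pair `(q, ξ)` makes the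
objective Γ at most of order √(log T) · (r-dec + CV ε). And the exponential weights keep the
cumulative information gain of a suitable `ψ` at most of order T ε². Summing Γ over the rounds at
that `ψ` bounds the regret.

The bound on Γ (`Observable.exists_exoObj_le`) is a minimax argument. A mixture of two strategies
can be reparametrized so that Γ becomes convex-like in `(q, ξ)` (`exists_convex_combination`).
Compactness reduces the opponent's choices `(ψ, M)` to finitely many, so a separation argument
(`exists_forall_lt_of_convexLike`) lets the opponent's prior be known. Against a known prior, take ξ
= ½ log(posterior / w). Whatever `w` is, its average gain is, up to smoothing, at least half the
average squared Hellinger distance between the models conditioned on `ψ` and their overall mixture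
(`sum_mul_integral_exp_le`).

What remains is an offset bound (`Observable.exists_offset`): one `q` for which the suboptimality of
every model is at most γ 𝔼 D_H² plus the target. The constrained DEC supplies a good distribution
only for models within a given radius of the reference. Mixing near-optimal distributions of the
dyadic radii 2^j ε covers all models at once; about log T radii are needed, and the weights are
balanced so that they cost only √(log T). Half of the mass pairs each decision with its measurement
`φ_π`, so that values under the model and under the reference can be compared.

For the probabilistic part, divide the cost of `ψ` in each round by its conditional mean. The
products form a nonnegative supermartingale dominating Z exp(-L(ψ)) exp(gain(ψ)), where L is the
exponent of the weights and Z their normalizer (`Admissible.le_ratioProcess`). Averaging over the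
prior and applying Markov's inequality gives a single good event. On it, the Cauchy-Schwarz bound
∫_S e^L · ∫_S e^(-L) ≥ w₁(S)² produces, in every set S of positive prior mass, an element of gain at
most log(1/δ) + 2 log(1/w₁(S)) (`Admissible.exists_infoGain_le`). Uniformity in S is essential: the
set needed consists of the `ψ` whose class contains the true constraint set and whose decision is
Δ-optimal for the average of the realized models, so it depends on the history. Since values are
affine, the best value of that average model is the comparator of the regret.

Measurable runs exist because near-minimizers may be taken with rational weights that are constant
on finitely many cells; the state of the algorithm is then countable. -/

set_option linter.unusedSectionVars false

namespace HybridDMSO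

/-! ### Squared Hellinger distance and its densities -/

section Hellinger

variable {Obs : Type*} [MeasurableSpace Obs]

lemma sq_sqrt_sub_sqrt_le {a b : ℝ} (ha : 0 ≤ a) (hb : 0 ≤ b) :
    (Real.sqrt a - Real.sqrt b) ^ 2 ≤ a + b := by
  nlinarith [Real.sq_sqrt ha, Real.sq_sqrt hb,
    mul_nonneg (Real.sqrt_nonneg a) (Real.sqrt_nonneg b)]

lemma hellingerSq_le_one (P Q : Measure Obs) [IsProbabilityMeasure P] [IsProbabilityMeasure Q] :
    hellingerSq P Q ≤ 1 := by
  have h : ∫⁻ o, ENNReal.ofReal ((Real.sqrt (P.rnDeriv (P + Q) o).toReal -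
      Real.sqrt (Q.rnDeriv (P + Q) o).toReal) ^ 2) ∂(P + Q) ≤ 2 := by
    calc _ ≤ ∫⁻ o, (P.rnDeriv (P + Q) o + Q.rnDeriv (P + Q) o) ∂(P + Q) := by
          refine lintegral_mono fun o => ?_
          refine (ENNReal.ofReal_le_ofReal (sq_sqrt_sub_sqrt_le ENNReal.toReal_nonneg
            ENNReal.toReal_nonneg)).trans ?_
          rw [ENNReal.ofReal_add ENNReal.toReal_nonneg ENNReal.toReal_nonneg]
          exact add_le_add ENNReal.ofReal_toReal_le ENNReal.ofReal_toReal_le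
      _ = ∫⁻ o, P.rnDeriv (P + Q) o ∂(P + Q) + ∫⁻ o, Q.rnDeriv (P + Q) o ∂(P + Q) :=
          lintegral_add_left (Measure.measurable_rnDeriv _ _) _
      _ ≤ P Set.univ + Q Set.univ := add_le_add Measure.lintegral_rnDeriv_le
          Measure.lintegral_rnDeriv_le
      _ = 2 := by simp; norm_num
  calc hellingerSq P Q ≤ 2⁻¹ * 2 := mul_le_mul_right h _
    _ = 1 := ENNReal.inv_mul_cancel (by simp) (by simp)

lemma hellingerSq_ne_top (P Q : Measure Obs) [IsProbabilityMeasure P] [IsProbabilityMeasure Q] :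
    hellingerSq P Q ≠ ⊤ :=
  ((hellingerSq_le_one P Q).trans_lt ENNReal.one_lt_top).ne

lemma hellinger_nonneg (P Q : Measure Obs) : 0 ≤ hellinger P Q := Real.sqrt_nonneg _

lemma hellinger_sq (P Q : Measure Obs) : hellinger P Q ^ 2 = (hellingerSq P Q).toReal :=
  Real.sq_sqrt ENNReal.toReal_nonneg

lemma toReal_hellingerSq_le_one (P Q : Measure Obs) [IsProbabilityMeasure P]
    [IsProbabilityMeasure Q] : (hellingerSq P Q).toReal ≤ 1 :=
  ENNReal.toReal_le_of_le_ofReal zero_le_one (by simpa using hellingerSq_le_one P Q)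

lemma hellinger_le_one (P Q : Measure Obs) [IsProbabilityMeasure P]
    [IsProbabilityMeasure Q] : hellinger P Q ≤ 1 :=
  Real.sqrt_le_one.mpr (toReal_hellingerSq_le_one P Q)

lemma integrable_sq_sqrt_rnDeriv_sub (P Q : Measure Obs) [IsProbabilityMeasure P]
    [IsProbabilityMeasure Q] :
    Integrable (fun o => (Real.sqrt (P.rnDeriv (P + Q) o).toReal -
      Real.sqrt (Q.rnDeriv (P + Q) o).toReal) ^ 2) (P + Q) := by
  refine Integrable.mono' (g := fun o => (P.rnDeriv (P + Q) o).toReal +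
      (Q.rnDeriv (P + Q) o).toReal) (Measure.integrable_toReal_rnDeriv.add
      Measure.integrable_toReal_rnDeriv) ?_ ?_
  · have h1 := (Measure.measurable_rnDeriv P (P + Q)).ennreal_toReal.sqrt
    have h2 := (Measure.measurable_rnDeriv Q (P + Q)).ennreal_toReal.sqrt
    exact ((h1.sub h2).pow_const 2).aestronglyMeasurable
  · refine ae_of_all _ fun o => ?_
    rw [Real.norm_of_nonneg (sq_nonneg _)]
    exact sq_sqrt_sub_sqrt_le ENNReal.toReal_nonneg ENNReal.toReal_nonneg

lemma toReal_hellingerSq (P Q : Measure Obs) [IsProbabilityMeasure P] [IsProbabilityMeasure Q] :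
    (hellingerSq P Q).toReal = 2⁻¹ * ∫ o, (Real.sqrt (P.rnDeriv (P + Q) o).toReal -
      Real.sqrt (Q.rnDeriv (P + Q) o).toReal) ^ 2 ∂(P + Q) := by
  rw [hellingerSq, ENNReal.toReal_mul,
    integral_eq_lintegral_of_nonneg_ae (ae_of_all _ fun o => sq_nonneg _)
      (integrable_sq_sqrt_rnDeriv_sub P Q).aestronglyMeasurable]
  simp

/-- Integrals of bounded functions are stable under small Hellinger perturbations. -/
lemma abs_integral_sub_integral_le (P Q : Measure Obs) [IsProbabilityMeasure P]
    [IsProbabilityMeasure Q] {s B : ℝ} (hs : 0 < s) (hPQ : hellinger P Q ≤ s) {h : Obs → ℝ}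
    (hm : Measurable h) (hB : ∀ o, |h o| ≤ B) :
    |∫ o, h o ∂P - ∫ o, h o ∂Q| ≤ 3 * s * B := by
  have hP : P ≪ P + Q := Measure.AbsolutelyContinuous.rfl.add_right Q
  have hQ : Q ≪ P + Q := by
    rw [add_comm]; exact Measure.AbsolutelyContinuous.rfl.add_right P
  set p := fun o => (P.rnDeriv (P + Q) o).toReal with hp
  set q := fun o => (Q.rnDeriv (P + Q) o).toReal with hq
  have hpm : Measurable p := (Measure.measurable_rnDeriv P (P + Q)).ennreal_toReal
  have hqm : Measurable q := (Measure.measurable_rnDeriv Q (P + Q)).ennreal_toReal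
  have hpi : Integrable p (P + Q) := Measure.integrable_toReal_rnDeriv
  have hqi : Integrable q (P + Q) := Measure.integrable_toReal_rnDeriv
  have hp0 : ∀ o, 0 ≤ p o := fun o => ENNReal.toReal_nonneg
  have hq0 : ∀ o, 0 ≤ q o := fun o => ENNReal.toReal_nonneg
  have hhP : Integrable (fun o => p o * h o) (P + Q) := by
    refine hpi.mul_bdd hm.aestronglyMeasurable (ae_of_all _ hB)
  have hhQ : Integrable (fun o => q o * h o) (P + Q) := by
    refine hqi.mul_bdd hm.aestronglyMeasurable (ae_of_all _ hB)
  have hB0 : 0 ≤ B := by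
    obtain ⟨o⟩ := P.nonempty_of_neZero
    exact (abs_nonneg _).trans (hB o)
  rw [← integral_toReal_rnDeriv_mul hP, ← integral_toReal_rnDeriv_mul hQ, ← integral_sub hhP hhQ]
  have hD := integrable_sq_sqrt_rnDeriv_sub P Q
  -- AM-GM in place of Cauchy-Schwarz: |√p - √q| |√p + √q| ≤ (2s)⁻¹ (√p - √q)² + (s/2) (√p + √q)²,
  -- and (√p + √q)² ≤ 2 (p + q). After integration the two terms contribute s and 2s, whence the
  -- factor 3.
  have key : ∀ o, |p o * h o - q o * h o| ≤
      B * ((2 * s)⁻¹ * (Real.sqrt (p o) - Real.sqrt (q o)) ^ 2 + s * (p o + q o)) := by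
    intro o
    have h1 : |p o * h o - q o * h o| = |p o - q o| * |h o| := by rw [← abs_mul]; congr 1; ring
    rw [h1, mul_comm]
    refine mul_le_mul (hB o) ?_ (abs_nonneg _) hB0
    have e1 := Real.sq_sqrt (hp0 o)
    have e2 := Real.sq_sqrt (hq0 o)
    set a := Real.sqrt (p o)
    set b := Real.sqrt (q o)
    rw [← e1, ← e2, sq_sub_sq, abs_mul]
    have h2 : (2 * s)⁻¹ * (a - b) ^ 2 + s * (a ^ 2 + b ^ 2) =
      (2 * s)⁻¹ * ((a - b) ^ 2 + 2 * s ^ 2 * (a ^ 2 + b ^ 2)) := by field_simp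
    rw [h2, inv_mul_eq_div, le_div_iff₀ (by positivity)]
    have h3 : |a + b| ^ 2 ≤ 2 * (a ^ 2 + b ^ 2) := by rw [sq_abs]; nlinarith [sq_nonneg (a - b)]
    have h4 : (a - b) ^ 2 = |a - b| ^ 2 := (sq_abs _).symm
    rw [h4]
    nlinarith [sq_nonneg (|a - b| - s * |a + b|), mul_le_mul_of_nonneg_left h3 (sq_nonneg s)]
  have hi : Integrable (fun o => B * ((2 * s)⁻¹ * (Real.sqrt (p o) - Real.sqrt (q o)) ^ 2 +
      s * (p o + q o))) (P + Q) :=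
    ((hD.const_mul _).add ((hpi.add hqi).const_mul _)).const_mul _
  calc |∫ o, (p o * h o - q o * h o) ∂(P + Q)| ≤ ∫ o, |p o * h o - q o * h o| ∂(P + Q) :=
        abs_integral_le_integral_abs
    _ ≤ ∫ o, B * ((2 * s)⁻¹ * (Real.sqrt (p o) - Real.sqrt (q o)) ^ 2 + s * (p o + q o)) ∂(P + Q) :=
        integral_mono (hhP.sub hhQ).abs hi key
    _ = B * ((2 * s)⁻¹ * (2 * (hellingerSq P Q).toReal) + s * (1 + 1)) := by
        have hD' : Integrable (fun o => (2 * s)⁻¹ * (Real.sqrt (p o) - Real.sqrt (q o)) ^ 2)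
          (P + Q) := hD.const_mul _
        have hpq : Integrable (fun o => s * (p o + q o)) (P + Q) := (hpi.add hqi).const_mul _
        rw [integral_const_mul, integral_add hD' hpq,
          integral_const_mul, integral_const_mul, integral_add hpi hqi, toReal_hellingerSq,
          Measure.integral_toReal_rnDeriv hP, Measure.integral_toReal_rnDeriv hQ]
        simp [hp, hq]
    _ ≤ B * ((2 * s)⁻¹ * (2 * s ^ 2) + s * (1 + 1)) := by
        gcongr
        rw [← hellinger_sq]
        exact pow_le_pow_left₀ (hellinger_nonneg _ _) hPQ 2
    _ = 3 * s * B := by field_simp; ring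

/-- Hellinger distance in terms of a density of `P` with respect to `Q`. -/
lemma toReal_hellingerSq_of_withDensity (P Q : Measure Obs) [IsProbabilityMeasure P]
    [IsProbabilityMeasure Q] {f : Obs → ℝ} (hf : Measurable f) (hf0 : ∀ o, 0 ≤ f o)
    (hfi : Integrable f Q) (hPQ : P = Q.withDensity fun o => ENNReal.ofReal (f o)) :
    (hellingerSq P Q).toReal = 1 - ∫ o, Real.sqrt (f o) ∂Q := by
  have hsum : P + Q = Q.withDensity fun o => ENNReal.ofReal (1 + f o) := by
    have : (fun o => ENNReal.ofReal (1 + f o)) = 1 + fun o => ENNReal.ofReal (f o) := by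
      ext o; simp [ENNReal.ofReal_add zero_le_one (hf0 o)]
    rw [this, withDensity_add_left measurable_one, withDensity_one, ← hPQ, add_comm]
  -- Change of dominating measure: P + Q has density 1 + f with respect to Q, so densities relative
  -- to Q are divided by 1 + f.
  have aux : ∀ g : Obs → ℝ, Measurable g → (∀ o, 0 ≤ g o) →
      (Q.withDensity fun o => ENNReal.ofReal (g o)) =
      (P + Q).withDensity fun o => ENNReal.ofReal (g o / (1 + f o)) := by
    intro g hg hg0
    rw [hsum, ← withDensity_mul _ (by fun_prop) (by fun_prop)]
    congr 1
    ext o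
    have := hf0 o
    rw [Pi.mul_apply, ← ENNReal.ofReal_mul (by positivity)]
    congr 1
    field_simp
  have hP' : P = (P + Q).withDensity fun o => ENNReal.ofReal (f o / (1 + f o)) := by
    conv_lhs => rw [hPQ]
    exact aux f hf hf0
  have hQ' : Q = (P + Q).withDensity fun o => ENNReal.ofReal (1 / (1 + f o)) := by
    have := aux (fun _ => 1) measurable_const (fun _ => zero_le_one)
    simpa using this
  have hPd : P.rnDeriv (P + Q) =ᵐ[P + Q] fun o => ENNReal.ofReal (f o / (1 + f o)) := by
    have := Measure.rnDeriv_withDensity (P + Q)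
      (f := fun o => ENNReal.ofReal (f o / (1 + f o))) (by fun_prop)
    rwa [← hP'] at this
  have hQd : Q.rnDeriv (P + Q) =ᵐ[P + Q] fun o => ENNReal.ofReal (1 / (1 + f o)) := by
    have := Measure.rnDeriv_withDensity (P + Q)
      (f := fun o => ENNReal.ofReal (1 / (1 + f o))) (by fun_prop)
    rwa [← hQ'] at this
  have hsi : Integrable (fun o => Real.sqrt (f o)) Q := by
    refine ((integrable_const (1 : ℝ)).add hfi).mono' hf.sqrt.aestronglyMeasurable
      (ae_of_all _ fun o => ?_)
    rw [Real.norm_of_nonneg (Real.sqrt_nonneg _)]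
    simp only [Pi.add_apply]
    nlinarith [Real.sq_sqrt (hf0 o), sq_nonneg (Real.sqrt (f o) - 1)]
  have hf1 : ∫ o, f o ∂Q = 1 := by
    rw [integral_eq_lintegral_of_nonneg_ae (ae_of_all _ hf0) hf.aestronglyMeasurable]
    have : P Set.univ = 1 := measure_univ
    rw [hPQ, withDensity_apply _ MeasurableSet.univ, Measure.restrict_univ] at this
    rw [this]; simp
  rw [toReal_hellingerSq]
  have h1 : ∫ o, (Real.sqrt (P.rnDeriv (P + Q) o).toReal -
      Real.sqrt (Q.rnDeriv (P + Q) o).toReal) ^ 2 ∂(P + Q) =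
      ∫ o, (Real.sqrt (f o / (1 + f o)) - Real.sqrt (1 / (1 + f o))) ^ 2 ∂(P + Q) := by
    refine integral_congr_ae ?_
    filter_upwards [hPd, hQd] with o h1 h2
    have := hf0 o
    rw [h1, h2, ENNReal.toReal_ofReal (by positivity), ENNReal.toReal_ofReal (by positivity)]
  rw [h1]
  conv_lhs => rw [hsum]
  rw [integral_withDensity_eq_integral_toReal_smul (by fun_prop)
    (ae_of_all _ fun o => ENNReal.ofReal_lt_top)]
  have h2 : ∀ o, (ENNReal.ofReal (1 + f o)).toReal • (Real.sqrt (f o / (1 + f o)) -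
      Real.sqrt (1 / (1 + f o))) ^ 2 = 1 + f o - 2 * Real.sqrt (f o) := by
    intro o
    have h0 := hf0 o
    rw [ENNReal.toReal_ofReal (by positivity), Real.sqrt_div h0, Real.sqrt_div zero_le_one,
      smul_eq_mul, ← sub_div, div_pow, Real.sq_sqrt (by positivity : (0:ℝ) ≤ 1 + f o),
      mul_div_cancel₀ _ (by positivity), Real.sqrt_one]
    nlinarith [Real.sq_sqrt h0]
  simp_rw [h2]
  have h3 : Integrable (fun o => 1 + f o) Q := (integrable_const _).add hfi
  rw [integral_sub h3 (hsi.const_mul _),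
    integral_add (integrable_const _) hfi, integral_const_mul, hf1]
  simp
  ring

end Hellinger

/-- Derivatives taken separately at each `x` need not be jointly measurable. The kernel derivative
is a jointly measurable version that agrees with them almost everywhere; its existence rests on the
countability assumption. -/
lemma measurable_hellingerSq {X Obs : Type*} [MeasurableSpace X] [MeasurableSpace Obs]
    [MeasurableSpace.CountableOrCountablyGenerated X Obs] (κ η : Kernel X Obs)
    [IsFiniteKernel κ] [IsFiniteKernel η] :
    Measurable fun x => hellingerSq (κ x) (η x) := by
  have h : ∀ x, hellingerSq (κ x) (η x) = 2⁻¹ * ∫⁻ o, ENNReal.ofReal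
      ((Real.sqrt (Kernel.rnDeriv κ (κ + η) x o).toReal -
        Real.sqrt (Kernel.rnDeriv η (κ + η) x o).toReal) ^ 2) ∂((κ + η) x) := by
    intro x
    rw [hellingerSq]
    congr 1
    refine lintegral_congr_ae ?_
    filter_upwards [Kernel.rnDeriv_eq_rnDeriv_measure (κ := κ) (η := κ + η) (a := x),
      Kernel.rnDeriv_eq_rnDeriv_measure (κ := η) (η := κ + η) (a := x)] with o h1 h2
    rw [h1, h2]
    rfl
  simp_rw [h]
  refine Measurable.const_mul (Measurable.lintegral_kernel_prod_right' (κ := κ + η)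
    (f := fun p => ENNReal.ofReal ((Real.sqrt (Kernel.rnDeriv κ (κ + η) p.1 p.2).toReal -
        Real.sqrt (Kernel.rnDeriv η (κ + η) p.1 p.2).toReal) ^ 2)) ?_) _
  have h1 := (Kernel.measurable_rnDeriv κ (κ + η)).ennreal_toReal.sqrt
  have h2 := (Kernel.measurable_rnDeriv η (κ + η)).ennreal_toReal.sqrt
  exact ((h1.sub h2).pow_const 2).ennreal_ofReal

/-! ### Mixtures of models, bounds on values, and scaling of the regret DEC -/

section Mixtures

variable {Dec Meas Obs : Type*} [MeasurableSpace Dec] [MeasurableSpace Meas] [MeasurableSpace Obs]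

lemma exists_mixture {ι : Type*} [Fintype ι] (a : ι → NNReal) (ha : ∑ i, a i = 1)
    (M : ι → Model Dec Meas Obs) :
    ∃ N : Model Dec Meas Obs, ∀ x, N.1 x = ∑ i, a i • (M i).1 x := by
  let κ : Kernel (Dec × Meas) Obs :=
    { toFun := fun x => ∑ i, a i • (M i).1 x
      measurable' := by
        refine Measure.measurable_of_measurable_coe _ fun s hs => ?_
        simp only [Measure.coe_finsetSum, Measure.coe_nnreal_smul_apply, Finset.sum_apply]
        exact Finset.measurable_sum _ fun i _ =>
          ((M i).1.measurable_coe hs).const_mul _ }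
  refine ⟨⟨κ, ⟨fun x => ⟨?_⟩⟩⟩, fun x => rfl⟩
  change (∑ i, a i • (M i).1 x) Set.univ = 1
  simp only [Measure.coe_finsetSum, Measure.coe_nnreal_smul_apply, Finset.sum_apply, measure_univ,
    mul_one]
  exact_mod_cast ha

lemma mem_co_of_eq_sum {ι : Type*} [Fintype ι] {a : ι → NNReal} (ha : ∑ i, a i = 1)
    {M : ι → Model Dec Meas Obs} {N : Model Dec Meas Obs} (hN : ∀ x, N.1 x = ∑ i, a i • (M i).1 x)
    {S : Set (Model Dec Meas Obs)} (hM : ∀ i, M i ∈ S) : N ∈ co S := by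
  let e := (Fintype.equivFin ι).symm
  refine ⟨Fintype.card ι, a ∘ e, M ∘ e, fun i => hM _, ?_, fun x => ?_⟩
  · rw [← ha]; exact e.sum_comp a
  · rw [hN x]; exact (e.sum_comp fun i => a i • (M i).1 x).symm

lemma subset_co (S : Set (Model Dec Meas Obs)) : S ⊆ co S := fun M hM =>
  mem_co_of_eq_sum (ι := Unit) (a := fun _ => 1) (M := fun _ => M) (by simp)
    (fun x => by simp) fun _ => hM

variable {Ps : Finset (Set (Model Dec Meas Obs))}

lemma co_subset_powClass {P : Set (Model Dec Meas Obs)} (hP : P ∈ Ps) : co P ⊆ powClass Ps :=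
  Set.subset_iUnion₂_of_subset P hP subset_rfl

lemma subset_powClass {P : Set (Model Dec Meas Obs)} (hP : P ∈ Ps) : P ⊆ powClass Ps :=
  (subset_co P).trans (co_subset_powClass hP)

lemma nonempty_of_mem_co {S : Set (Model Dec Meas Obs)} {N : Model Dec Meas Obs} (hN : N ∈ co S) :
    S.Nonempty := by
  obtain ⟨n, a, M, hM, h1, -⟩ := hN
  rcases n with _ | n
  · simp at h1
  · exact ⟨_, hM 0⟩

variable {V : Model Dec Meas Obs → Dec → ℝ} {Vmax CV : ℝ}

lemma Observable.affine_fintype (hO : Observable Ps V Vmax CV) {ι : Type*} [Fintype ι]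
    {a : ι → NNReal} (ha : ∑ i, a i = 1) {M : ι → Model Dec Meas Obs} {N : Model Dec Meas Obs}
    (hM : ∀ i, M i ∈ powClass Ps) (hN : N ∈ powClass Ps)
    (hMN : ∀ x, N.1 x = ∑ i, a i • (M i).1 x) (π : Dec) :
    V N π = ∑ i, (a i : ℝ) * V (M i) π := by
  let e := (Fintype.equivFin ι).symm
  rw [hO.affine (Fintype.card ι) (a ∘ e) (M ∘ e) N (fun i => hM _) hN ⟨?_, fun x => ?_⟩ π]
  · exact e.sum_comp fun i => (a i : ℝ) * V (M i) π
  · rw [← ha]; exact e.sum_comp a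
  · rw [hMN x]; exact (e.sum_comp fun i => a i • (M i).1 x).symm

lemma Observable.measurable_of_mem (hO : Observable Ps V Vmax CV) {M : Model Dec Meas Obs}
    (hM : M ∈ powClass Ps) : Measurable (V M) := hO.measurable M (subset_co _ hM)

/-- Reference models may leave the class on which values lie in [0, Vmax]. The Lipschitz condition
against any member of the class, with Hellinger distance at most 1, costs one `CV` on each side. -/
lemma Observable.mem_Icc_co (hO : Observable Ps V Vmax CV) (hCV : 0 < CV) {M : Model Dec Meas Obs}
    (hM : M ∈ co (powClass Ps)) (π : Dec) : V M π ∈ Set.Icc (-CV) (Vmax + CV) := by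
  obtain ⟨φ, -, hφ⟩ := hO.lipschitz
  obtain ⟨N, hN⟩ := nonempty_of_mem_co hM
  have h1 := hφ π N hN M hM
  have h2 : CV * hellinger (N.1 (π, φ π)) (M.1 (π, φ π)) ≤ CV :=
    mul_le_of_le_one_right hCV.le (hellinger_le_one _ _)
  have h3 := hO.mem_Icc N hN π
  rw [abs_le] at h1
  exact ⟨by linarith [h3.1], by linarith [h3.2]⟩

lemma Observable.bddAbove (hO : Observable Ps V Vmax CV) (hCV : 0 < CV) {M : Model Dec Meas Obs}
    (hM : M ∈ co (powClass Ps)) : BddAbove (Set.range (V M)) :=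
  ⟨Vmax + CV, by rintro _ ⟨π, rfl⟩; exact (hO.mem_Icc_co hCV hM π).2⟩

lemma Observable.le_bestValue (hO : Observable Ps V Vmax CV) (hCV : 0 < CV)
    {M : Model Dec Meas Obs} (hM : M ∈ co (powClass Ps)) (π : Dec) : V M π ≤ bestValue V M :=
  le_ciSup (hO.bddAbove hCV hM) π

lemma Observable.integrable (hO : Observable Ps V Vmax CV) (hCV : 0 < CV)
    {M : Model Dec Meas Obs} (hM : M ∈ co (powClass Ps)) (p : Measure (Dec × Meas))
    [IsFiniteMeasure p] : Integrable (fun x => V M x.1) p := by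
  refine Integrable.of_bound ((hO.measurable M hM).comp measurable_fst).aestronglyMeasurable
    (max CV (Vmax + CV)) (ae_of_all _ fun x => ?_)
  have := hO.mem_Icc_co hCV hM x.1
  exact abs_le_max_abs_abs this.1 this.2 |>.trans (by
    rw [abs_neg, abs_of_pos hCV]
    refine max_le (le_max_left _ _) ?_
    rcases abs_cases (Vmax + CV) with h | h
    · rw [h.1]; exact le_max_right _ _
    · rw [h.1]; linarith [this.1, this.2, le_max_left CV (Vmax + CV)])

lemma Observable.bestValue_le [Nonempty Dec] (hO : Observable Ps V Vmax CV) (hCV : 0 < CV)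
    {M : Model Dec Meas Obs} (hM : M ∈ co (powClass Ps)) : bestValue V M ≤ Vmax + CV :=
  ciSup_le fun π => (hO.mem_Icc_co hCV hM π).2

lemma mem_co_of_mem_union {N M : Model Dec Meas Obs} (hN : N ∈ co (powClass Ps))
    (hM : M ∈ powClass Ps ∪ {N}) : M ∈ co (powClass Ps) := by
  rcases hM with hM | hM
  · exact subset_co _ hM
  · rw [Set.mem_singleton_iff.mp hM]; exact hN

/-- A point mass already gives the bound `Vmax + 2 * CV`. Finiteness is what makes passing to
`toReal` faithful. -/
lemma Observable.rDec_ne_top [Nonempty Dec] (hO : Observable Ps V Vmax CV) (hCV : 0 < CV) (ε : ℝ) :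
    rDec V (powClass Ps) ε ≠ ⊤ := by
  obtain ⟨φ, -, -⟩ := hO.lipschitz
  obtain ⟨π⟩ := (inferInstance : Nonempty Dec)
  refine ne_top_of_le_ne_top (b := ENNReal.ofReal (Vmax + CV + CV)) ENNReal.ofReal_ne_top ?_
  refine iSup₂_le fun N hN => (iInf_le _ ⟨Measure.dirac (π, φ π), inferInstance⟩).trans ?_
  refine iSup₂_le fun M hM => ?_
  have hM' := mem_co_of_mem_union hN hM.1
  refine (lintegral_mono fun x => ENNReal.ofReal_le_ofReal
    (q := Vmax + CV + CV) ?_).trans (by simp)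
  have h1 := hO.bestValue_le hCV hM'
  have h2 := (hO.mem_Icc_co hCV hM' x.1).1
  linarith

/-- The squared Hellinger distance never exceeds 1, so from scale 1 on the constraint is void. -/
lemma rDec_of_one_le (V : Model Dec Meas Obs → Dec → ℝ) (𝓜 : Set (Model Dec Meas Obs)) {ε : ℝ}
    (hε : 1 ≤ ε) : rDec V 𝓜 ε = rDec V 𝓜 1 := by
  have h : ∀ (p : ProbabilityMeasure (Dec × Meas)) (M N : Model Dec Meas Obs) (ε : ℝ), 1 ≤ ε →
      ∫⁻ x, hellingerSq (M.1 x) (N.1 x) ∂(p : Measure (Dec × Meas)) ≤ ENNReal.ofReal (ε ^ 2) := by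
    intro p M N ε hε
    refine (lintegral_mono fun x => hellingerSq_le_one _ _).trans ?_
    rw [lintegral_const, measure_univ, mul_one]
    exact ENNReal.one_le_ofReal.mpr (one_le_pow₀ hε)
  unfold rDec rDecRef
  simp only [h _ _ _ ε hε, h _ _ _ 1 le_rfl]

/-- Moderate decay speaks only of scales up to 1. Beyond that the DEC is constant while the right
side grows, so the linear bound persists at every dyadic scale. -/
lemma rDec_toReal_le_mul {c : ℝ} (hc : 1 ≤ c)
    (hd : ModerateDecay c (fun ε => (rDec V (powClass Ps) ε).toReal)) {ε ε' : ℝ} (hε : 0 < ε)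
    (hεε' : ε ≤ ε') :
    (rDec V (powClass Ps) ε').toReal ≤ c * (rDec V (powClass Ps) ε).toReal / ε * ε' := by
  have hε' : 0 < ε' := hε.trans_le hεε'
  have key : ∀ ε ε' : ℝ, 0 < ε → ε ≤ ε' → ε' ≤ 1 →
      (rDec V (powClass Ps) ε').toReal ≤ c * (rDec V (powClass Ps) ε).toReal / ε * ε' := by
    intro ε ε' h0 h1 h2
    have := hd ε ε' h0 h1 h2
    rwa [div_le_iff₀ (h0.trans_le h1), ← mul_div_assoc] at this
  rcases le_or_gt ε' 1 with h1 | h1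
  · exact key ε ε' hε hεε' h1
  rw [rDec_of_one_le V _ h1.le]
  have h0 : 0 ≤ (rDec V (powClass Ps) ε).toReal := ENNReal.toReal_nonneg
  rcases le_or_gt ε 1 with h2 | h2
  · refine (key ε 1 hε h2 le_rfl).trans ?_
    gcongr
  · rw [← rDec_of_one_le V _ h2.le, mul_div_assoc, mul_assoc, div_mul_eq_mul_div, ← mul_div_assoc,
      le_div_iff₀ hε, mul_left_comm]
    refine mul_le_mul_of_nonneg_left ?_ h0
    nlinarith

variable [MeasurableSpace.CountableOrCountablyGenerated (Dec × Meas) Obs]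

lemma measurable_hellinger_sq (M N : Model Dec Meas Obs) :
    Measurable fun x => hellinger (M.1 x) (N.1 x) ^ 2 := by
  simp_rw [hellinger_sq]
  exact (measurable_hellingerSq M.1 N.1).ennreal_toReal

lemma integrable_hellinger_sq (M N : Model Dec Meas Obs) (p : Measure (Dec × Meas))
    [IsFiniteMeasure p] : Integrable (fun x => hellinger (M.1 x) (N.1 x) ^ 2) p := by
  refine Integrable.of_bound (measurable_hellinger_sq M N).aestronglyMeasurable 1
    (ae_of_all _ fun x => ?_)
  rw [Real.norm_of_nonneg (sq_nonneg _)]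
  exact pow_le_one₀ (hellinger_nonneg _ _) (hellinger_le_one _ _)

lemma lintegral_hellingerSq (M N : Model Dec Meas Obs) (p : Measure (Dec × Meas))
    [IsFiniteMeasure p] : ∫⁻ x, hellingerSq (M.1 x) (N.1 x) ∂p =
      ENNReal.ofReal (∫ x, hellinger (M.1 x) (N.1 x) ^ 2 ∂p) := by
  rw [ofReal_integral_eq_lintegral_ofReal (integrable_hellinger_sq M N p)
    (ae_of_all _ fun _ => sq_nonneg _)]
  refine lintegral_congr fun x => ?_
  rw [hellinger_sq, ENNReal.ofReal_toReal (hellingerSq_ne_top _ _)]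

/-- A distribution that nearly attains the regret DEC for the reference model `N`. -/
lemma Observable.exists_near_rDec [Nonempty Dec] (hO : Observable Ps V Vmax CV) (hCV : 0 < CV)
    {N : Model Dec Meas Obs} (hN : N ∈ co (powClass Ps)) (ε : ℝ) {s : ℝ} (hs : 0 < s) :
    ∃ p : ProbabilityMeasure (Dec × Meas), ∀ M ∈ powClass Ps ∪ {N},
      ∫ x, hellinger (M.1 x) (N.1 x) ^ 2 ∂(p : Measure (Dec × Meas)) ≤ ε ^ 2 →
      bestValue V M - ∫ x, V M x.1 ∂(p : Measure (Dec × Meas)) ≤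
        (rDec V (powClass Ps) ε).toReal + s := by
  have hlt : rDecRef V (powClass Ps ∪ {N}) ε N <
      ENNReal.ofReal ((rDec V (powClass Ps) ε).toReal + s) := by
    refine (le_iSup₂ (f := fun N _ => rDecRef V (powClass Ps ∪ {N}) ε N) N hN).trans_lt ?_
    change rDec V (powClass Ps) ε < _
    rw [← ENNReal.ofReal_toReal (hO.rDec_ne_top hCV ε), ENNReal.toReal_ofReal ENNReal.toReal_nonneg]
    exact (ENNReal.ofReal_lt_ofReal_iff (by positivity)).mpr (by linarith)
  obtain ⟨p, hp⟩ := iInf_lt_iff.mp hlt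
  refine ⟨p, fun M hM hMN => ?_⟩
  have hM' := mem_co_of_mem_union hN hM
  have h1 : ∫⁻ x, ENNReal.ofReal (bestValue V M - V M x.1) ∂(p : Measure (Dec × Meas)) ≤
      ENNReal.ofReal ((rDec V (powClass Ps) ε).toReal + s) := by
    refine le_trans ?_ hp.le
    refine le_iSup₂ (f := fun (M : Model Dec Meas Obs) _ =>
      ∫⁻ x, ENNReal.ofReal (bestValue V M - V M x.1) ∂(p : Measure (Dec × Meas))) M ⟨hM, ?_⟩
    rw [lintegral_hellingerSq]
    exact ENNReal.ofReal_le_ofReal hMN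
  have hi := hO.integrable hCV hM' (p : Measure (Dec × Meas))
  have hi' : Integrable (fun x : Dec × Meas => bestValue V M - V M x.1) (p : Measure (Dec × Meas)) :=
    (integrable_const _).sub hi
  rw [← ofReal_integral_eq_lintegral_ofReal hi' (ae_of_all _ fun x => by
    simpa using hO.le_bestValue hCV hM' x.1), integral_sub (integrable_const _) hi] at h1
  have h2 := (ENNReal.ofReal_le_ofReal_iff (by positivity)).mp h1
  simpa using h2

end Mixtures

/-! ### Offset bound by mixing dyadic scales -/

section MultiScale

/-- Weights on dyadic scales `2 ^ j`, `j ≤ n`, most of the mass sitting at the finest scale. -/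
lemma exists_dyadic_weights (n : ℕ) {a : ℝ} (ha : 0 ≤ a) (ha1 : a ≤ 1) :
    ∃ l : ℕ → ℝ, (∀ j, a / 2 ^ (j + 1) ≤ l j) ∧ ∑ j ∈ Finset.range (n + 1), l j = 1 ∧
      ∑ j ∈ Finset.range (n + 1), l j * 2 ^ j ≤ 1 + a * (n + 1) / 2 := by
  have h1 : ∀ m : ℕ, ∑ j ∈ Finset.range m, a / 2 ^ (j + 1) = a * (1 - (1 / 2) ^ m) := by
    intro m
    induction m with
    | zero => simp
    | succ m ih =>
      rw [Finset.sum_range_succ, ih, pow_succ, pow_succ, one_div, inv_pow]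
      field_simp
      ring
  have h2 : (0 : ℝ) ≤ (1 / 2) ^ (n + 1) := by positivity
  have h3 : (1 / 2 : ℝ) ^ (n + 1) ≤ 1 := pow_le_one₀ (by norm_num) (by norm_num)
  have h4 : 0 ≤ 1 - a * (1 - (1 / 2) ^ (n + 1)) := by nlinarith
  -- The geometric part contributes a/2 per scale to the sum of l j * 2 ^ j. The missing mass is put
  -- at j = 0, where the factor 2 ^ j is 1.
  refine ⟨fun j => a / 2 ^ (j + 1) + if j = 0 then 1 - a * (1 - (1 / 2) ^ (n + 1)) else 0,
    fun j => ?_, ?_, ?_⟩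
  · simp only
    split_ifs <;> linarith
  · rw [Finset.sum_add_distrib, h1, Finset.sum_ite_eq' (Finset.range (n + 1)) 0]
    simp
  · simp_rw [add_mul]
    rw [Finset.sum_add_distrib]
    have h5 : ∀ j : ℕ, a / 2 ^ (j + 1) * 2 ^ j = a / 2 := by
      intro j; rw [pow_succ]; field_simp
    simp_rw [h5, ite_mul, zero_mul]
    rw [Finset.sum_ite_eq' (Finset.range (n + 1)) 0]
    simp only [Finset.sum_const, Finset.card_range, nsmul_eq_mul, Finset.mem_range,
      Nat.zero_lt_succ, if_true, pow_zero, mul_one]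
    push_cast
    nlinarith

/-- Numerical core of the offset bound: `B`, `B₀` are the best values of the model and of the
reference, `v j`, `u j` their mean values under the j-th distribution, and `b j`, `b' j` the mean
squared Hellinger distances under it and under its observing copy. If `i` is the first scale whose
radius accommodates the model, the DEC at scale `i` gives B ≤ B₀ + 2 D 2^i ε. This controls every
scale, since the DEC at each scale also controls B₀ - u j. When i > 0, the failure of the constraint
at scale i - 1 forces enough information to pay for 2 D 2^i ε. -/
lemma multiscale_bound {n : ℕ} {ε D CV a γ B B₀ : ℝ} {l v u b b' : ℕ → ℝ} (hε : 0 < ε)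
    (hn : 2 ≤ 2 ^ n * ε) (hCV : 0 < CV) (hD : CV ≤ D) (ha : a = 1 / Real.sqrt (n + 1))
    (hγ : γ = 32 * D * Real.sqrt (n + 1) / ε)
    (hl : ∀ j, a / 2 ^ (j + 1) ≤ l j) (hl1 : ∑ j ∈ Finset.range (n + 1), l j = 1)
    (hl2 : ∑ j ∈ Finset.range (n + 1), l j * 2 ^ j ≤ 1 + a * (n + 1) / 2)
    (hb0 : ∀ j, 0 ≤ b j) (hb0' : ∀ j, 0 ≤ b' j) (hb1 : ∀ j, b j ≤ 1) (hb1' : ∀ j, b' j ≤ 1)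
    (hu : ∀ j, B₀ - u j ≤ D * (2 ^ j * ε)) (hu' : ∀ j, u j ≤ B₀)
    (hv : ∀ j, b j ≤ (2 ^ j * ε) ^ 2 → B - v j ≤ D * (2 ^ j * ε))
    (huv : ∀ j t, 0 < t → |v j - u j| ≤ t * b' j + CV ^ 2 / (4 * t)) :
    ∑ j ∈ Finset.range (n + 1), l j * (B - v j - γ * ((b j + b' j) / 2)) ≤
      5 * Real.sqrt (n + 1) * (D * ε) := by
  set R := Real.sqrt (n + 1) with hR
  have hR1 : 1 ≤ R := by rw [hR, Real.one_le_sqrt]; linarith [Nat.cast_nonneg (α := ℝ) n]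
  have hRsq : R ^ 2 = n + 1 := Real.sq_sqrt (by positivity)
  have hD0 : 0 < D := hCV.trans_le hD
  have hγ0 : 0 < γ := by rw [hγ]; positivity
  have ha0 : 0 < a := by rw [ha]; positivity
  have hl0 : ∀ j, 0 ≤ l j := fun j => le_trans (by positivity) (hl j)
  have hex : ∃ i, b i + b' i ≤ (2 ^ i * ε) ^ 2 := ⟨n, by nlinarith [hb1 n, hb1' n]⟩
  classical
  -- Scale `n` always qualifies: its radius is at least 2, and b + b' ≤ 2.
  set i := Nat.find hex with hi
  have hi1 : b i + b' i ≤ (2 ^ i * ε) ^ 2 := Nat.find_spec hex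
  have hin : i ≤ n := Nat.find_min' hex (by nlinarith [hb1 n, hb1' n])
  set ei := 2 ^ i * ε with hei
  have hei0 : 0 < ei := by positivity
  have hB : B ≤ B₀ + 2 * D * ei := by
    have h1 := hv i (by linarith [hb0' i])
    -- This parameter balances both terms of the AM-GM bound to CV * ei / 2, given b' i ≤ ei ^ 2.
    have h2 := huv i (CV / (2 * ei)) (by positivity)
    have h3 : CV / (2 * ei) * b' i + CV ^ 2 / (4 * (CV / (2 * ei))) ≤ CV * ei := by
      have : CV / (2 * ei) * b' i ≤ CV / (2 * ei) * ei ^ 2 := by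
        gcongr; linarith [hb0 i]
      refine (add_le_add_left this _).trans (le_of_eq ?_)
      field_simp
      ring
    have h4 := le_abs_self (v i - u i)
    have h5 : CV * ei ≤ D * ei := by gcongr
    linarith [hu' i]
  -- Half of the information term pays for replacing v j by u j; the other half is kept for `hS`.
  have hj : ∀ j, B - v j - γ * ((b j + b' j) / 2) ≤
      2 * D * ei + D * ε * 2 ^ j + CV ^ 2 / γ - γ / 4 * (b j + b' j) := by
    intro j
    have h2 := huv j (γ / 4) (by positivity)
    have h3 := neg_abs_le (v j - u j)
    have h4 : CV ^ 2 / (4 * (γ / 4)) = CV ^ 2 / γ := by congr 1; ring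
    rw [h4] at h2
    nlinarith [hu j, hb0 j]
  have hS : 2 * D * ei ≤ 2 * D * ε + γ / 4 * ∑ j ∈ Finset.range (n + 1), l j * (b j + b' j) := by
    have hnn : ∀ j, 0 ≤ l j * (b j + b' j) := fun j =>
      mul_nonneg (hl0 j) (add_nonneg (hb0 j) (hb0' j))
    rcases Nat.eq_zero_or_pos i with h0 | h0
    · have : ei = ε := by rw [hei, h0]; simp
      rw [this]
      have := Finset.sum_nonneg (s := Finset.range (n + 1)) fun j _ => hnn j
      nlinarith
    · obtain ⟨k, hk⟩ : ∃ k, i = k + 1 := ⟨i - 1, by omega⟩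
      have hk1 : ¬ (b k + b' k ≤ (2 ^ k * ε) ^ 2) := Nat.find_min hex (by omega)
      push Not at hk1
      have h1 : l k * (b k + b' k) ≤ ∑ j ∈ Finset.range (n + 1), l j * (b j + b' j) :=
        Finset.single_le_sum (f := fun j => l j * (b j + b' j)) (fun j _ => hnn j)
          (Finset.mem_range.mpr (by omega))
      have h2 : a / 2 ^ (k + 1) * (2 ^ k * ε) ^ 2 ≤ l k * (b k + b' k) :=
        mul_le_mul (hl k) hk1.le (by positivity) (hl0 k)
      -- The factor 32 in `γ` is calibrated for this identity; the root in `γ` cancels the one in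
      -- `a`.
      have h3 : γ / 4 * (a / 2 ^ (k + 1) * (2 ^ k * ε) ^ 2) = 2 * D * ei := by
        rw [hγ, ha, hei, hk]
        have : R ≠ 0 := by positivity
        field_simp
        ring
      have h4 : γ / 4 * (a / 2 ^ (k + 1) * (2 ^ k * ε) ^ 2) ≤
          γ / 4 * ∑ j ∈ Finset.range (n + 1), l j * (b j + b' j) := by
        gcongr; exact h2.trans h1
      nlinarith [mul_pos hD0 hε]
  have hsum : ∑ j ∈ Finset.range (n + 1), l j * (B - v j - γ * ((b j + b' j) / 2)) ≤
      2 * D * ei + D * ε * ∑ j ∈ Finset.range (n + 1), l j * 2 ^ j + CV ^ 2 / γ -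
        γ / 4 * ∑ j ∈ Finset.range (n + 1), l j * (b j + b' j) := by
    calc _ ≤ ∑ j ∈ Finset.range (n + 1), l j *
          (2 * D * ei + D * ε * 2 ^ j + CV ^ 2 / γ - γ / 4 * (b j + b' j)) :=
          Finset.sum_le_sum fun j _ => mul_le_mul_of_nonneg_left (hj j) (hl0 j)
      _ = (2 * D * ei + CV ^ 2 / γ) * ∑ j ∈ Finset.range (n + 1), l j +
          D * ε * ∑ j ∈ Finset.range (n + 1), l j * 2 ^ j -
          γ / 4 * ∑ j ∈ Finset.range (n + 1), l j * (b j + b' j) := by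
          rw [Finset.mul_sum, Finset.mul_sum, Finset.mul_sum, ← Finset.sum_add_distrib,
            ← Finset.sum_sub_distrib]
          exact Finset.sum_congr rfl fun j _ => by ring
      _ = _ := by rw [hl1]; ring
  have haN : a * (n + 1) / 2 = R / 2 := by
    rw [ha, ← hRsq]; field_simp
  have hCVγ : CV ^ 2 / γ ≤ R * (D * ε) / 32 := by
    rw [hγ, div_div_eq_mul_div, div_le_iff₀ (by positivity)]
    have h1 : CV ^ 2 ≤ D ^ 2 := by gcongr
    nlinarith [mul_le_mul_of_nonneg_right h1 hε.le, mul_nonneg (sq_nonneg D) hε.le,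
      mul_le_mul_of_nonneg_left (one_le_pow₀ (n := 2) hR1) (mul_nonneg (sq_nonneg D) hε.le)]
  have h6 : D * ε * ∑ j ∈ Finset.range (n + 1), l j * 2 ^ j ≤ D * ε * (1 + R / 2) := by
    rw [← haN]; gcongr
  nlinarith [mul_pos hD0 hε, mul_le_mul_of_nonneg_left hR1 (mul_pos hD0 hε).le]

variable {Dec Meas Obs : Type*} [MeasurableSpace Dec] [MeasurableSpace Meas] [MeasurableSpace Obs]
  {Ps : Finset (Set (Model Dec Meas Obs))} {V : Model Dec Meas Obs → Dec → ℝ} {Vmax CV : ℝ}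
  [MeasurableSpace.CountableOrCountablyGenerated (Dec × Meas) Obs]

lemma hellinger_self (P : Measure Obs) : hellinger P P = 0 := by
  simp [hellinger, hellingerSq]

/-- Offset bound from the constrained regret DEC: one distribution over joint decisions works for
all models simultaneously. -/
lemma Observable.exists_offset [Nonempty Dec] (hO : Observable Ps V Vmax CV) (hCV : 0 < CV)
    {c : ℝ} (hc : 1 ≤ c) (hd : ModerateDecay c (fun ε => (rDec V (powClass Ps) ε).toReal))
    {N : Model Dec Meas Obs} (hN : N ∈ co (powClass Ps)) {ε : ℝ} (hε : 0 < ε) {n : ℕ}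
    (hn : 2 ≤ 2 ^ n * ε) {D γ : ℝ} (hD : D = c * (rDec V (powClass Ps) ε).toReal / ε + CV)
    (hγ : γ = 32 * D * Real.sqrt (n + 1) / ε) :
    ∃ q : Measure (Dec × Meas), IsProbabilityMeasure q ∧ ∀ M ∈ powClass Ps,
      bestValue V M - ∫ x, V M x.1 ∂q - γ * ∫ x, hellinger (M.1 x) (N.1 x) ^ 2 ∂q ≤
        5 * Real.sqrt (n + 1) * (D * ε) := by
  have hR1 : 1 ≤ Real.sqrt (n + 1) := by
    rw [Real.one_le_sqrt]; linarith [Nat.cast_nonneg (α := ℝ) n]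
  obtain ⟨l, hl, hl1, hl2⟩ := exists_dyadic_weights n (a := 1 / Real.sqrt (n + 1)) (by positivity)
    (by rw [div_le_one (by positivity)]; exact hR1)
  have hl0 : ∀ j, 0 ≤ l j := fun j => le_trans (by positivity) (hl j)
  have hDCV : CV ≤ D := by
    rw [hD]
    have : 0 ≤ c * (rDec V (powClass Ps) ε).toReal / ε := by positivity
    linarith
  -- The infimum in the DEC need not be attained. A slack proportional to the scale is absorbed by
  -- the summand `CV` of `D`.
  choose p hp using fun j : ℕ => hO.exists_near_rDec hCV hN (2 ^ j * ε) (s := CV * (2 ^ j * ε))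
    (by positivity)
  have hr : ∀ j : ℕ, (rDec V (powClass Ps) (2 ^ j * ε)).toReal + CV * (2 ^ j * ε) ≤
      D * (2 ^ j * ε) := by
    intro j
    have := rDec_toReal_le_mul hc hd hε (ε' := 2 ^ j * ε)
      (le_mul_of_one_le_left hε.le (one_le_pow₀ one_le_two))
    rw [hD, add_mul]
    linarith
  obtain ⟨φ, hφm, hφ⟩ := hO.lipschitz
  have hφm' : Measurable fun x : Dec × Meas => (x.1, φ x.1) :=
    measurable_fst.prodMk (hφm.comp measurable_fst)
  -- The observing copy keeps the law of the decision, hence the value, but uses the measurement `φ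
  -- π`, at which the Lipschitz condition compares values.
  let p' : ℕ → Measure (Dec × Meas) := fun j => (p j : Measure (Dec × Meas)).map
    fun x : Dec × Meas => (x.1, φ x.1)
  have hp' : ∀ j, IsProbabilityMeasure (p' j) := fun j =>
    Measure.isProbabilityMeasure_map hφm'.aemeasurable
  let L : ℕ → NNReal := fun j => ⟨l j / 2, by have := hl0 j; positivity⟩
  let q : Measure (Dec × Meas) := ∑ j ∈ Finset.range (n + 1),
    (L j • (p j : Measure (Dec × Meas)) + L j • p' j)
  have hL : ∀ j, (L j : ℝ) = l j / 2 := fun j => rfl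
  have hq1 : IsProbabilityMeasure q := by
    constructor
    have h1 : q Set.univ = ((∑ j ∈ Finset.range (n + 1), (L j + L j) : NNReal) : ENNReal) := by
      simp [q]
    have h2 : (∑ j ∈ Finset.range (n + 1), (L j + L j) : NNReal) = 1 := by
      rw [← NNReal.coe_inj]
      push_cast
      simp_rw [hL]
      rw [← hl1]
      exact Finset.sum_congr rfl fun j _ => by ring
    rw [h1, h2]; rfl
  have hqi : ∀ f : Dec × Meas → ℝ, (∀ j, Integrable f (p j : Measure (Dec × Meas))) →
      (∀ j, Integrable f (p' j)) → ∫ x, f x ∂q = ∑ j ∈ Finset.range (n + 1),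
        l j * ((∫ x, f x ∂(p j : Measure (Dec × Meas)) + ∫ x, f x ∂(p' j)) / 2) := by
    intro f h1 h2
    have h3 : ∀ j, Integrable f (L j • (p j : Measure (Dec × Meas))) := fun j =>
      (h1 j).smul_measure_nnreal
    have h4 : ∀ j, Integrable f (L j • p' j) := fun j => (h2 j).smul_measure_nnreal
    rw [integral_finsetSum_measure fun j _ => (h3 j).add_measure (h4 j)]
    refine Finset.sum_congr rfl fun j _ => ?_
    rw [integral_add_measure (h3 j) (h4 j), integral_smul_nnreal_measure,
      integral_smul_nnreal_measure, NNReal.smul_def, NNReal.smul_def, hL, smul_eq_mul, smul_eq_mul]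
    ring
  refine ⟨q, hq1, fun M hM => ?_⟩
  have hMc := subset_co _ hM
  have hVp' : ∀ j, ∫ x, V M x.1 ∂(p' j) = ∫ x, V M x.1 ∂(p j : Measure (Dec × Meas)) := by
    intro j
    exact integral_map (f := fun x : Dec × Meas => V M x.1) hφm'.aemeasurable
      ((hO.measurable M hMc).comp measurable_fst).aestronglyMeasurable
  have hVq := hqi (fun x => V M x.1) (fun j => hO.integrable hCV hMc _)
    (fun j => hO.integrable hCV hMc _)
  have hHq := hqi (fun x => hellinger (M.1 x) (N.1 x) ^ 2)
    (fun j => integrable_hellinger_sq M N _) (fun j => integrable_hellinger_sq M N _)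
  have hH1 : ∀ (r : Measure (Dec × Meas)) [IsProbabilityMeasure r],
      ∫ x, hellinger (M.1 x) (N.1 x) ^ 2 ∂r ≤ 1 := by
    intro r _
    refine (integral_mono (integrable_hellinger_sq M N r) (integrable_const 1) fun x =>
      pow_le_one₀ (hellinger_nonneg _ _) (hellinger_le_one _ _)).trans (by simp)
  have hH0 : ∀ (r : Measure (Dec × Meas)), 0 ≤ ∫ x, hellinger (M.1 x) (N.1 x) ^ 2 ∂r :=
    fun r => integral_nonneg fun x => sq_nonneg _
  have main := multiscale_bound (n := n) (l := l) (B := bestValue V M) (B₀ := bestValue V N)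
    (v := fun j => ∫ x, V M x.1 ∂(p j : Measure (Dec × Meas)))
    (u := fun j => ∫ x, V N x.1 ∂(p j : Measure (Dec × Meas)))
    (b := fun j => ∫ x, hellinger (M.1 x) (N.1 x) ^ 2 ∂(p j : Measure (Dec × Meas)))
    (b' := fun j => ∫ x, hellinger (M.1 x) (N.1 x) ^ 2 ∂(p' j)) hε hn hCV hDCV rfl hγ hl hl1 hl2
    (fun j => hH0 _) (fun j => hH0 _) (fun j => hH1 _) (fun j => hH1 _) ?_ ?_ ?_ ?_
  · refine le_trans (le_of_eq ?_) main
    rw [hVq, hHq]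
    simp_rw [hVp']
    rw [Finset.mul_sum, sub_sub, ← Finset.sum_add_distrib]
    conv_lhs => rw [← one_mul (bestValue V M), ← hl1, Finset.sum_mul, ← Finset.sum_sub_distrib]
    exact Finset.sum_congr rfl fun j _ => by ring
  · intro j
    -- The reference model competes in its own DEC and meets the constraint at every scale, being at
    -- distance 0 from itself. This is the purpose of adjoining it to the class.
    refine (hp j N (Or.inr rfl) ?_).trans (hr j)
    simp [hellinger_self]
    positivity
  · intro j
    refine (integral_mono (hO.integrable hCV hN _) (integrable_const (bestValue V N)) fun x =>
      hO.le_bestValue hCV hN x.1).trans (by simp)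
  · intro j hj
    exact (hp j M (Or.inl hM) hj).trans (hr j)
  · intro j t ht
    have hpt : ∀ x : Dec × Meas, |V M x.1 - V N x.1| ≤
        t * hellinger (M.1 (x.1, φ x.1)) (N.1 (x.1, φ x.1)) ^ 2 + CV ^ 2 / (4 * t) := by
      intro x
      refine (hφ x.1 M hM N hN).trans ?_
      set h := hellinger (M.1 (x.1, φ x.1)) (N.1 (x.1, φ x.1))
      have e : t * h ^ 2 + CV ^ 2 / (4 * t) - CV * h = (2 * t * h - CV) ^ 2 / (4 * t) := by
        field_simp; ring
      have : 0 ≤ (2 * t * h - CV) ^ 2 / (4 * t) := by positivity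
      linarith
    have hi1 := hO.integrable hCV hMc (p j : Measure (Dec × Meas))
    have hi2 := hO.integrable hCV hN (p j : Measure (Dec × Meas))
    have hi3 : Integrable (fun x : Dec × Meas =>
        hellinger (M.1 (x.1, φ x.1)) (N.1 (x.1, φ x.1)) ^ 2) (p j : Measure (Dec × Meas)) :=
      (integrable_map_measure (measurable_hellinger_sq M N).aestronglyMeasurable
        hφm'.aemeasurable).mp (integrable_hellinger_sq M N (p' j))
    rw [← integral_sub hi1 hi2]
    refine abs_integral_le_integral_abs.trans ?_
    have hi4 : Integrable (fun x : Dec × Meas =>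
        t * hellinger (M.1 (x.1, φ x.1)) (N.1 (x.1, φ x.1)) ^ 2 + CV ^ 2 / (4 * t))
        (p j : Measure (Dec × Meas)) := (hi3.const_mul t).add (integrable_const _)
    refine (integral_mono (hi1.sub hi2).abs hi4 hpt).trans ?_
    rw [integral_add (hi3.const_mul t) (integrable_const _), integral_const_mul]
    simp only [p']
    rw [integral_map hφm'.aemeasurable (measurable_hellinger_sq M N).aestronglyMeasurable]
    simp

end MultiScale

/-! ### The posterior test and its information gain -/

section Information

variable {Obs : Type*} [MeasurableSpace Obs]

/-- The logarithms of the test are smoothed by `τ` to keep it bounded. The price is only √τ, because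
w/√(w + τ) ≤ √w ≤ 1 and √(p + τ) ≤ √p + √τ. -/
lemma mul_sqrt_div_sqrt_le {w p τ : ℝ} (hw : 0 ≤ w) (hw1 : w ≤ 1) (hp : 0 ≤ p) (hτ : 0 < τ) :
    w * (Real.sqrt (p + τ) / Real.sqrt (w + τ)) ≤ Real.sqrt w * Real.sqrt p + Real.sqrt τ := by
  have h1 : w / Real.sqrt (w + τ) ≤ Real.sqrt w := by
    rw [div_le_iff₀ (Real.sqrt_pos.mpr (by positivity))]
    calc w = Real.sqrt w * Real.sqrt w := (Real.mul_self_sqrt hw).symm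
      _ ≤ Real.sqrt w * Real.sqrt (w + τ) := by gcongr; linarith
  have h2 : Real.sqrt (p + τ) ≤ Real.sqrt p + Real.sqrt τ := by
    rw [Real.sqrt_le_left (by positivity)]
    nlinarith [Real.sq_sqrt hp, Real.sq_sqrt hτ.le,
      mul_nonneg (Real.sqrt_nonneg p) (Real.sqrt_nonneg τ)]
  have h3 : Real.sqrt w ≤ 1 := Real.sqrt_le_one.mpr hw1
  calc w * (Real.sqrt (p + τ) / Real.sqrt (w + τ)) =
        w / Real.sqrt (w + τ) * Real.sqrt (p + τ) := by ring
    _ ≤ Real.sqrt w * (Real.sqrt p + Real.sqrt τ) := by gcongr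
    _ ≤ Real.sqrt w * Real.sqrt p + Real.sqrt τ := by
        nlinarith [Real.sqrt_nonneg τ]

/-- The gain of the exponential-weights test built from posterior densities `p k` and prior
weights `w k` dominates the average squared Hellinger distance to the mixture. -/
lemma sum_mul_integral_exp_le {K : Type*} [Fintype K] (Q : Measure Obs) [IsProbabilityMeasure Q]
    (P : K → Measure Obs) [∀ k, IsProbabilityMeasure (P k)] (μ : K → NNReal) (hμ : ∑ k, μ k = 1)
    (hQ : Q = ∑ k, μ k • P k) (p : K → Obs → ℝ) (hpm : ∀ k, Measurable (p k))
    (hp0 : ∀ k o, 0 ≤ p k o) (hp1 : ∀ k o, p k o ≤ 1) (hpμ : ∀ k, μ k = 0 → ∀ o, p k o = 0)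
    (hPp : ∀ k, μ k ≠ 0 → P k = Q.withDensity fun o => ENNReal.ofReal (p k o / μ k))
    (w : K → ℝ) (hw0 : ∀ k, 0 ≤ w k) (hw1 : ∑ k, w k = 1) {τ : ℝ} (hτ : 0 < τ) :
    ∑ k, (μ k : ℝ) * ∫ o, (∑ k', w k' * (Real.sqrt (p k' o + τ) / Real.sqrt (w k' + τ))) *
        (Real.sqrt (w k + τ) / Real.sqrt (p k o + τ)) ∂(P k) ≤
      1 - 2⁻¹ * ∑ k, (μ k : ℝ) * hellinger (P k) Q ^ 2 +
        (2 * Fintype.card K * Real.sqrt τ + Fintype.card K ^ 2 * τ) := by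
  set n : ℝ := (Fintype.card K : ℝ) with hn
  have hw1' : ∀ k, w k ≤ 1 := fun k => by
    rw [← hw1]; exact Finset.single_le_sum (fun i _ => hw0 i) (Finset.mem_univ k)
  have hsum1 : ∀ h : Obs → ℝ, ∀ k, (μ k : ℝ) * ∫ o, h o ∂(P k) = ∫ o, p k o * h o ∂Q := by
    intro h k
    rcases eq_or_ne (μ k) 0 with h0 | h0
    · simp [h0, hpμ k h0]
    · rw [hPp k h0, integral_withDensity_eq_integral_toReal_smul (by fun_prop)
        (ae_of_all _ fun o => ENNReal.ofReal_lt_top), ← integral_const_mul]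
      refine integral_congr_ae (ae_of_all _ fun o => ?_)
      have h1 : (0 : ℝ) ≤ p k o / μ k := div_nonneg (hp0 k o) (NNReal.coe_nonneg _)
      have h2 : (μ k : ℝ) ≠ 0 := by exact_mod_cast h0
      simp only [ENNReal.toReal_ofReal h1, smul_eq_mul]
      field_simp
  have hpi : ∀ k, Integrable (p k) Q := fun k =>
    Integrable.of_bound (hpm k).aestronglyMeasurable 1 (ae_of_all _ fun o => by
      rw [Real.norm_of_nonneg (hp0 k o)]; exact hp1 k o)
  -- The `p k` are posterior probabilities: they integrate over any set `s` to μ k * P k(s), and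
  -- these add up to Q(s).
  have hae : ∀ᵐ o ∂Q, ∑ k, p k o = 1 := by
    refine Integrable.ae_eq_of_forall_setIntegral_eq (fun o => ∑ k, p k o) (fun _ => (1 : ℝ))
      (integrable_finsetSum _ fun k _ => hpi k) (integrable_const _) fun s hs _ => ?_
    rw [integral_finsetSum _ fun k _ => (hpi k).integrableOn]
    have h1 : ∀ k, ∫ o in s, p k o ∂Q = (μ k : ℝ) * (P k).real s := by
      intro k
      rw [← integral_indicator_one hs, hsum1, ← integral_indicator hs]
      refine integral_congr_ae (ae_of_all _ fun o => ?_)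
      by_cases ho : o ∈ s <;> simp [ho]
    simp_rw [h1]
    rw [setIntegral_const, smul_eq_mul, mul_one, hQ, Measure.real, Measure.finsetSum_apply,
      ENNReal.toReal_sum (fun k _ => by
        simp only [Measure.smul_apply]
        exact ENNReal.mul_ne_top ENNReal.coe_ne_top (measure_ne_top _ _))]
    refine Finset.sum_congr rfl fun k _ => ?_
    rw [Measure.smul_apply, ENNReal.smul_def, smul_eq_mul, ENNReal.toReal_mul]
    rfl
  have hsqi : ∀ k, Integrable (fun o => Real.sqrt (p k o)) Q := fun k =>
    Integrable.of_bound (hpm k).sqrt.aestronglyMeasurable 1 (ae_of_all _ fun o => by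
      rw [Real.norm_of_nonneg (Real.sqrt_nonneg _)]; exact Real.sqrt_le_one.mpr (hp1 k o))
  -- `s` is the Bhattacharyya coefficient of `w` and the posterior. `A` is the average under `w` of
  -- the smoothed √(p/w), and `C` the posterior average of its inverse; up to smoothing both are at
  -- most `s`.
  set s : Obs → ℝ := fun o => ∑ k, Real.sqrt (w k) * Real.sqrt (p k o) with hs
  set A : Obs → ℝ := fun o => ∑ k', w k' * (Real.sqrt (p k' o + τ) / Real.sqrt (w k' + τ)) with hA
  set C : Obs → ℝ := fun o => ∑ k, p k o * (Real.sqrt (w k + τ) / Real.sqrt (p k o + τ)) with hC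
  have hsi : Integrable s Q := integrable_finsetSum _ fun k _ => (hsqi k).const_mul _
  have hs0 : ∀ o, 0 ≤ s o := fun o => Finset.sum_nonneg fun k _ => by positivity
  have hA0 : ∀ o, 0 ≤ A o := fun o => Finset.sum_nonneg fun k _ => mul_nonneg (hw0 k) (by positivity)
  have hC0 : ∀ o, 0 ≤ C o := fun o => Finset.sum_nonneg fun k _ =>
    mul_nonneg (hp0 k o) (by positivity)
  have hAs : ∀ o, A o ≤ s o + n * Real.sqrt τ := by
    intro o
    refine (Finset.sum_le_sum fun k _ =>
      mul_sqrt_div_sqrt_le (hw0 k) (hw1' k) (hp0 k o) hτ).trans (le_of_eq ?_)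
    rw [Finset.sum_add_distrib]
    simp [hs, hn]
  have hCs : ∀ o, C o ≤ s o + n * Real.sqrt τ := by
    intro o
    refine (Finset.sum_le_sum fun k _ =>
      mul_sqrt_div_sqrt_le (hp0 k o) (hp1 k o) (hw0 k) hτ).trans (le_of_eq ?_)
    rw [Finset.sum_add_distrib]
    simp [hs, hn, mul_comm]
  have hAm : Measurable A := by
    rw [hA]; fun_prop
  have hCm : Measurable C := by
    rw [hC]; fun_prop
  have hs1 : ∀ᵐ o ∂Q, s o ≤ 1 := by
    filter_upwards [hae] with o ho
    calc s o ≤ ∑ k, (w k + p k o) / 2 := Finset.sum_le_sum fun k _ => by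
          nlinarith [sq_nonneg (Real.sqrt (w k) - Real.sqrt (p k o)), Real.sq_sqrt (hw0 k),
            Real.sq_sqrt (hp0 k o)]
      _ = 1 := by rw [← Finset.sum_div, Finset.sum_add_distrib, hw1, ho]; norm_num
  have hn0 : 0 ≤ n := Nat.cast_nonneg _
  -- Here s² ≤ s because s ≤ 1; the rest is the expansion of (s + n√τ)².
  have hAC : ∀ᵐ o ∂Q, A o * C o ≤ s o + (2 * n * Real.sqrt τ + n ^ 2 * τ) := by
    filter_upwards [hs1] with o ho
    have h1 : A o * C o ≤ (s o + n * Real.sqrt τ) * (s o + n * Real.sqrt τ) :=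
      mul_le_mul (hAs o) (hCs o) (hC0 o) ((hA0 o).trans (hAs o))
    have h2 : 0 ≤ n * Real.sqrt τ := by positivity
    nlinarith [Real.sq_sqrt hτ.le, hs0 o, mul_nonneg h2 (sub_nonneg.mpr ho)]
  have hAb : ∀ᵐ o ∂Q, ‖A o‖ ≤ 1 + n * Real.sqrt τ := by
    filter_upwards [hs1] with o ho
    rw [Real.norm_of_nonneg (hA0 o)]; linarith [hAs o]
  have hterm : ∀ k o, p k o * (A o * (Real.sqrt (w k + τ) / Real.sqrt (p k o + τ))) =
      (p k o * (Real.sqrt (w k + τ) / Real.sqrt (p k o + τ))) * A o := fun k o => by ring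
  have hti : ∀ k, Integrable (fun o => p k o *
      (A o * (Real.sqrt (w k + τ) / Real.sqrt (p k o + τ)))) Q := by
    intro k
    simp_rw [hterm]
    refine Integrable.mul_bdd ?_ hAm.aestronglyMeasurable hAb
    refine ((hsqi k).const_mul (Real.sqrt (w k)) |>.add (integrable_const (Real.sqrt τ))).mono'
      (by have := hpm k; exact Measurable.aestronglyMeasurable (by fun_prop))
      (ae_of_all _ fun o => ?_)
    rw [Real.norm_of_nonneg (mul_nonneg (hp0 k o) (by positivity))]
    have := mul_sqrt_div_sqrt_le (hp0 k o) (hp1 k o) (hw0 k) hτ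
    simp only [Pi.add_apply]
    linarith
  have hmain : ∑ k, (μ k : ℝ) * ∫ o, A o * (Real.sqrt (w k + τ) / Real.sqrt (p k o + τ)) ∂(P k) =
      ∫ o, A o * C o ∂Q := by
    simp_rw [hsum1]
    rw [← integral_finsetSum _ fun k _ => hti k]
    refine integral_congr_ae (ae_of_all _ fun o => ?_)
    simp only [hC, Finset.mul_sum]
    exact Finset.sum_congr rfl fun k _ => by ring
  have hACi : Integrable (fun o => A o * C o) Q := by
    have : (fun o => A o * C o) = fun o => ∑ k, p k o *
        (A o * (Real.sqrt (w k + τ) / Real.sqrt (p k o + τ))) := by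
      ext o
      simp only [hC, Finset.mul_sum]
      exact Finset.sum_congr rfl fun k _ => by ring
    rw [this]
    exact integrable_finsetSum _ fun k _ => hti k
  rw [hmain]
  have hint : ∫ o, A o * C o ∂Q ≤ ∫ o, s o ∂Q + (2 * n * Real.sqrt τ + n ^ 2 * τ) := by
    refine (integral_mono_ae hACi (hsi.add (integrable_const _)) hAC).trans (le_of_eq ?_)
    rw [integral_add' hsi (integrable_const _)]
    simp
  -- With h the squared Hellinger distance, ∫ √(p k) dQ = √(μ k) (1 - h), and AM-GM with (1 - h)² ≤
  -- 1 - h gives the bound. Both `w` and `μ` have total mass 1, so a mismatch between them costs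
  -- nothing after summation.
  have hsk : ∀ k, Real.sqrt (w k) * ∫ o, Real.sqrt (p k o) ∂Q ≤
      w k / 2 + μ k / 2 - μ k * hellinger (P k) Q ^ 2 / 2 := by
    intro k
    rcases eq_or_ne (μ k) 0 with h0 | h0
    · simp [h0, hpμ k h0]; linarith [hw0 k]
    · have hμ0 : (0 : ℝ) < μ k := by exact_mod_cast pos_iff_ne_zero.mpr h0
      have h1 := toReal_hellingerSq_of_withDensity (P k) Q (f := fun o => p k o / μ k)
        ((hpm k).div_const _) (fun o => div_nonneg (hp0 k o) hμ0.le) ((hpi k).div_const _)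
        (hPp k h0)
      simp_rw [Real.sqrt_div (hp0 k _)] at h1
      rw [integral_div, ← hellinger_sq] at h1
      have h2 : ∫ o, Real.sqrt (p k o) ∂Q = Real.sqrt (μ k) * (1 - hellinger (P k) Q ^ 2) := by
        rw [h1]
        have : Real.sqrt (μ k) ≠ 0 := (Real.sqrt_pos.mpr hμ0).ne'
        field_simp
        ring
      rw [h2]
      have h3 : hellinger (P k) Q ^ 2 ≤ 1 :=
        pow_le_one₀ (hellinger_nonneg _ _) (hellinger_le_one _ _)
      have h4 : 0 ≤ hellinger (P k) Q ^ 2 := sq_nonneg _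
      set H := hellinger (P k) Q ^ 2
      have h5 := Real.sq_sqrt (hw0 k)
      have h6 := Real.sq_sqrt hμ0.le
      have h7 := mul_nonneg hμ0.le (mul_nonneg h4 (sub_nonneg.mpr h3))
      rw [← h6] at h7
      rw [← h5, ← h6]
      simp only [Real.sqrt_sq (Real.sqrt_nonneg _)]
      nlinarith [sq_nonneg (Real.sqrt (w k) - Real.sqrt (μ k) * (1 - H))]
  have hμ1 : ∑ k, (μ k : ℝ) = 1 := by exact_mod_cast hμ
  have hs2 : ∫ o, s o ∂Q ≤ 1 - 2⁻¹ * ∑ k, (μ k : ℝ) * hellinger (P k) Q ^ 2 := by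
    rw [hs, integral_finsetSum _ fun k _ => (hsqi k).const_mul _]
    simp_rw [integral_const_mul]
    refine (Finset.sum_le_sum fun k _ => hsk k).trans (le_of_eq ?_)
    rw [Finset.sum_sub_distrib, Finset.sum_add_distrib, ← Finset.sum_div, ← Finset.sum_div,
      ← Finset.sum_div, hw1, hμ1]
    ring
  linarith

variable {X : Type*} [MeasurableSpace X] [MeasurableSpace.CountableOrCountablyGenerated X Obs]

/-- A bounded weight function whose gain dominates the average squared Hellinger distance of the
components of a mixture to the mixture. -/
lemma exists_posterior_weight {K : Type*} [Fintype K] (M : K → Kernel X Obs)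
    [∀ k, IsMarkovKernel (M k)] (N : Kernel X Obs) [IsMarkovKernel N] (μ : K → NNReal)
    (hμ : ∑ k, μ k = 1) (hN : ∀ x, N x = ∑ k, μ k • M k x) (w : K → ℝ) (hw0 : ∀ k, 0 ≤ w k)
    (hw1 : ∑ k, w k = 1) {τ : ℝ} (hτ : 0 < τ) :
    ∃ ξ : K → X → Obs → ℝ, (∀ k, Measurable fun z : X × Obs => ξ k z.1 z.2) ∧
      (∀ k x o, |ξ k x o| ≤ |Real.log (1 + τ)| + |Real.log τ|) ∧
      ∀ x, ∑ k, (μ k : ℝ) * ∫ o, (∑ k', w k' * Real.exp (ξ k' x o)) * Real.exp (-ξ k x o) ∂(M k x) ≤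
        1 - 2⁻¹ * ∑ k, (μ k : ℝ) * hellinger (M k x) (N x) ^ 2 +
          (2 * Fintype.card K * Real.sqrt τ + Fintype.card K ^ 2 * τ) := by
  have hw1' : ∀ k, w k ≤ 1 := fun k => by
    rw [← hw1]; exact Finset.single_le_sum (fun i _ => hw0 i) (Finset.mem_univ k)
  -- Truncation makes the posterior bounded everywhere. It changes nothing almost everywhere,
  -- because μ k • M k ≤ N.
  let p : K → X → Obs → ℝ := fun k x o => min 1 (μ k * ((M k).rnDeriv N x o).toReal)
  have hpm : ∀ k, Measurable fun z : X × Obs => p k z.1 z.2 := fun k =>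
    measurable_const.min ((Kernel.measurable_rnDeriv (M k) N).ennreal_toReal.const_mul _)
  have hp0 : ∀ k x o, 0 ≤ p k x o := fun k x o =>
    le_min zero_le_one (mul_nonneg (NNReal.coe_nonneg _) ENNReal.toReal_nonneg)
  have hp1 : ∀ k x o, p k x o ≤ 1 := fun k x o => min_le_left _ _
  have hexp : ∀ k x o, Real.exp (2⁻¹ * (Real.log (p k x o + τ) - Real.log (w k + τ))) =
      Real.sqrt (p k x o + τ) / Real.sqrt (w k + τ) := by
    intro k x o
    have h1 : 0 < p k x o + τ := by linarith [hp0 k x o]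
    have h2 : 0 < w k + τ := by linarith [hw0 k]
    rw [← Real.log_div h1.ne' h2.ne', ← Real.sqrt_div h1.le, inv_mul_eq_div,
      ← Real.log_sqrt (by positivity), Real.exp_log (Real.sqrt_pos.mpr (by positivity))]
  have hlog : ∀ t : ℝ, 0 ≤ t → t ≤ 1 → |Real.log (t + τ)| ≤ |Real.log (1 + τ)| + |Real.log τ| := by
    intro t h0 h1
    have h2 : Real.log τ ≤ Real.log (t + τ) := Real.log_le_log hτ (by linarith)
    have h3 : Real.log (t + τ) ≤ Real.log (1 + τ) := Real.log_le_log (by linarith) (by linarith)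
    exact (abs_le_max_abs_abs h2 h3).trans (max_le (by linarith [abs_nonneg (Real.log (1 + τ))])
      (by linarith [abs_nonneg (Real.log τ)]))
  refine ⟨fun k x o => 2⁻¹ * (Real.log (p k x o + τ) - Real.log (w k + τ)), fun k => ?_,
    fun k x o => ?_, fun x => ?_⟩
  · exact (((hpm k).add_const τ).log.sub_const _).const_mul _
  · have h1 := hlog _ (hp0 k x o) (hp1 k x o)
    have h2 := hlog _ (hw0 k) (hw1' k)
    have h3 := abs_sub (Real.log (p k x o + τ)) (Real.log (w k + τ))
    rw [abs_mul, abs_of_pos (by norm_num : (0 : ℝ) < 2⁻¹)]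
    linarith
  · have hexp' : ∀ k o, Real.exp (-(2⁻¹ * (Real.log (p k x o + τ) - Real.log (w k + τ)))) =
        Real.sqrt (w k + τ) / Real.sqrt (p k x o + τ) := by
      intro k o
      rw [Real.exp_neg, hexp, inv_div]
    simp_rw [hexp', hexp]
    refine sum_mul_integral_exp_le (N x) (fun k => M k x) μ hμ (hN x) (fun k o => p k x o)
      (fun k => (hpm k).comp measurable_prodMk_left) (fun k o => hp0 k x o) (fun k o => hp1 k x o)
      (fun k hk o => ?_) (fun k hk => ?_) w hw0 hw1 hτ
    · simp [p, hk]
    · have hμ0 : (0 : ℝ) < μ k := by exact_mod_cast pos_iff_ne_zero.mpr hk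
      have hle : μ k • M k x ≤ N x := by
        rw [hN x]
        exact Finset.single_le_sum (f := fun k => μ k • M k x) (fun i _ => Measure.zero_le _)
          (Finset.mem_univ k)
      have hac : M k x ≪ N x := by
        refine Measure.AbsolutelyContinuous.trans ?_ (Measure.absolutelyContinuous_of_le hle)
        refine Measure.AbsolutelyContinuous.mk fun s _ hs => ?_
        rw [Measure.smul_apply, ENNReal.smul_def, smul_eq_mul, mul_eq_zero] at hs
        exact hs.resolve_left (by simpa using hk)
      have h1 := Kernel.rnDeriv_eq_rnDeriv_measure (κ := M k) (η := N) (a := x)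
      have h2 := Measure.rnDeriv_le_one_of_le hle
      have h3 := Measure.rnDeriv_smul_left (M k x) (N x) (μ k)
      have h4 := Measure.rnDeriv_ne_top (M k x) (N x)
      refine (Measure.withDensity_rnDeriv_eq _ _ hac).symm.trans ?_
      refine withDensity_congr_ae ?_
      filter_upwards [h1, h2, h3, h4] with o h1 h2 h3 h4
      have h5 : (μ k : ℝ) * ((M k x).rnDeriv (N x) o).toReal ≤ 1 := by
        rw [h3, Pi.smul_apply, ENNReal.smul_def, smul_eq_mul] at h2
        have := ENNReal.toReal_mono (by simp) h2
        simpa using this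
      simp only [p]
      rw [h1, min_eq_right h5, mul_div_cancel_left₀ _ hμ0.ne', ENNReal.ofReal_toReal h4]

end Information

/-! ### Information cost: boundedness, stability and convexity -/

section Payoff

variable {Dec Meas Obs Ψ : Type*} [MeasurableSpace Dec] [MeasurableSpace Meas] [MeasurableSpace Obs]
  [MeasurableSpace Ψ]

/-- The normalizing constant `𝔼_{ψ ∼ w} exp(ξ(ψ; x, o))`. -/
noncomputable def expMean (w : Measure Ψ) (ξ : Ψ → Dec × Meas → Obs → ℝ) (z : (Dec × Meas) × Obs) : ℝ :=
  ∫ ψ', Real.exp (ξ ψ' z.1 z.2) ∂w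

/-- The information cost `𝔼_{x ∼ q, o ∼ M(x), ψ' ∼ w} exp(ξ(ψ'; x, o) - ξ(ψ; x, o))`. -/
noncomputable def infoCost (w : Measure Ψ) (q : Measure (Dec × Meas)) (ξ : Ψ → Dec × Meas → Obs → ℝ)
    (M : Model Dec Meas Obs) (ψ : Ψ) : ℝ :=
  ∫ z, expMean w ξ z * Real.exp (-ξ ψ z.1 z.2) ∂(q ⊗ₘ M.1)

/-- A weight function bounded by `B`. -/
def IsWeightBdd (B : ℝ) (ξ : Ψ → Dec × Meas → Obs → ℝ) : Prop :=
  (Measurable fun z : Ψ × (Dec × Meas) × Obs => ξ z.1 z.2.1 z.2.2) ∧ ∀ ψ x o, |ξ ψ x o| ≤ B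

variable {w : Measure Ψ} [IsProbabilityMeasure w] {ξ : Ψ → Dec × Meas → Obs → ℝ} {B : ℝ}

lemma exp_le_of_abs_le {t : ℝ} (h : |t| ≤ B) : Real.exp t ≤ Real.exp B :=
  Real.exp_le_exp.mpr (abs_le.mp h).2

lemma IsWeightBdd.measurable_right (h : IsWeightBdd B ξ) (ψ : Ψ) :
    Measurable fun z : (Dec × Meas) × Obs => ξ ψ z.1 z.2 :=
  h.1.comp (measurable_const.prodMk measurable_id)

lemma IsWeightBdd.integrable_exp (h : IsWeightBdd B ξ) (z : (Dec × Meas) × Obs) :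
    Integrable (fun ψ' => Real.exp (ξ ψ' z.1 z.2)) w :=
  Integrable.of_bound (h.1.comp (measurable_id.prodMk measurable_const)).exp.aestronglyMeasurable
    (Real.exp B) (ae_of_all _ fun ψ => by
      rw [Real.norm_of_nonneg (Real.exp_pos _).le]; exact exp_le_of_abs_le (h.2 _ _ _))

lemma IsWeightBdd.measurable_expMean (h : IsWeightBdd B ξ) : Measurable (expMean w ξ) := by
  have : StronglyMeasurable fun p : ((Dec × Meas) × Obs) × Ψ => Real.exp (ξ p.2 p.1.1 p.1.2) :=
    (h.1.comp (measurable_snd.prodMk measurable_fst)).exp.stronglyMeasurable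
  exact this.integral_prod_right.measurable

lemma expMean_nonneg (z : (Dec × Meas) × Obs) : 0 ≤ expMean w ξ z :=
  integral_nonneg fun _ => (Real.exp_pos _).le

lemma IsWeightBdd.expMean_le (h : IsWeightBdd B ξ) (z : (Dec × Meas) × Obs) :
    expMean w ξ z ≤ Real.exp B := by
  refine (integral_mono (h.integrable_exp z) (integrable_const (Real.exp B)) fun ψ =>
    exp_le_of_abs_le (h.2 _ _ _)).trans (by simp)

lemma IsWeightBdd.measurable_cost (h : IsWeightBdd B ξ) (ψ : Ψ) :
    Measurable fun z : (Dec × Meas) × Obs => expMean w ξ z * Real.exp (-ξ ψ z.1 z.2) :=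
  h.measurable_expMean.mul (h.measurable_right ψ).neg.exp

lemma cost_nonneg (ψ : Ψ) (z : (Dec × Meas) × Obs) :
    0 ≤ expMean w ξ z * Real.exp (-ξ ψ z.1 z.2) :=
  mul_nonneg (expMean_nonneg z) (Real.exp_pos _).le

lemma IsWeightBdd.cost_le (h : IsWeightBdd B ξ) (ψ : Ψ) (z : (Dec × Meas) × Obs) :
    expMean w ξ z * Real.exp (-ξ ψ z.1 z.2) ≤ Real.exp (2 * B) := by
  rw [two_mul, Real.exp_add]
  exact mul_le_mul (h.expMean_le z) (exp_le_of_abs_le (by rw [abs_neg]; exact h.2 _ _ _))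
    (Real.exp_pos _).le (Real.exp_pos _).le

lemma IsWeightBdd.integrable_cost (h : IsWeightBdd B ξ) (ψ : Ψ)
    (ρ : Measure ((Dec × Meas) × Obs)) [IsFiniteMeasure ρ] :
    Integrable (fun z => expMean w ξ z * Real.exp (-ξ ψ z.1 z.2)) ρ :=
  Integrable.of_bound (h.measurable_cost ψ).aestronglyMeasurable (Real.exp (2 * B))
    (ae_of_all _ fun z => by
      rw [Real.norm_of_nonneg (cost_nonneg ψ z)]; exact h.cost_le ψ z)

lemma infoCost_nonneg (q : Measure (Dec × Meas)) (M : Model Dec Meas Obs) (ψ : Ψ) :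
    0 ≤ infoCost w q ξ M ψ := integral_nonneg fun z => cost_nonneg ψ z

lemma IsWeightBdd.infoCost_eq (h : IsWeightBdd B ξ) (q : Measure (Dec × Meas))
    [IsProbabilityMeasure q] (M : Model Dec Meas Obs) (ψ : Ψ) :
    infoCost w q ξ M ψ = ∫ x, ∫ o, expMean w ξ (x, o) * Real.exp (-ξ ψ x o) ∂(M.1 x) ∂q :=
  Measure.integral_compProd (h.integrable_cost ψ _)

/-- Factoring e^(ξ(ψ') - ξ(ψ)) separates the average over `ψ'` and leaves the objective affine in
one nonnegative quantity, in which all later estimates are made. -/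
lemma IsWeightBdd.exoObjAt_eq (h : IsWeightBdd B ξ) {V : Model Dec Meas Obs → Dec → ℝ}
    (I : InfoStructure Dec Meas Obs Ψ) (γ : ℝ) (q : Measure (Dec × Meas))
    [IsProbabilityMeasure q] (M : Model Dec Meas Obs) (ψ : Ψ)
    (hV : Integrable (fun x => V M x.1) q) :
    exoObjAt V I γ w q ξ M ψ =
      V M (I.dec ψ) - ∫ x, V M x.1 ∂q - γ + γ * infoCost w q ξ M ψ := by
  have h1 : ∀ x o, ∫ ψ', (1 - Real.exp (ξ ψ' x o - ξ ψ x o)) ∂w =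
      1 - expMean w ξ (x, o) * Real.exp (-ξ ψ x o) := by
    intro x o
    simp_rw [sub_eq_add_neg (ξ _ x o), Real.exp_add]
    rw [integral_sub (integrable_const _) ((h.integrable_exp (x, o)).mul_const _),
      integral_mul_const]
    simp [expMean]
  have h2 : ∫ x, ∫ o, ∫ ψ', (1 - Real.exp (ξ ψ' x o - ξ ψ x o)) ∂w ∂(M.1 x) ∂q =
      1 - infoCost w q ξ M ψ := by
    simp_rw [h1]
    have h3 := Measure.integral_compProd (μ := q) (κ := M.1)
      (f := fun z => 1 - expMean w ξ z * Real.exp (-ξ ψ z.1 z.2))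
      ((integrable_const _).sub (h.integrable_cost ψ _))
    rw [← h3, integral_sub (integrable_const _) (h.integrable_cost ψ _)]
    simp [infoCost]
  rw [exoObjAt, h2, integral_sub (integrable_const _) hV]
  simp
  ring

lemma IsWeightBdd.infoCost_le (h : IsWeightBdd B ξ) (q : Measure (Dec × Meas))
    [IsProbabilityMeasure q] (M : Model Dec Meas Obs) (ψ : Ψ) :
    infoCost w q ξ M ψ ≤ Real.exp (2 * B) :=
  (integral_mono (h.integrable_cost ψ _) (integrable_const _) (h.cost_le ψ)).trans (by simp)

lemma infoCost_comp {K : Type*} [MeasurableSpace K] {cell : Ψ → K} (hcell : Measurable cell)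
    {ξ : K → Dec × Meas → Obs → ℝ}
    (hξ : Measurable fun z : K × (Dec × Meas) × Obs => ξ z.1 z.2.1 z.2.2)
    (q : Measure (Dec × Meas)) (M : Model Dec Meas Obs) (ψ : Ψ) :
    infoCost w q (fun ψ => ξ (cell ψ)) M ψ = infoCost (w.map cell) q ξ M (cell ψ) := by
  have : ∀ z, expMean w (fun ψ => ξ (cell ψ)) z = expMean (w.map cell) ξ z := fun z =>
    (integral_map (f := fun k => Real.exp (ξ k z.1 z.2)) hcell.aemeasurable
      (hξ.comp (measurable_id.prodMk measurable_const)).exp.aestronglyMeasurable).symm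
  simp only [infoCost, this]

/-- Two models whose observation laws and values differ by at most `s`. -/
def Near (V : Model Dec Meas Obs → Dec → ℝ) (s : ℝ) (M M' : Model Dec Meas Obs) : Prop :=
  (∀ (x : Dec × Meas) (h : Obs → ℝ) (b : ℝ), Measurable h → (∀ o, |h o| ≤ b) →
    |∫ o, h o ∂(M.1 x) - ∫ o, h o ∂(M'.1 x)| ≤ s * b) ∧ ∀ π, |V M π - V M' π| ≤ s

/-- The cost takes values in [0, e^(2B)]. The loss thus depends on the bound of the weights, so a
net of models has to be chosen after `B`. -/
lemma IsWeightBdd.infoCost_le_of_near (h : IsWeightBdd B ξ) {V : Model Dec Meas Obs → Dec → ℝ}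
    {s : ℝ} {M M' : Model Dec Meas Obs} (hM : Near V s M M') (q : Measure (Dec × Meas))
    [IsProbabilityMeasure q] (ψ : Ψ) :
    infoCost w q ξ M ψ ≤ infoCost w q ξ M' ψ + s * Real.exp (2 * B) := by
  rw [h.infoCost_eq, h.infoCost_eq]
  have hi : ∀ N : Model Dec Meas Obs, Integrable (fun x =>
      ∫ o, expMean w ξ (x, o) * Real.exp (-ξ ψ x o) ∂(N.1 x)) q := fun N =>
    (h.integrable_cost ψ (q ⊗ₘ N.1)).integral_compProd
  rw [← sub_le_iff_le_add', ← integral_sub (hi M) (hi M')]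
  refine (integral_mono ((hi M).sub (hi M')) (integrable_const (s * Real.exp (2 * B)))
    fun x => ?_).trans (by simp)
  refine (le_abs_self _).trans (hM.1 x _ _ ((h.measurable_cost ψ).comp measurable_prodMk_left)
    fun o => ?_)
  rw [abs_of_nonneg (cost_nonneg ψ (x, o))]
  exact h.cost_le ψ (x, o)

/-- Densities of the components of a two-component mixture. -/
lemma exists_density {X : Type*} [MeasurableSpace X] (q₁ q₂ : Measure X) [IsProbabilityMeasure q₁]
    [IsProbabilityMeasure q₂] (a b : NNReal) :
    ∃ r : X → ℝ, Measurable r ∧ (∀ x, 0 ≤ r x) ∧ (∀ x, r x ≤ 1) ∧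
      ∀ f : X → ℝ, Integrable f (a • q₁ + b • q₂) →
        ∫ x, r x * f x ∂(a • q₁ + b • q₂) = a * ∫ x, f x ∂q₁ ∧
        ∫ x, (1 - r x) * f x ∂(a • q₁ + b • q₂) = b * ∫ x, f x ∂q₂ := by
  set q := a • q₁ + b • q₂ with hq
  have hle : a • q₁ ≤ q := Measure.le_add_right le_rfl
  refine ⟨fun x => min 1 ((a • q₁).rnDeriv q x).toReal,
    measurable_const.min (Measure.measurable_rnDeriv _ _).ennreal_toReal,
    fun x => le_min zero_le_one ENNReal.toReal_nonneg, fun x => min_le_left _ _, fun f hf => ?_⟩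
  have hrm : Measurable fun x => min 1 ((a • q₁).rnDeriv q x).toReal :=
    measurable_const.min (Measure.measurable_rnDeriv _ _).ennreal_toReal
  have h1 : ∫ x, min 1 ((a • q₁).rnDeriv q x).toReal * f x ∂q = a * ∫ x, f x ∂q₁ := by
    have h2 : ∫ x, min 1 ((a • q₁).rnDeriv q x).toReal * f x ∂q =
        ∫ x, ((a • q₁).rnDeriv q x).toReal * f x ∂q := by
      refine integral_congr_ae ?_
      filter_upwards [Measure.rnDeriv_le_one_of_le hle] with x hx
      have := ENNReal.toReal_mono (by simp) hx
      rw [min_eq_right (by simpa using this)]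
    rw [h2, integral_toReal_rnDeriv_mul (Measure.absolutelyContinuous_of_le hle),
      integral_smul_nnreal_measure, NNReal.smul_def, smul_eq_mul]
  refine ⟨h1, ?_⟩
  have hi : Integrable (fun x => min 1 ((a • q₁).rnDeriv q x).toReal * f x) q :=
    hf.bdd_mul (c := 1) hrm.aestronglyMeasurable (ae_of_all _ fun x => by
      rw [Real.norm_of_nonneg (le_min zero_le_one ENNReal.toReal_nonneg)]
      exact min_le_left _ _)
  simp_rw [sub_mul, one_mul]
  rw [integral_sub hf hi, h1, hq, integral_add_measure (hf.mono_measure hle)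
    (hf.mono_measure (Measure.le_add_left le_rfl)), integral_smul_nnreal_measure,
    integral_smul_nnreal_measure, NNReal.smul_def, NNReal.smul_def, smul_eq_mul, smul_eq_mul]
  ring

/-- The information cost is jointly convex in the distribution and the weight function, after a
reparametrization of the weight function. -/
lemma exists_convex_combination {ξ₁ ξ₂ : Ψ → Dec × Meas → Obs → ℝ} (h₁ : IsWeightBdd B ξ₁)
    (h₂ : IsWeightBdd B ξ₂) (q₁ q₂ : Measure (Dec × Meas)) [IsProbabilityMeasure q₁]
    [IsProbabilityMeasure q₂] (a b : NNReal) (hab : a + b = 1) :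
    ∃ ξ : Ψ → Dec × Meas → Obs → ℝ, IsWeightBdd B ξ ∧ ∀ (M : Model Dec Meas Obs) ψ,
      infoCost w (a • q₁ + b • q₂) ξ M ψ ≤
        a * infoCost w q₁ ξ₁ M ψ + b * infoCost w q₂ ξ₂ M ψ := by
  have hq : IsProbabilityMeasure (a • q₁ + b • q₂) := by
    constructor
    simp only [Measure.add_apply, Measure.smul_apply, measure_univ, ENNReal.smul_def, smul_eq_mul,
      mul_one]
    exact_mod_cast hab
  obtain ⟨r, hrm, hr0, hr1, hr⟩ := exists_density q₁ q₂ a b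
  -- Mixing the weights with the posterior probability `r x` that the decision came from `q₁` makes
  -- convexity of exp, applied to ξ(ψ') - ξ(ψ), yield r times the first cost plus 1 - r times the
  -- second. Under the mixture these integrate to `a` and `b` times the original costs.
  have hξ : IsWeightBdd B fun ψ x o => r x * ξ₁ ψ x o + (1 - r x) * ξ₂ ψ x o := by
    refine ⟨?_, fun ψ x o => ?_⟩
    · have hr' : Measurable fun z : Ψ × (Dec × Meas) × Obs => r z.2.1 :=
        hrm.comp (measurable_snd.fst)
      exact (hr'.mul h₁.1).add ((hr'.const_sub 1).mul h₂.1)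
    · have e1 := abs_le.mp (h₁.2 ψ x o)
      have e2 := abs_le.mp (h₂.2 ψ x o)
      have h3 := hr0 x
      have h4 := hr1 x
      rw [abs_le]
      constructor <;> nlinarith
  refine ⟨_, hξ, fun M ψ => ?_⟩
  have hi : ∀ {ξ' : Ψ → Dec × Meas → Obs → ℝ}, IsWeightBdd B ξ' → Integrable (fun x =>
      ∫ o, expMean w ξ' (x, o) * Real.exp (-ξ' ψ x o) ∂(M.1 x)) (a • q₁ + b • q₂) := fun h =>
    (h.integrable_cost ψ ((a • q₁ + b • q₂) ⊗ₘ M.1)).integral_compProd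
  have hrewr : ∀ {ξ' : Ψ → Dec × Meas → Obs → ℝ}, IsWeightBdd B ξ' → ∀ z,
      expMean w ξ' z * Real.exp (-ξ' ψ z.1 z.2) =
        ∫ ψ', Real.exp (ξ' ψ' z.1 z.2 - ξ' ψ z.1 z.2) ∂w := by
    intro ξ' h z
    simp_rw [sub_eq_add_neg, Real.exp_add]
    rw [integral_mul_const, expMean]
  have hri : ∀ {ξ' : Ψ → Dec × Meas → Obs → ℝ}, IsWeightBdd B ξ' → ∀ z : (Dec × Meas) × Obs,
      Integrable (fun ψ' => Real.exp (ξ' ψ' z.1 z.2 - ξ' ψ z.1 z.2)) w := by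
    intro ξ' h z
    simp_rw [sub_eq_add_neg, Real.exp_add]
    exact (h.integrable_exp z).mul_const _
  have hpt : ∀ z : (Dec × Meas) × Obs,
      expMean w (fun ψ x o => r x * ξ₁ ψ x o + (1 - r x) * ξ₂ ψ x o) z *
        Real.exp (-(r z.1 * ξ₁ ψ z.1 z.2 + (1 - r z.1) * ξ₂ ψ z.1 z.2)) ≤
      r z.1 * (expMean w ξ₁ z * Real.exp (-ξ₁ ψ z.1 z.2)) +
        (1 - r z.1) * (expMean w ξ₂ z * Real.exp (-ξ₂ ψ z.1 z.2)) := by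
    intro z
    rw [hrewr hξ z, hrewr h₁ z, hrewr h₂ z, ← integral_const_mul, ← integral_const_mul,
      ← integral_add ((hri h₁ z).const_mul _) ((hri h₂ z).const_mul _)]
    refine integral_mono (hri hξ z) (((hri h₁ z).const_mul _).add ((hri h₂ z).const_mul _))
      fun ψ' => ?_
    have := convexOn_exp.2 (Set.mem_univ (ξ₁ ψ' z.1 z.2 - ξ₁ ψ z.1 z.2))
      (Set.mem_univ (ξ₂ ψ' z.1 z.2 - ξ₂ ψ z.1 z.2)) (hr0 z.1) (sub_nonneg.mpr (hr1 z.1))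
      (by ring)
    simp only [smul_eq_mul] at this
    refine le_trans (le_of_eq ?_) this
    congr 1
    ring
  rw [hξ.infoCost_eq, h₁.infoCost_eq, h₂.infoCost_eq, ← (hr _ (hi h₁)).1, ← (hr _ (hi h₂)).2]
  have hrb : ∀ x, ‖r x‖ ≤ 1 := fun x => by rw [Real.norm_of_nonneg (hr0 x)]; exact hr1 x
  have hrb' : ∀ x, ‖1 - r x‖ ≤ 1 := fun x => by
    rw [Real.norm_of_nonneg (sub_nonneg.mpr (hr1 x))]; linarith [hr0 x]
  have hi1 := (hi h₁).bdd_mul (c := 1) hrm.aestronglyMeasurable (ae_of_all _ hrb)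
  have hi2 := (hi h₂).bdd_mul (c := 1) (hrm.const_sub 1).aestronglyMeasurable (ae_of_all _ hrb')
  rw [← integral_add hi1 hi2]
  refine integral_mono (hi hξ) (hi1.add hi2) fun x => ?_
  have hio : ∀ {ξ' : Ψ → Dec × Meas → Obs → ℝ}, IsWeightBdd B ξ' → Integrable (fun o =>
      expMean w ξ' (x, o) * Real.exp (-ξ' ψ x o)) (M.1 x) := fun h =>
    Integrable.of_bound ((h.measurable_cost ψ).comp measurable_prodMk_left).aestronglyMeasurable
      (Real.exp (2 * B)) (ae_of_all _ fun o => by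
        rw [Real.norm_of_nonneg (cost_nonneg ψ (x, o))]; exact h.cost_le ψ (x, o))
  rw [← integral_const_mul, ← integral_const_mul,
    ← integral_add ((hio h₁).const_mul _) ((hio h₂).const_mul _)]
  exact integral_mono (hio hξ) (((hio h₁).const_mul _).add ((hio h₂).const_mul _))
    fun o => hpt (x, o)

end Payoff

/-- A finite minimax principle for payoffs that are convex-like in the minimizing strategy. -/
lemma exists_forall_lt_of_convexLike {J 𝒬 : Type*} [Fintype J] [Nonempty 𝒬] (F : 𝒬 → J → ℝ)
    (hF : ∀ x y, ∀ a b : NNReal, a + b = 1 → ∃ z, ∀ j, F z j ≤ a * F x j + b * F y j) (v : ℝ)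
    (hv : ∀ μ : J → NNReal, ∑ j, μ j = 1 → ∃ x, ∑ j, (μ j : ℝ) * F x j < v) :
    ∃ x, ∀ j, F x j < v := by
  classical
  by_contra hcon
  push Not at hcon
  -- Only the upward closure of the payoff vectors is convex under the convex-like hypothesis. If no
  -- strategy beats `v` everywhere, it misses the open orthant `U`.
  let S : Set (J → ℝ) := {u | ∃ x, ∀ j, F x j ≤ u j}
  let U : Set (J → ℝ) := {u | ∀ j, u j < v}
  have hS : Convex ℝ S := by
    rintro u ⟨x, hx⟩ u' ⟨y, hy⟩ a b ha hb hab
    obtain ⟨z, hz⟩ := hF x y ⟨a, ha⟩ ⟨b, hb⟩ (by ext; exact hab)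
    refine ⟨z, fun j => (hz j).trans ?_⟩
    simp only [Pi.add_apply, Pi.smul_apply, smul_eq_mul]
    exact add_le_add (mul_le_mul_of_nonneg_left (hx j) ha) (mul_le_mul_of_nonneg_left (hy j) hb)
  have hUeq : U = Set.univ.pi fun _ => Set.Iio v := by ext u; simp [U]
  have hU : Convex ℝ U := by rw [hUeq]; exact convex_pi fun _ _ => convex_Iio v
  have hUo : IsOpen U := by rw [hUeq]; exact isOpen_set_pi Set.finite_univ fun _ _ => isOpen_Iio
  have hdisj : Disjoint U S := by
    rw [Set.disjoint_left]
    rintro u hu ⟨x, hx⟩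
    obtain ⟨j, hj⟩ := hcon x
    exact absurd (hu j) (not_lt.mpr (hj.trans (hx j)))
  obtain ⟨f, c, hfU, hfS⟩ := geometric_hahn_banach_open hU hUo hS hdisj
  let e : J → J → ℝ := fun j => Pi.single j 1
  have hf : ∀ u : J → ℝ, f u = ∑ j, f (e j) * u j := by
    intro u
    conv_lhs => rw [pi_eq_sum_univ' u]
    rw [map_sum]
    refine Finset.sum_congr rfl fun j _ => ?_
    have : (fun i => if j = i then (1 : ℝ) else 0) = e j := by
      ext i; simp [e, Pi.single_apply, eq_comm]
    simp only [map_smul, smul_eq_mul]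
    ring
  have hfj : ∀ j, 0 ≤ f (e j) := by
    intro j
    by_contra hneg
    push Not at hneg
    let u₀ : J → ℝ := fun _ => v - 1
    have h0 := hfU u₀ (fun j => by simp [u₀])
    -- Moving this far in direction -e j stays in `U` but makes `f` equal to `c`, which is
    -- impossible.
    let t : ℝ := (c - f u₀) / (-f (e j))
    have ht : 0 ≤ t := div_nonneg (by linarith) (by linarith)
    have h1 := hfU (u₀ - t • e j) (fun i => by
      simp only [Pi.sub_apply, Pi.smul_apply, smul_eq_mul, u₀, e]
      have : 0 ≤ t * (Pi.single j (1 : ℝ) : J → ℝ) i :=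
        mul_nonneg ht (by by_cases h : i = j <;> simp [h])
      linarith)
    rw [map_sub, map_smul, smul_eq_mul] at h1
    have h2 : t * f (e j) = -(c - f u₀) := by
      have : f (e j) ≠ 0 := hneg.ne
      simp only [t]; field_simp
    linarith
  obtain ⟨x₀⟩ := (inferInstance : Nonempty 𝒬)
  have hle : ∀ x, c ≤ ∑ j, f (e j) * F x j := fun x => by
    rw [← hf]; exact hfS _ ⟨x, fun j => le_rfl⟩
  -- Limit of f < c at the corner (v, …, v) of the orthant.
  have hUv : v * ∑ j, f (e j) ≤ c := by
    refine le_of_forall_pos_lt_add fun s hs => ?_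
    have hσ0 : 0 ≤ ∑ j, f (e j) := Finset.sum_nonneg fun j _ => hfj j
    have h1 := hfU (fun _ => v - s / (∑ j, f (e j) + 1)) (fun j => by
      have : 0 < s / (∑ j, f (e j) + 1) := by positivity
      linarith)
    rw [hf, ← Finset.sum_mul] at h1
    have h2 : (∑ j, f (e j)) * (s / (∑ j, f (e j) + 1)) ≤ s := by
      rw [mul_div_assoc', div_le_iff₀ (by positivity)]
      nlinarith
    nlinarith
  have hσ : 0 < ∑ j, f (e j) := by
    refine lt_of_le_of_ne (Finset.sum_nonneg fun j _ => hfj j) fun h0 => ?_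
    have h1 : ∀ j, f (e j) = 0 := fun j =>
      (Finset.sum_eq_zero_iff_of_nonneg fun j _ => hfj j).mp h0.symm j (Finset.mem_univ j)
    have h2 := hfU (fun _ => v - 1) (fun j => by simp)
    have h3 := hle x₀
    rw [hf] at h2
    simp only [h1, zero_mul, Finset.sum_const_zero] at h2 h3
    linarith
  have hco : ∀ j, ((f (e j) / ∑ j, f (e j)).toNNReal : ℝ) = f (e j) / ∑ j, f (e j) := fun j =>
    Real.coe_toNNReal _ (div_nonneg (hfj j) hσ.le)
  -- The normalized separating functional is a prior against which every strategy pays at least `v`.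
  obtain ⟨x, hx⟩ := hv (fun j => (f (e j) / ∑ j, f (e j)).toNNReal) (by
    ext; push_cast; simp_rw [hco]; rw [← Finset.sum_div, div_self hσ.ne'])
  simp_rw [hco] at hx
  simp_rw [div_mul_eq_mul_div] at hx
  rw [← Finset.sum_div, div_lt_iff₀ hσ] at hx
  linarith [hle x]

/-! ### Finite reductions and the Bayesian game -/

section Game

variable {Dec Meas Obs : Type*} [MeasurableSpace Dec] [MeasurableSpace Meas] [MeasurableSpace Obs]
  {Ps : Finset (Set (Model Dec Meas Obs))} {V : Model Dec Meas Obs → Dec → ℝ} {Vmax CV : ℝ}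

/-- Finitely many measurable cells of decisions on which all value functions are nearly constant. -/
lemma Observable.exists_cells [Nonempty Dec] (hO : Observable Ps V Vmax CV) (hCV : 0 < CV)
    (hcomp : IsCompactClass (powClass Ps)) {s : ℝ} (hs : 0 < s) :
    ∃ (n : ℕ) (cell : Dec → Fin n) (rep : Fin n → Dec), Measurable cell ∧
      ∀ M ∈ powClass Ps, ∀ π, |V M π - V M (rep (cell π))| ≤ s := by
  classical
  obtain ⟨φ, -, hφ⟩ := hO.lipschitz
  set t := s / (1 + 2 * CV) with ht
  have ht0 : 0 < t := by positivity
  obtain ⟨S, hSP, hS⟩ := hcomp t ht0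
  let m := ⌊Vmax / t⌋₊
  -- Decisions are grouped by their values on a finite net, rounded to multiples of `t`. Values are
  -- at most `Vmax`, so the floor is at most `m` and `Fin.ofNat` never wraps around.
  let g : Dec → S → Fin (m + 1) := fun π M => Fin.ofNat (m + 1) ⌊V M π / t⌋₊
  have hg : Measurable g := measurable_pi_lambda _ fun M =>
    (measurable_of_countable (Fin.ofNat (m + 1))).comp
      (Nat.measurable_floor.comp ((hO.measurable_of_mem (hSP M.2)).div_const t))
  let e := Fintype.equivFin (S → Fin (m + 1))
  refine ⟨_, e ∘ g, Function.invFun (e ∘ g), (measurable_of_finite e).comp hg, fun M hM π => ?_⟩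
  set π' := Function.invFun (e ∘ g) ((e ∘ g) π)
  have hgg : g π' = g π := e.injective (Function.invFun_eq (f := e ∘ g) ⟨π, rfl⟩)
  obtain ⟨M', hM', hMM'⟩ := hS M hM
  have hMp := hSP hM'
  have h1 : ⌊V M' π' / t⌋₊ = ⌊V M' π / t⌋₊ := by
    have h2 := congrArg Fin.val (congrFun hgg ⟨M', hM'⟩)
    have h3 : ∀ π, ⌊V M' π / t⌋₊ < m + 1 := fun π => Nat.lt_succ_of_le
      (Nat.floor_mono (by have := (hO.mem_Icc M' hMp π).2; gcongr))
    simpa [g, Fin.ofNat, Nat.mod_eq_of_lt (h3 _)] using h2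
  have h2 : |V M' π - V M' π'| ≤ t := by
    have a1 := Nat.floor_le (div_nonneg (hO.mem_Icc M' hMp π).1 ht0.le)
    have a2 := Nat.lt_floor_add_one (V M' π / t)
    have a3 := Nat.floor_le (div_nonneg (hO.mem_Icc M' hMp π').1 ht0.le)
    have a4 := Nat.lt_floor_add_one (V M' π' / t)
    rw [h1] at a3 a4
    have a5 : |V M' π / t - V M' π' / t| ≤ 1 := abs_le.mpr ⟨by linarith, by linarith⟩
    rw [← sub_div, abs_div, abs_of_pos ht0, div_le_one ht0] at a5
    exact a5
  have h3 : ∀ π, |V M π - V M' π| ≤ CV * t := fun π =>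
    (hφ π M hM M' (subset_co _ hMp)).trans (mul_le_mul_of_nonneg_left (hMM' _) hCV.le)
  have h4 : s = t + 2 * (CV * t) := by rw [ht]; field_simp
  have b1 := abs_le.mp h2
  have b2 := abs_le.mp (h3 π)
  have b3 := abs_le.mp (h3 π')
  rw [abs_le]
  constructor <;> linarith [b1.1, b1.2, b2.1, b2.2, b3.1, b3.2]

/-- Each constraint set has a finite net of its own elements. -/
lemma Observable.exists_near_net (hO : Observable Ps V Vmax CV) (hCV : 0 < CV)
    (hcomp : IsCompactClass (powClass Ps)) {P : Set (Model Dec Meas Obs)} (hP : P ∈ Ps)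
    {s : ℝ} (hs : 0 < s) :
    ∃ S : Finset (Model Dec Meas Obs), (∀ M ∈ S, M ∈ P) ∧ ∀ M ∈ P, ∃ M' ∈ S, Near V s M M' := by
  classical
  obtain ⟨φ, -, hφ⟩ := hO.lipschitz
  -- Both models are compared with a common net point: twice 3t for integrals, twice CV * t for
  -- values.
  set t := s / (6 + 2 * CV) with ht
  have ht0 : 0 < t := by positivity
  have hst : s = 6 * t + 2 * (CV * t) := by rw [ht]; field_simp
  obtain ⟨S, hSP, hS⟩ := hcomp t ht0
  -- The net lies in the union of the convex hulls, not in `P`. Each net point close to some element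
  -- of `P` is replaced by such an element.
  let S' := S.filter fun M₀ => ∃ M ∈ P, ∀ x, hellinger (M.1 x) (M₀.1 x) ≤ t
  have hch : ∀ M₀ : S', ∃ M ∈ P, ∀ x, hellinger (M.1 x) (M₀.1.1 x) ≤ t := fun M₀ =>
    (Finset.mem_filter.mp M₀.2).2
  choose r hrP hr using hch
  refine ⟨Finset.univ.image r, fun M hM => ?_, fun M hM => ?_⟩
  · obtain ⟨M₀, -, rfl⟩ := Finset.mem_image.mp hM
    exact hrP M₀
  · obtain ⟨M₀, hM₀, hMM₀⟩ := hS M (subset_powClass hP hM)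
    let m : S' := ⟨M₀, Finset.mem_filter.mpr ⟨hM₀, M, hM, hMM₀⟩⟩
    refine ⟨r m, Finset.mem_image_of_mem r (Finset.mem_univ m), fun x h b hm hb => ?_,
      fun π => ?_⟩
    · have h1 := abs_le.mp (abs_integral_sub_integral_le (M.1 x) (M₀.1 x) ht0 (hMM₀ x) hm hb)
      have h2 := abs_le.mp (abs_integral_sub_integral_le ((r m).1 x) (M₀.1 x) ht0 (hr m x) hm hb)
      have hb0 : 0 ≤ b := by
        obtain ⟨o⟩ := (M.1 x).nonempty_of_neZero
        exact (abs_nonneg _).trans (hb o)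
      have h3 : 0 ≤ CV * t * b := by positivity
      rw [abs_le, hst]
      constructor <;> nlinarith [h1.1, h1.2, h2.1, h2.2]
    · have hco := subset_co _ (hSP hM₀)
      have h1 := abs_le.mp ((hφ π M (subset_powClass hP hM) M₀ hco).trans
        (mul_le_mul_of_nonneg_left (hMM₀ _) hCV.le))
      have h2 := abs_le.mp ((hφ π (r m) (subset_powClass hP (hrP m)) M₀ hco).trans
        (mul_le_mul_of_nonneg_left (hr m _) hCV.le))
      rw [abs_le, hst]
      constructor <;> linarith [h1.1, h1.2, h2.1, h2.2]

variable {K : Type*} [Fintype K] [MeasurableSpace K] [MeasurableSingletonClass K]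

lemma expMean_fintype (w : Measure K) [IsProbabilityMeasure w] (ξ : K → Dec × Meas → Obs → ℝ)
    (z : (Dec × Meas) × Obs) : expMean w ξ z = ∑ k, w.real {k} * Real.exp (ξ k z.1 z.2) := by
  rw [expMean, integral_fintype .of_finite]
  simp

/-- Mixtures within the groups of a two-level mixture. -/
lemma Observable.exists_group_mixture (hO : Observable Ps V Vmax CV)
    {P : Set (Model Dec Meas Obs)} (hP : P ∈ Ps) (hne : P.Nonempty) {L : Type*} [Fintype L]
    (M : L → Model Dec Meas Obs) (hM : ∀ l, M l ∈ P) (μ : L → NNReal) :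
    ∃ N ∈ co P, (∀ x, (∑ l, μ l) • N.1 x = ∑ l, μ l • (M l).1 x) ∧
      ∀ π, (∑ l, (μ l : ℝ)) * V N π = ∑ l, (μ l : ℝ) * V (M l) π := by
  rcases eq_or_ne (∑ l, μ l) 0 with h0 | h0
  · obtain ⟨N, hN⟩ := hne
    have h1 : ∀ l, μ l = 0 := fun l => by simpa using (Finset.sum_eq_zero_iff.mp h0) l
    exact ⟨N, subset_co P hN, by simp [h1], by simp [h1]⟩
  · have ha : ∑ l, μ l / ∑ l, μ l = 1 := by rw [← Finset.sum_div, div_self h0]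
    obtain ⟨N, hN⟩ := exists_mixture (fun l => μ l / ∑ l, μ l) ha M
    have hNP := mem_co_of_eq_sum ha hN hM
    refine ⟨N, hNP, fun x => ?_, fun π => ?_⟩
    · rw [hN x, Finset.smul_sum]
      refine Finset.sum_congr rfl fun l _ => ?_
      rw [smul_smul, mul_div_cancel₀ _ h0]
    · rw [hO.affine_fintype ha (fun l => subset_powClass hP (hM l)) (co_subset_powClass hP hNP) hN,
        Finset.mul_sum]
      refine Finset.sum_congr rfl fun l _ => ?_
      have h1 : (∑ l, (μ l : ℝ)) ≠ 0 := by exact_mod_cast h0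
      push_cast
      field_simp

variable [MeasurableSpace.CountableOrCountablyGenerated (Dec × Meas) Obs]

/-- The Bayesian version of exploration by optimization: against a known finite prior, the
posterior test attains the offset bound. -/
lemma Observable.exists_bayes [Nonempty Dec] (hO : Observable Ps V Vmax CV) (hCV : 0 < CV)
    {c : ℝ} (hc : 1 ≤ c) (hd : ModerateDecay c (fun ε => (rDec V (powClass Ps) ε).toReal))
    {ε : ℝ} (hε : 0 < ε) {n : ℕ} (hn : 2 ≤ 2 ^ n * ε) {D γ : ℝ}
    (hD : D = c * (rDec V (powClass Ps) ε).toReal / ε + CV)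
    (hγ : γ = 32 * D * Real.sqrt (n + 1) / ε)
    (I : InfoStructure Dec Meas Obs K) (hI : ∀ k, I.models k ∈ Ps)
    (hne : ∀ k, (I.models k).Nonempty) (w : Measure K) [IsProbabilityMeasure w]
    {L : K → Type*} [∀ k, Fintype (L k)] (M : ∀ k, L k → Model Dec Meas Obs)
    (hM : ∀ k l, M k l ∈ I.models k) (μ : (Σ k, L k) → NNReal) (hμ : ∑ j, μ j = 1) {τ : ℝ}
    (hτ : 0 < τ) :
    ∃ (q : Measure (Dec × Meas)) (ξ : K → Dec × Meas → Obs → ℝ), IsProbabilityMeasure q ∧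
      IsWeightBdd (|Real.log (1 + τ)| + |Real.log τ|) ξ ∧
      ∑ j, (μ j : ℝ) * exoObjAt V I (2 * γ) w q ξ (M j.1 j.2) j.1 ≤
        5 * Real.sqrt (n + 1) * (D * ε) +
          2 * γ * (2 * Fintype.card K * Real.sqrt τ + Fintype.card K ^ 2 * τ) := by
  have hγ0 : 0 ≤ γ := by
    have : 0 ≤ D := by rw [hD]; positivity
    rw [hγ]; positivity
  choose N hNP hNx hNV using fun k =>
    hO.exists_group_mixture (hI k) (hne k) (M k) (hM k) (fun l => μ ⟨k, l⟩)
  let ν : K → NNReal := fun k => ∑ l, μ ⟨k, l⟩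
  have hν : ∑ k, ν k = 1 := by rw [← hμ, Fintype.sum_sigma]
  have hν' : ∑ k, (ν k : ℝ) = 1 := by exact_mod_cast hν
  have hNp : ∀ k, N k ∈ powClass Ps := fun k => co_subset_powClass (hI k) (hNP k)
  -- `N k` is the model conditioned on `k`, and stays in the class because each constraint set is
  -- taken with its hull. `N₀` is the marginal model: it lies in the hull of the whole class and
  -- serves as reference for the offset bound.
  obtain ⟨N₀, hN₀⟩ := exists_mixture ν hν N
  have hN₀c : N₀ ∈ co (powClass Ps) := mem_co_of_eq_sum hν hN₀ hNp
  obtain ⟨q, hq, hqb⟩ := hO.exists_offset hCV hc hd hN₀c hε hn hD hγ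
  obtain ⟨ξ, hξm, hξb, hξ⟩ := exists_posterior_weight (fun k => (N k).1) N₀.1 ν hν hN₀
    (fun k => w.real {k}) (fun k => measureReal_nonneg) (by
      rw [sum_measureReal_singleton]; simp) hτ
  have hξW : IsWeightBdd (|Real.log (1 + τ)| + |Real.log τ|) ξ :=
    ⟨measurable_from_prod_countable_right fun k => hξm k, hξb⟩
  refine ⟨q, ξ, hq, hξW, ?_⟩
  have hVi : ∀ {M' : Model Dec Meas Obs}, M' ∈ powClass Ps → Integrable (fun x => V M' x.1) q :=
    fun h => hO.integrable hCV (subset_co _ h) q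
  have hMp : ∀ k l, M k l ∈ powClass Ps := fun k l => subset_powClass (hI k) (hM k l)
  set G : K → (Dec × Meas) × Obs → ℝ := fun k z => expMean w ξ z * Real.exp (-ξ k z.1 z.2) with hG
  have hGi : ∀ k (M' : Model Dec Meas Obs), Integrable (fun x => ∫ o, G k (x, o) ∂(M'.1 x)) q :=
    fun k M' => (hξW.integrable_cost k (q ⊗ₘ M'.1)).integral_compProd
  have hGio : ∀ k (M' : Model Dec Meas Obs) x, Integrable (fun o => G k (x, o)) (M'.1 x) :=
    fun k M' x => Integrable.of_bound
      ((hξW.measurable_cost k).comp measurable_prodMk_left).aestronglyMeasurable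
      (Real.exp (2 * (|Real.log (1 + τ)| + |Real.log τ|))) (ae_of_all _ fun o => by
        rw [Real.norm_of_nonneg (cost_nonneg k (x, o))]; exact hξW.cost_le k (x, o))
  have hIC : ∀ k (M' : Model Dec Meas Obs), infoCost w q ξ M' k =
      ∫ x, ∫ o, G k (x, o) ∂(M'.1 x) ∂q := fun k M' => hξW.infoCost_eq q M' k
  have hICm : ∀ (a : ℝ) k (M' : Model Dec Meas Obs), a * infoCost w q ξ M' k =
      ∫ x, a * ∫ o, G k (x, o) ∂(M'.1 x) ∂q := fun a k M' => by rw [hIC, integral_const_mul]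
  have hInfoGroup : ∀ k, ∑ l, (μ ⟨k, l⟩ : ℝ) * infoCost w q ξ (M k l) k =
      ν k * infoCost w q ξ (N k) k := by
    intro k
    rw [hIC, ← integral_const_mul, Finset.sum_congr rfl fun l _ => hICm (μ ⟨k, l⟩) k (M k l),
      ← integral_finsetSum _ fun l _ => (hGi k (M k l)).const_mul _]
    refine integral_congr_ae (ae_of_all _ fun x => ?_)
    have h1 := congrArg (fun ρ : Measure Obs => ∫ o, G k (x, o) ∂ρ) (hNx k x)
    beta_reduce at h1
    rw [integral_smul_nnreal_measure, integral_finsetSum_measure fun l _ =>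
      (hGio k (M k l) x).smul_measure_nnreal] at h1
    simp_rw [integral_smul_nnreal_measure, NNReal.smul_def, smul_eq_mul] at h1
    exact h1.symm
  have hVGroup : ∀ k, ∑ l, (μ ⟨k, l⟩ : ℝ) * ∫ x, V (M k l) x.1 ∂q = ν k * ∫ x, V (N k) x.1 ∂q := by
    intro k
    simp_rw [← integral_const_mul]
    rw [← integral_finsetSum _ fun l _ => (hVi (hMp k l)).const_mul _]
    refine integral_congr_ae (ae_of_all _ fun x => ?_)
    have := hNV k x.1
    simp only [ν]
    push_cast
    exact this.symm
  have hgroup : ∀ k, ∑ l, (μ ⟨k, l⟩ : ℝ) * exoObjAt V I (2 * γ) w q ξ (M k l) k =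
      ν k * (V (N k) (I.dec k) - ∫ x, V (N k) x.1 ∂q - 2 * γ) +
        2 * γ * (ν k * infoCost w q ξ (N k) k) := by
    intro k
    have h1 : ∀ l, (μ ⟨k, l⟩ : ℝ) * exoObjAt V I (2 * γ) w q ξ (M k l) k =
        μ ⟨k, l⟩ * V (M k l) (I.dec k) - μ ⟨k, l⟩ * ∫ x, V (M k l) x.1 ∂q - μ ⟨k, l⟩ * (2 * γ) +
          2 * γ * (μ ⟨k, l⟩ * infoCost w q ξ (M k l) k) := by
      intro l
      rw [hξW.exoObjAt_eq I (2 * γ) q (M k l) k (hVi (hMp k l))]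
      ring
    simp_rw [h1]
    rw [Finset.sum_add_distrib, Finset.sum_sub_distrib, Finset.sum_sub_distrib, ← Finset.mul_sum,
      hInfoGroup, hVGroup, ← hNV, ← Finset.sum_mul]
    have h2 : (ν k : ℝ) = ∑ l, (μ ⟨k, l⟩ : ℝ) := by simp [ν]
    rw [h2]
    ring
  set τ' : ℝ := 2 * Fintype.card K * Real.sqrt τ + Fintype.card K ^ 2 * τ with hτ'
  have hHi := fun k => integrable_hellinger_sq (N k) N₀ q
  have hinfo : ∑ k, (ν k : ℝ) * infoCost w q ξ (N k) k ≤
      1 - 2⁻¹ * ∑ k, (ν k : ℝ) * ∫ x, hellinger ((N k).1 x) (N₀.1 x) ^ 2 ∂q + τ' := by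
    rw [Finset.sum_congr rfl fun k _ => hICm (ν k) k (N k),
      ← integral_finsetSum _ fun k _ => (hGi k (N k)).const_mul _,
      Finset.sum_congr rfl fun k _ => (integral_const_mul (ν k : ℝ) _).symm,
      ← integral_finsetSum _ fun k _ => (hHi k).const_mul _, ← integral_const_mul]
    have hsi : Integrable (fun x => 2⁻¹ * ∑ k, (ν k : ℝ) *
        hellinger ((N k).1 x) (N₀.1 x) ^ 2) q :=
      (integrable_finsetSum _ fun k _ => (hHi k).const_mul _).const_mul _
    have h1 : ∫ x, (1 - 2⁻¹ * ∑ k, (ν k : ℝ) * hellinger ((N k).1 x) (N₀.1 x) ^ 2 + τ') ∂q =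
        1 - ∫ x, 2⁻¹ * ∑ k, (ν k : ℝ) * hellinger ((N k).1 x) (N₀.1 x) ^ 2 ∂q + τ' := by
      have h2 : Integrable (fun x => 1 - 2⁻¹ * ∑ k, (ν k : ℝ) *
        hellinger ((N k).1 x) (N₀.1 x) ^ 2) q := (integrable_const _).sub hsi
      rw [integral_add h2 (integrable_const _), integral_sub (integrable_const _) hsi]
      simp
    rw [← h1]
    refine integral_mono (integrable_finsetSum _ fun k _ => (hGi k (N k)).const_mul _)
      (((integrable_const _).sub hsi).add (integrable_const _)) fun x => ?_
    refine le_trans (le_of_eq ?_) (hξ x)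
    refine Finset.sum_congr rfl fun k _ => ?_
    simp only [hG, expMean_fintype]
  rw [Fintype.sum_sigma]
  simp_rw [hgroup]
  rw [Finset.sum_add_distrib, ← Finset.mul_sum]
  have hfin : ∑ k, (ν k : ℝ) * (V (N k) (I.dec k) - ∫ x, V (N k) x.1 ∂q - 2 * γ) ≤
      ∑ k, (ν k : ℝ) * (5 * Real.sqrt (n + 1) * (D * ε) - 2 * γ +
        γ * ∫ x, hellinger ((N k).1 x) (N₀.1 x) ^ 2 ∂q) := by
    refine Finset.sum_le_sum fun k _ => mul_le_mul_of_nonneg_left ?_ (NNReal.coe_nonneg _)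
    have h1 := hqb (N k) (hNp k)
    have h2 := hO.le_bestValue hCV (subset_co _ (hNp k)) (I.dec k)
    linarith
  have hsplit : ∑ k, (ν k : ℝ) * (5 * Real.sqrt (n + 1) * (D * ε) - 2 * γ +
        γ * ∫ x, hellinger ((N k).1 x) (N₀.1 x) ^ 2 ∂q) =
      5 * Real.sqrt (n + 1) * (D * ε) - 2 * γ +
        γ * ∑ k, (ν k : ℝ) * ∫ x, hellinger ((N k).1 x) (N₀.1 x) ^ 2 ∂q := by
    simp_rw [mul_add]
    rw [Finset.sum_add_distrib, ← Finset.sum_mul, hν', one_mul, Finset.mul_sum]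
    congr 1
    exact Finset.sum_congr rfl fun k _ => by ring
  -- The objective carries 2γ because the test recovers only half of the squared Hellinger distance.
  have h3 := mul_le_mul_of_nonneg_left hinfo (by positivity : 0 ≤ 2 * γ)
  linarith

end Game

/-! ### Minimax bound on the objective for an arbitrary reference distribution -/

section Bound

variable {Dec Meas Obs : Type*} [MeasurableSpace Dec] [MeasurableSpace Meas] [MeasurableSpace Obs]
  {Ps : Finset (Set (Model Dec Meas Obs))} {V : Model Dec Meas Obs → Dec → ℝ} {Vmax CV : ℝ}

instance (Ps : Finset (Set (Model Dec Meas Obs))) : MeasurableSingletonClass (Constraint Ps) :=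
  ⟨fun _ => trivial⟩

noncomputable instance (Ps : Finset (Set (Model Dec Meas Obs))) : Fintype (Constraint Ps) :=
  inferInstanceAs (Fintype {P : Set (Model Dec Meas Obs) // P ∈ Ps})

lemma exists_smoothing_parameter (n : ℝ) (hn : 0 ≤ n) (γ : ℝ) (hγ : 0 ≤ γ) {s : ℝ} (hs : 0 < s) :
    ∃ τ : ℝ, 0 < τ ∧ 2 * γ * (2 * n * Real.sqrt τ + n ^ 2 * τ) ≤ s := by
  set A := 2 * γ * (2 * n + n ^ 2) with hA
  have hA0 : 0 ≤ A := by positivity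
  set t := min 1 (s / (A + 1)) with ht
  have ht0 : 0 < t := lt_min one_pos (by positivity)
  have ht1 : t ≤ 1 := min_le_left _ _
  refine ⟨t ^ 2, by positivity, ?_⟩
  rw [Real.sqrt_sq ht0.le]
  have h1 : t * (A + 1) ≤ s := (le_div_iff₀ (by positivity)).mp (min_le_right _ _)
  have h2 : 2 * γ * (2 * n * t + n ^ 2 * t ^ 2) ≤ A * t := by
    rw [hA]
    have : n ^ 2 * t ^ 2 ≤ n ^ 2 * t := by gcongr; nlinarith
    have h3 : 2 * γ * (2 * n * t + n ^ 2 * t ^ 2) ≤ 2 * γ * (2 * n * t + n ^ 2 * t) := by gcongr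
    linarith
  nlinarith

variable {K : Type*} [Fintype K] [MeasurableSpace K] [MeasurableSingletonClass K]
  [MeasurableSpace.CountableOrCountablyGenerated (Dec × Meas) Obs]

/-- Exploration by optimization on a finite information set structure. -/
lemma Observable.exists_finite_exo [Nonempty Dec] (hO : Observable Ps V Vmax CV) (hCV : 0 < CV)
    (hcomp : IsCompactClass (powClass Ps))
    {c : ℝ} (hc : 1 ≤ c) (hd : ModerateDecay c (fun ε => (rDec V (powClass Ps) ε).toReal))
    {ε : ℝ} (hε : 0 < ε) {n : ℕ} (hn : 2 ≤ 2 ^ n * ε) {D γ : ℝ}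
    (hD : D = c * (rDec V (powClass Ps) ε).toReal / ε + CV)
    (hγ : γ = 32 * D * Real.sqrt (n + 1) / ε)
    (I : InfoStructure Dec Meas Obs K) (hI : ∀ k, I.models k ∈ Ps)
    (hne : ∀ k, (I.models k).Nonempty) (w : Measure K) [IsProbabilityMeasure w] {s : ℝ}
    (hs : 0 < s) :
    ∃ (q : Measure (Dec × Meas)) (B : ℝ) (ξ : K → Dec × Meas → Obs → ℝ),
      IsProbabilityMeasure q ∧ IsWeightBdd B ξ ∧
      ∀ k, ∀ M ∈ I.models k, exoObjAt V I (2 * γ) w q ξ M k ≤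
        5 * Real.sqrt (n + 1) * (D * ε) + s := by
  have hD0 : 0 < D := by rw [hD]; positivity
  have hγ0 : 0 ≤ γ := by rw [hγ]; positivity
  -- `τ`, and with it the bound `B`, is fixed before any prior of the opponent, so that all Bayesian
  -- responses lie in one strategy set `𝒬`.
  obtain ⟨τ, hτ, hτs⟩ := exists_smoothing_parameter (Fintype.card K) (Nat.cast_nonneg _) γ hγ0
    (by positivity : 0 < s / 4)
  set B := |Real.log (1 + τ)| + |Real.log τ| with hB
  -- Passing from the net to all models costs `t` for each of two values and 2γ t e^(2B) for the
  -- information cost: s/2 in total.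
  set t := s / (4 + 4 * γ * Real.exp (2 * B)) with ht
  have ht0 : 0 < t := by positivity
  have hts : 2 * t + 2 * γ * (t * Real.exp (2 * B)) ≤ s / 2 := by
    rw [ht]; field_simp; linarith
  choose S hSP hS using fun k => hO.exists_near_net hCV hcomp (hI k) ht0
  obtain ⟨φ, hφ, -⟩ := hO.lipschitz
  let 𝒬 := {a : Measure (Dec × Meas) × (K → Dec × Meas → Obs → ℝ) //
    IsProbabilityMeasure a.1 ∧ IsWeightBdd B a.2}
  have h𝒬 : Nonempty 𝒬 := by
    obtain ⟨π⟩ := (inferInstance : Nonempty Dec)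
    refine ⟨⟨(Measure.dirac (π, φ π), fun _ _ _ => 0), inferInstance, measurable_const, fun _ _ _ => ?_⟩⟩
    simp only [abs_zero]; positivity
  have hVi : ∀ {M' : Model Dec Meas Obs} (q : Measure (Dec × Meas)) [IsProbabilityMeasure q],
      M' ∈ powClass Ps → Integrable (fun x => V M' x.1) q :=
    fun q _ h => hO.integrable hCV (subset_co _ h) q
  let F : 𝒬 → (Σ k, S k) → ℝ := fun a j => exoObjAt V I (2 * γ) w a.1.1 a.1.2 j.2 j.1
  have hSp : ∀ k (l : S k), (l : Model Dec Meas Obs) ∈ powClass Ps := fun k l =>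
    subset_powClass (hI k) (hSP k l l.2)
  have key : ∃ a : 𝒬, ∀ j, F a j < 5 * Real.sqrt (n + 1) * (D * ε) + s / 2 := by
    refine exists_forall_lt_of_convexLike F ?_ _ ?_
    · rintro ⟨⟨q₁, ξ₁⟩, hq₁, hξ₁⟩ ⟨⟨q₂, ξ₂⟩, hq₂, hξ₂⟩ a b hab
      have hq₁' : IsProbabilityMeasure q₁ := hq₁
      have hq₂' : IsProbabilityMeasure q₂ := hq₂
      obtain ⟨ξ, hξ, hle⟩ := exists_convex_combination (w := w) hξ₁ hξ₂ q₁ q₂ a b hab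
      have hq : IsProbabilityMeasure (a • q₁ + b • q₂) := by
        constructor
        simp only [Measure.add_apply, Measure.smul_apply, measure_univ, ENNReal.smul_def, smul_eq_mul,
          mul_one]
        exact_mod_cast hab
      refine ⟨⟨⟨a • q₁ + b • q₂, ξ⟩, hq, hξ⟩, fun ⟨k, l⟩ => ?_⟩
      change exoObjAt V I (2 * γ) w (a • q₁ + b • q₂) ξ l k ≤
        a * exoObjAt V I (2 * γ) w q₁ ξ₁ l k + b * exoObjAt V I (2 * γ) w q₂ ξ₂ l k
      have hl := hSp k l
      rw [hξ.exoObjAt_eq I (2 * γ) _ _ k (hVi _ hl), hξ₁.exoObjAt_eq I (2 * γ) _ _ k (hVi _ hl),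
        hξ₂.exoObjAt_eq I (2 * γ) _ _ k (hVi _ hl),
        integral_add_measure (hVi q₁ hl).smul_measure_nnreal (hVi q₂ hl).smul_measure_nnreal,
        integral_smul_nnreal_measure, integral_smul_nnreal_measure]
      simp only [NNReal.smul_def, smul_eq_mul]
      have h1 := mul_le_mul_of_nonneg_left (hle l k) (by positivity : 0 ≤ 2 * γ)
      have hab' : (a : ℝ) + b = 1 := by exact_mod_cast hab
      have hb : (b : ℝ) = 1 - a := by linarith
      rw [hb] at h1 ⊢
      nlinarith
    · intro μ hμ
      obtain ⟨q, ξ, hq, hξ, hle⟩ := hO.exists_bayes hCV hc hd hε hn hD hγ I hI hne w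
        (fun k (l : S k) => (l : Model Dec Meas Obs)) (fun k l => hSP k l l.2) μ hμ hτ
      refine ⟨⟨⟨q, ξ⟩, hq, hξ⟩, ?_⟩
      change ∑ j : (Σ k, S k), (μ j : ℝ) * exoObjAt V I (2 * γ) w q ξ j.2 j.1 < _
      linarith
  obtain ⟨⟨⟨q, ξ⟩, hq, hξ⟩, hqξ⟩ := key
  have hq' : IsProbabilityMeasure q := hq
  refine ⟨q, B, ξ, hq, hξ, fun k M hM => ?_⟩
  obtain ⟨M', hM', hMM'⟩ := hS k M hM
  have h1 : exoObjAt V I (2 * γ) w q ξ M' k < 5 * Real.sqrt (n + 1) * (D * ε) + s / 2 :=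
    hqξ ⟨k, M', hM'⟩
  have hMp := subset_powClass (hI k) hM
  have hM'p := hSp k ⟨M', hM'⟩
  rw [hξ.exoObjAt_eq I (2 * γ) q M' k (hVi q hM'p)] at h1
  rw [hξ.exoObjAt_eq I (2 * γ) q M k (hVi q hMp)]
  have h2 := mul_le_mul_of_nonneg_left (hξ.infoCost_le_of_near (w := w) hMM' q k)
    (by positivity : 0 ≤ 2 * γ)
  have h3 := (abs_le.mp (hMM'.2 (I.dec k))).2
  have h4 : ∫ x, V M' x.1 ∂q ≤ ∫ x, V M x.1 ∂q + t := by
    rw [← sub_le_iff_le_add', ← integral_sub (hVi q hM'p) (hVi q hMp)]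
    refine (integral_mono ((hVi q hM'p).sub (hVi q hMp)) (integrable_const t) fun x => ?_).trans
      (by simp)
    change V M' x.1 - V M x.1 ≤ t
    linarith [(abs_le.mp (hMM'.2 x.1)).1]
  linarith

/-- The finite information set structure obtained by grouping decisions into cells. -/
def cellInfo (Ps : Finset (Set (Model Dec Meas Obs))) {n : ℕ} (rep : Fin n → Dec) :
    InfoStructure Dec Meas Obs (Constraint Ps × Fin n) where
  models k := k.1.1
  dec k := rep k.2

lemma measurable_cell {n : ℕ} {cell : Dec → Fin n} (hcell : Measurable cell) :
    Measurable fun ψ : Constraint Ps × Dec => (ψ.1, cell ψ.2) :=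
  measurable_fst.prodMk (hcell.comp measurable_snd)

/-- A weight constant on cells has the same information cost under `w` as under its image on cells.
Only the value at the decision of `ψ` changes. -/
lemma Observable.exoObjAt_cell (hO : Observable Ps V Vmax CV) (hCV : 0 < CV) {n : ℕ}
    {cell : Dec → Fin n} {rep : Fin n → Dec} (hcell : Measurable cell) {s : ℝ}
    (hrep : ∀ M ∈ powClass Ps, ∀ π, |V M π - V M (rep (cell π))| ≤ s) (γ : ℝ)
    (w : Measure (Constraint Ps × Dec)) [IsProbabilityMeasure w] (q : Measure (Dec × Meas))
    [IsProbabilityMeasure q] {B : ℝ} {ξ : Constraint Ps × Fin n → Dec × Meas → Obs → ℝ}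
    (hξ : IsWeightBdd B ξ) {M : Model Dec Meas Obs} (hM : M ∈ powClass Ps)
    (ψ : Constraint Ps × Dec) :
    exoObjAt V (hybridInfo Ps) γ w q (fun ψ => ξ (ψ.1, cell ψ.2)) M ψ ≤
      exoObjAt V (cellInfo Ps rep) γ (w.map fun ψ => (ψ.1, cell ψ.2)) q ξ M (ψ.1, cell ψ.2) + s := by
  have hm := measurable_cell (Ps := Ps) hcell
  have hw := Measure.isProbabilityMeasure_map (μ := w) hm.aemeasurable
  have hξ' : IsWeightBdd B fun ψ : Constraint Ps × Dec => ξ (ψ.1, cell ψ.2) :=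
    ⟨hξ.1.comp ((hm.comp measurable_fst).prodMk measurable_snd), fun ψ x o => hξ.2 _ x o⟩
  have hVi : Integrable (fun x => V M x.1) q := hO.integrable hCV (subset_co _ hM) q
  rw [hξ'.exoObjAt_eq _ γ q M ψ hVi, hξ.exoObjAt_eq _ γ q M _ hVi, infoCost_comp hm hξ.1]
  have h1 := (abs_le.mp (hrep M hM ψ.2)).2
  change V M ψ.2 - _ - _ + _ ≤ V M (rep (cell ψ.2)) - _ - _ + _ + s
  linarith

/-- The exploration-by-optimization objective is bounded by the regret DEC, for every reference
distribution. -/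
lemma Observable.exists_exoObj_le [Nonempty Dec] (hO : Observable Ps V Vmax CV) (hCV : 0 < CV)
    (hcomp : IsCompactClass (powClass Ps)) (hne : ∀ P ∈ Ps, P.Nonempty)
    {c : ℝ} (hc : 1 ≤ c) (hd : ModerateDecay c (fun ε => (rDec V (powClass Ps) ε).toReal))
    {ε : ℝ} (hε : 0 < ε) {n : ℕ} (hn : 2 ≤ 2 ^ n * ε) {D γ : ℝ}
    (hD : D = c * (rDec V (powClass Ps) ε).toReal / ε + CV)
    (hγ : γ = 32 * D * Real.sqrt (n + 1) / ε) (w : Measure (Constraint Ps × Dec))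
    [IsProbabilityMeasure w] {s : ℝ} (hs : 0 < s) :
    ∃ (q : Measure (Dec × Meas)) (ξ : Constraint Ps × Dec → Dec × Meas → Obs → ℝ),
      IsProbabilityMeasure q ∧ IsWeight ξ ∧ exoObj V (hybridInfo Ps) (2 * γ) w q ξ ≤
        ((5 * Real.sqrt (n + 1) * (D * ε) + s : ℝ) : EReal) := by
  obtain ⟨m, cell, rep, hcell, hrep⟩ := hO.exists_cells hCV hcomp (by positivity : 0 < s / 2)
  have hm := measurable_cell (Ps := Ps) hcell
  have hw := Measure.isProbabilityMeasure_map (μ := w) hm.aemeasurable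
  obtain ⟨q, B, ξ, hq, hξ, hle⟩ := hO.exists_finite_exo hCV hcomp hc hd hε hn hD hγ
    (cellInfo Ps rep) (fun k => k.1.2) (fun k => hne _ k.1.2)
    (w.map fun ψ => (ψ.1, cell ψ.2)) (by positivity : 0 < s / 2)
  refine ⟨q, fun ψ => ξ (ψ.1, cell ψ.2), hq,
    ⟨hξ.1.comp ((hm.comp measurable_fst).prodMk measurable_snd), B, fun ψ x o => hξ.2 _ x o⟩, ?_⟩
  refine iSup_le fun ψ => iSup₂_le fun M hM => EReal.coe_le_coe_iff.mpr ?_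
  have h1 := hO.exoObjAt_cell hCV hcell hrep (2 * γ) w q hξ (subset_powClass ψ.1.2 hM) ψ
  have h2 := hle (ψ.1, cell ψ.2) M hM
  linarith

end Bound

/-! ### Rounding weight functions to finitely many cells and rational values -/

section Rounding

variable {Dec Meas Obs : Type*} [MeasurableSpace Dec] [MeasurableSpace Meas] [MeasurableSpace Obs]

/-- Jensen's inequality for exp on `A`, multiplied by the mass of `A`. -/
lemma measure_mul_exp_average_le {Ψ : Type*} [MeasurableSpace Ψ] (w : Measure Ψ)
    [IsProbabilityMeasure w] {A : Set Ψ} (hA0 : w A ≠ 0) {f : Ψ → ℝ}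
    (hf : Measurable f) {B : ℝ} (hB : ∀ ψ, |f ψ| ≤ B) :
    w.real A * Real.exp (⨍ ψ in A, f ψ ∂w) ≤ ∫ ψ in A, Real.exp (f ψ) ∂w := by
  have hfi : IntegrableOn f A w :=
    (Integrable.of_bound hf.aestronglyMeasurable B (ae_of_all _ hB)).integrableOn
  have hei : IntegrableOn (Real.exp ∘ f) A w :=
    (Integrable.of_bound hf.exp.aestronglyMeasurable (Real.exp B) (ae_of_all _ fun ψ => by
      rw [Real.norm_of_nonneg (Real.exp_pos _).le]; exact exp_le_of_abs_le (hB ψ))).integrableOn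
  have h1 := convexOn_exp.map_set_average_le Real.continuous_exp.continuousOn isClosed_univ hA0
    (measure_ne_top _ _) (ae_of_all _ fun _ => Set.mem_univ _) hfi hei
  rw [setAverage_eq w (fun ψ => Real.exp (f ψ)), smul_eq_mul] at h1
  have h2 : 0 < w.real A := ENNReal.toReal_pos hA0 (measure_ne_top _ _)
  rwa [inv_mul_eq_div, le_div_iff₀ h2, mul_comm] at h1

variable {K : Type*} [Fintype K] [MeasurableSpace K] [MeasurableSingletonClass K]

/-- Averaging a weight function over the cells of a finite partition. -/
lemma exists_cell_average {Ψ : Type*} [MeasurableSpace Ψ] (w : Measure Ψ) [IsProbabilityMeasure w]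
    {cell : Ψ → K} (hcell : Measurable cell) (rep : K → Ψ) {B : ℝ}
    {ξ : Ψ → Dec × Meas → Obs → ℝ} (hξ : IsWeightBdd B ξ) :
    ∃ ζ : K → Dec × Meas → Obs → ℝ, IsWeightBdd B ζ ∧
      ∀ (q : Measure (Dec × Meas)) [IsProbabilityMeasure q] (M : Model Dec Meas Obs) (k : K),
        (w (cell ⁻¹' {k}) = 0 → infoCost (w.map cell) q ζ M k ≤ infoCost w q ξ M (rep k)) ∧
        w.real (cell ⁻¹' {k}) * infoCost (w.map cell) q ζ M k ≤
          ∫ ψ in cell ⁻¹' {k}, infoCost w q ξ M ψ ∂w := by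
  classical
  -- By Jensen, averaging over a cell lowers both the normalizing constant and the average of
  -- e^(-ξ), so the averaged cost does not increase. On a null cell the average is meaningless and
  -- the value at a representative is used instead.
  let ζ : K → Dec × Meas → Obs → ℝ := fun k x o =>
    if w (cell ⁻¹' {k}) = 0 then ξ (rep k) x o else ⨍ ψ in cell ⁻¹' {k}, ξ ψ x o ∂w
  have hAm : ∀ k, MeasurableSet (cell ⁻¹' {k}) := fun k => hcell (measurableSet_singleton k)
  have hξψ : ∀ x o, Measurable fun ψ => ξ ψ x o := fun x o =>
    hξ.1.comp (measurable_id.prodMk (measurable_const (a := (x, o))))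
  have hζ : IsWeightBdd B ζ := by
    refine ⟨measurable_from_prod_countable_right fun k => ?_, fun k x o => ?_⟩
    · by_cases h0 : w (cell ⁻¹' {k}) = 0
      · simp only [ζ, h0, if_true]
        exact hξ.measurable_right (rep k)
      · simp only [ζ, h0, if_false, setAverage_eq, smul_eq_mul]
        have : StronglyMeasurable fun p : ((Dec × Meas) × Obs) × Ψ => ξ p.2 p.1.1 p.1.2 :=
          (hξ.1.comp (measurable_snd.prodMk measurable_fst)).stronglyMeasurable
        exact (this.integral_prod_right (ν := w.restrict (cell ⁻¹' {k}))).measurable.const_mul _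
    · by_cases h0 : w (cell ⁻¹' {k}) = 0
      · simp only [ζ, h0, if_true]; exact hξ.2 _ _ _
      · simp only [ζ, h0, if_false, setAverage_eq, smul_eq_mul]
        have h2 : 0 < w.real (cell ⁻¹' {k}) := ENNReal.toReal_pos h0 (measure_ne_top _ _)
        rw [inv_mul_eq_div, abs_div, abs_of_pos h2, div_le_iff₀ h2]
        exact norm_setIntegral_le_of_norm_le_const (f := fun ψ => ξ ψ x o) (measure_lt_top _ _) fun ψ _ => hξ.2 ψ x o
  have hw := Measure.isProbabilityMeasure_map (μ := w) hcell.aemeasurable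
  have hmean : ∀ z : (Dec × Meas) × Obs, expMean (w.map cell) ζ z ≤ expMean w ξ z := by
    intro z
    have hU : ⋃ k, cell ⁻¹' {k} = Set.univ := by ext ψ; simp
    have h1 : expMean w ξ z = ∑ k, ∫ ψ in cell ⁻¹' {k}, Real.exp (ξ ψ z.1 z.2) ∂w := by
      rw [expMean, ← setIntegral_univ, ← hU]
      refine integral_iUnion_fintype hAm (fun k l hkl => ?_) fun k =>
        (hξ.integrable_exp z).integrableOn
      exact Disjoint.preimage _ (Set.disjoint_singleton.mpr hkl)
    rw [expMean_fintype, h1]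
    refine Finset.sum_le_sum fun k _ => ?_
    rw [map_measureReal_apply hcell (measurableSet_singleton k)]
    by_cases h0 : w (cell ⁻¹' {k}) = 0
    · simp only [Measure.real, h0, ENNReal.toReal_zero, zero_mul]
      exact integral_nonneg fun _ => (Real.exp_pos _).le
    · simp only [ζ, h0, if_false]
      exact measure_mul_exp_average_le w h0 (hξψ _ _) fun ψ => hξ.2 ψ _ _
  refine ⟨ζ, hζ, fun q _ M k => ⟨fun h0 => ?_, ?_⟩⟩
  · refine integral_mono (hζ.integrable_cost k _) (hξ.integrable_cost (rep k) _) fun z => ?_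
    simp only [ζ, h0, if_true]
    exact mul_le_mul_of_nonneg_right (hmean z) (Real.exp_pos _).le
  · by_cases h0 : w (cell ⁻¹' {k}) = 0
    · simp only [Measure.real, h0, ENNReal.toReal_zero, zero_mul]
      exact integral_nonneg fun ψ => infoCost_nonneg q M ψ
    simp only [infoCost]
    have hjm : Measurable fun p : Ψ × (Dec × Meas) × Obs =>
        expMean w ξ p.2 * Real.exp (-ξ p.1 p.2.1 p.2.2) :=
      (hξ.measurable_expMean.comp measurable_snd).mul hξ.1.neg.exp
    have hji : ∀ (ρ : Measure (Ψ × (Dec × Meas) × Obs)) [IsFiniteMeasure ρ], Integrable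
        (fun p => expMean w ξ p.2 * Real.exp (-ξ p.1 p.2.1 p.2.2)) ρ := fun ρ _ =>
      Integrable.of_bound hjm.aestronglyMeasurable (Real.exp (2 * B)) (ae_of_all _ fun p => by
        rw [Real.norm_of_nonneg (cost_nonneg p.1 p.2)]; exact hξ.cost_le p.1 p.2)
    rw [integral_integral_swap (f := fun ψ z => expMean w ξ z * Real.exp (-ξ ψ z.1 z.2)) (hji _),
      ← integral_const_mul]
    refine integral_mono ((hζ.integrable_cost k _).const_mul _)
      (hji ((w.restrict (cell ⁻¹' {k})).prod (q ⊗ₘ M.1))).integral_prod_right fun z => ?_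
    simp only
    rw [integral_const_mul]
    have h1 := measure_mul_exp_average_le w h0 (hξψ z.1 z.2).neg (B := B) fun ψ => by
      simp only [Pi.neg_apply, abs_neg]; exact hξ.2 ψ _ _
    have h2 : ⨍ ψ in cell ⁻¹' {k}, (-fun ψ => ξ ψ z.1 z.2) ψ ∂w = -ζ k z.1 z.2 := by
      simp only [ζ, h0, if_false, setAverage_eq, Pi.neg_apply, integral_neg, smul_neg]
    rw [h2] at h1
    calc w.real (cell ⁻¹' {k}) * (expMean (w.map cell) ζ z * Real.exp (-ζ k z.1 z.2)) =
          expMean (w.map cell) ζ z * (w.real (cell ⁻¹' {k}) * Real.exp (-ζ k z.1 z.2)) := by ring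
      _ ≤ expMean w ξ z * ∫ ψ in cell ⁻¹' {k}, Real.exp (-ξ ψ z.1 z.2) ∂w :=
          mul_le_mul (hmean z) h1 (by positivity) (expMean_nonneg z)

/-- Rounding a weight function to rational values. -/
lemma exists_rational_weight (w : Measure K) [IsProbabilityMeasure w] {B : ℝ}
    {ζ : K → Dec × Meas → Obs → ℝ} (hζ : IsWeightBdd B ζ) {s : ℝ} (hs : 0 < s) :
    ∃ ξ : K → Dec × Meas → Obs → ℚ, (∀ k, Measurable fun z : (Dec × Meas) × Obs => ξ k z.1 z.2) ∧
      IsWeightBdd (B + 1) (fun k x o => (ξ k x o : ℝ)) ∧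
      ∀ (q : Measure (Dec × Meas)) [IsProbabilityMeasure q] (M : Model Dec Meas Obs) (k : K),
        infoCost w q (fun k x o => (ξ k x o : ℝ)) M k ≤ infoCost w q ζ M k + s := by
  -- Rounding down to multiples of 1/m multiplies the cost by at most e^(1/m) ≤ 1 + 2/m, and the
  -- cost is at most e^(2B).
  set m : ℕ := ⌈2 * Real.exp (2 * B) / s⌉₊ + 1 with hm
  have hm0 : (0 : ℝ) < m := by rw [hm]; positivity
  have hm1 : (1 : ℝ) ≤ m := by rw [hm]; push_cast; linarith [Nat.cast_nonneg (α := ℝ) ⌈2 * Real.exp (2 * B) / s⌉₊]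
  have hms : 2 * Real.exp (2 * B) / s ≤ m := by
    rw [hm]; push_cast; linarith [Nat.le_ceil (2 * Real.exp (2 * B) / s)]
  let ξ : K → Dec × Meas → Obs → ℚ := fun k x o => (⌊m * ζ k x o⌋ : ℚ) / m
  have hξm : ∀ k, Measurable fun z : (Dec × Meas) × Obs => ξ k z.1 z.2 := fun k =>
    (measurable_of_countable fun i : ℤ => (i : ℚ) / m).comp
      (Int.measurable_floor.comp ((hζ.measurable_right k).const_mul _))
  have hle : ∀ k x o, (ξ k x o : ℝ) ≤ ζ k x o := by
    intro k x o
    simp only [ξ]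
    push_cast
    rw [div_le_iff₀ hm0, mul_comm]
    exact Int.floor_le _
  have hge : ∀ k x o, ζ k x o ≤ ξ k x o + 1 / m := by
    intro k x o
    simp only [ξ]
    push_cast
    rw [← add_div, le_div_iff₀ hm0, mul_comm]
    exact (Int.lt_floor_add_one _).le
  have hξ : IsWeightBdd (B + 1) (fun k x o => (ξ k x o : ℝ)) := by
    refine ⟨measurable_from_prod_countable_right fun k =>
      (measurable_of_countable fun r : ℚ => (r : ℝ)).comp (hξm k), fun k x o => ?_⟩
    have h1 := abs_le.mp (hζ.2 k x o)
    have h2 : 1 / (m : ℝ) ≤ 1 := by rw [div_le_one hm0]; exact hm1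
    rw [abs_le]
    constructor <;> linarith [hle k x o, hge k x o, h1.1, h1.2]
  refine ⟨ξ, hξm, hξ, fun q _ M k => ?_⟩
  have hpt : ∀ z : (Dec × Meas) × Obs, expMean w (fun k x o => (ξ k x o : ℝ)) z *
      Real.exp (-(ξ k z.1 z.2 : ℝ)) ≤ expMean w ζ z * Real.exp (-ζ k z.1 z.2) + s := by
    intro z
    have h1 : expMean w (fun k x o => (ξ k x o : ℝ)) z ≤ expMean w ζ z :=
      integral_mono (hξ.integrable_exp z) (hζ.integrable_exp z) fun k =>
        Real.exp_le_exp.mpr (hle k _ _)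
    have h2 : Real.exp (-(ξ k z.1 z.2 : ℝ)) ≤ Real.exp (-ζ k z.1 z.2) * Real.exp (1 / m) := by
      rw [← Real.exp_add]
      exact Real.exp_le_exp.mpr (by linarith [hge k z.1 z.2])
    have h3 : Real.exp (1 / m) ≤ 1 + 2 / m := by
      have h4 : |(1 : ℝ) / m| ≤ 1 := by
        rw [abs_of_pos (by positivity), div_le_one hm0]; exact hm1
      have := Real.abs_exp_sub_one_le h4
      rw [abs_of_pos (by positivity : (0 : ℝ) < 1 / m)] at this
      have h5 := (abs_le.mp this).2
      have h6 : 2 * (1 / (m : ℝ)) = 2 / m := by ring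
      linarith
    have h4 := hζ.cost_le (w := w) k z
    have h5 := cost_nonneg (w := w) (ξ := ζ) k z
    calc _ ≤ expMean w ζ z * (Real.exp (-ζ k z.1 z.2) * Real.exp (1 / m)) :=
          mul_le_mul h1 h2 (Real.exp_pos _).le (expMean_nonneg z)
      _ = expMean w ζ z * Real.exp (-ζ k z.1 z.2) * Real.exp (1 / m) := by ring
      _ ≤ expMean w ζ z * Real.exp (-ζ k z.1 z.2) * (1 + 2 / m) := by gcongr
      _ ≤ expMean w ζ z * Real.exp (-ζ k z.1 z.2) + Real.exp (2 * B) * (2 / m) := by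
          have : expMean w ζ z * Real.exp (-ζ k z.1 z.2) * (2 / m) ≤
            Real.exp (2 * B) * (2 / m) := by gcongr
          linarith
      _ ≤ _ := by
          have : Real.exp (2 * B) * (2 / m) ≤ s := by
            rw [div_le_iff₀ hs] at hms
            rw [mul_div_assoc', div_le_iff₀ hm0]
            linarith
          linarith
  refine (integral_mono (hξ.integrable_cost k _) ((hζ.integrable_cost k _).add
    (integrable_const s)) hpt).trans (le_of_eq ?_)
  rw [integral_add' (hζ.integrable_cost k _) (integrable_const s)]
  simp [infoCost]

end Rounding

/-! ### Measurable near-minimization -/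

section Existence

variable {Dec Meas Obs : Type*} [MeasurableSpace Dec] [MeasurableSpace Meas] [MeasurableSpace Obs]
  {Ps : Finset (Set (Model Dec Meas Obs))} {V : Model Dec Meas Obs → Dec → ℝ} {Vmax CV : ℝ}
  [MeasurableSpace.CountableOrCountablyGenerated (Dec × Meas) Obs]

/-- Any pair of a distribution and a weight function can be replaced, up to a small loss, by one
whose weight function is rational-valued and depends only on the cell. -/
lemma Observable.exists_cell_approx [Nonempty Dec] (hO : Observable Ps V Vmax CV) (hCV : 0 < CV)
    {n : ℕ} {cell : Dec → Fin n} {rep : Fin n → Dec} (hcell : Measurable cell) {s : ℝ} (hs : 0 < s)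
    (hrep : ∀ M ∈ powClass Ps, ∀ π, |V M π - V M (rep (cell π))| ≤ s) {γ : ℝ} (hγ : 0 < γ)
    (w : Measure (Constraint Ps × Dec)) [IsProbabilityMeasure w] (q : Measure (Dec × Meas))
    [IsProbabilityMeasure q] {ξ : Constraint Ps × Dec → Dec × Meas → Obs → ℝ}
    (hξ : IsWeight ξ) {r : ℝ} (hr : exoObj V (hybridInfo Ps) γ w q ξ ≤ r) :
    ∃ (B : ℝ) (ζ : Constraint Ps × Fin n → Dec × Meas → Obs → ℚ),
      (∀ k, Measurable fun z : (Dec × Meas) × Obs => ζ k z.1 z.2) ∧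
      IsWeightBdd B (fun k x o => (ζ k x o : ℝ)) ∧
      exoObj V (hybridInfo Ps) γ w q (fun ψ x o => (ζ (ψ.1, cell ψ.2) x o : ℝ)) ≤
        ((r + 3 * s : ℝ) : EReal) := by
  obtain ⟨hξm, B, hξB⟩ := hξ
  have hξ : IsWeightBdd B ξ := ⟨hξm, hξB⟩
  have hm := measurable_cell (Ps := Ps) hcell
  have hw := Measure.isProbabilityMeasure_map (μ := w) hm.aemeasurable
  obtain ⟨ζ₁, hζ₁, hζ₁le⟩ := exists_cell_average w hm
    (fun k : Constraint Ps × Fin n => (k.1, rep k.2)) hξ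
  obtain ⟨ζ, hζm, hζ, hζle⟩ := exists_rational_weight
    (w.map fun ψ : Constraint Ps × Dec => (ψ.1, cell ψ.2)) hζ₁ (div_pos hs hγ)
  -- The loss 3s is made of one `s` each for replacing the decision by its representative, averaging
  -- over cells, and rational rounding.
  refine ⟨B + 1, ζ, hζm, hζ, iSup_le fun ψ => iSup₂_le fun M hM => EReal.coe_le_coe_iff.mpr ?_⟩
  have hM : M ∈ ψ.1.1 := hM
  have hMp : M ∈ powClass Ps := subset_powClass ψ.1.2 hM
  have hVi : Integrable (fun x => V M x.1) q := hO.integrable hCV (subset_co _ hMp) q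
  have hr' : ∀ ψ' : Constraint Ps × Dec, M ∈ ψ'.1.1 →
      V M ψ'.2 - ∫ x, V M x.1 ∂q - γ + γ * infoCost w q ξ M ψ' ≤ r := by
    intro ψ' hMψ'
    have h1 : (exoObjAt V (hybridInfo Ps) γ w q ξ M ψ' : EReal) ≤ r :=
      (le_iSup₂ (f := fun (M : Model Dec Meas Obs) (_ : M ∈ (hybridInfo Ps).models ψ') =>
        (exoObjAt V (hybridInfo Ps) γ w q ξ M ψ' : EReal)) M hMψ').trans
        ((le_iSup (fun ψ' => ⨆ M ∈ (hybridInfo Ps).models ψ',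
          (exoObjAt V (hybridInfo Ps) γ w q ξ M ψ' : EReal)) ψ').trans hr)
    have h2 := EReal.coe_le_coe_iff.mp h1
    rwa [hξ.exoObjAt_eq _ γ q M ψ' hVi] at h2
  refine (hO.exoObjAt_cell hCV hcell hrep γ w q hζ hMp ψ).trans ?_
  rw [hζ.exoObjAt_eq _ γ q M _ hVi]
  set k : Constraint Ps × Fin n := (ψ.1, cell ψ.2) with hk
  have h1 := hζle q M k
  have h2 : V M (rep k.2) - ∫ x, V M x.1 ∂q - γ + γ * infoCost
      (w.map fun ψ : Constraint Ps × Dec => (ψ.1, cell ψ.2)) q ζ₁ M k ≤ r + s := by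
    obtain ⟨h3, h4⟩ := hζ₁le q M k
    by_cases h0 : w ((fun ψ : Constraint Ps × Dec => (ψ.1, cell ψ.2)) ⁻¹' {k}) = 0
    · have h5 := hr' (k.1, rep k.2) hM
      have h6 := mul_le_mul_of_nonneg_left (h3 h0) hγ.le
      linarith
    · set A := (fun ψ : Constraint Ps × Dec => (ψ.1, cell ψ.2)) ⁻¹' {k} with hA
      have hw0 : 0 < w.real A := ENNReal.toReal_pos h0 (measure_ne_top _ _)
      -- The objective bound, solved for the information cost. It holds for every `ψ'` of the cell
      -- because `M` is in the class of each of them; this is why cells keep the constraint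
      -- coordinate.
      set b := (r + s - V M (rep k.2) + ∫ x, V M x.1 ∂q + γ) / γ with hb
      have hAm : MeasurableSet A := hm (measurableSet_singleton k)
      have h5 : ∫ ψ' in A, infoCost w q ξ M ψ' ∂w ≤ w.real A * b := by
        have h6 : ∀ ψ' ∈ A, infoCost w q ξ M ψ' ≤ b := by
          intro ψ' hψ'
          have hψk : (ψ'.1, cell ψ'.2) = k := hψ'
          have hψ1 : ψ'.1 = k.1 := congrArg (fun j : Constraint Ps × Fin n => j.1) hψk
          have hψ2 : cell ψ'.2 = k.2 := congrArg (fun j : Constraint Ps × Fin n => j.2) hψk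
          have h7 := hr' ψ' (by rw [hψ1]; exact hM)
          have h8 := (abs_le.mp (hrep M hMp ψ'.2)).1
          rw [hψ2] at h8
          rw [hb, le_div_iff₀ hγ]
          linarith
        have hjm : StronglyMeasurable fun p : (Constraint Ps × Dec) × (Dec × Meas) × Obs =>
            expMean w ξ p.2 * Real.exp (-ξ p.1 p.2.1 p.2.2) :=
          ((hξ.measurable_expMean.comp measurable_snd).mul hξ.1.neg.exp).stronglyMeasurable
        have him : Measurable fun ψ' => infoCost w q ξ M ψ' :=
          (hjm.integral_prod_right (ν := q ⊗ₘ M.1)).measurable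
        have hi : Integrable (fun ψ' => infoCost w q ξ M ψ') w :=
          Integrable.of_bound him.aestronglyMeasurable (Real.exp (2 * B)) (ae_of_all _ fun ψ' => by
            rw [Real.norm_of_nonneg (infoCost_nonneg q M ψ')]; exact hξ.infoCost_le q M ψ')
        refine (setIntegral_mono_on hi.integrableOn (integrable_const b).integrableOn hAm h6).trans
          (le_of_eq ?_)
        rw [setIntegral_const, smul_eq_mul]
      have h9 := le_of_mul_le_mul_left (h4.trans h5) hw0
      rw [hb, le_div_iff₀ hγ] at h9
      linarith
  have h3 := mul_le_mul_of_nonneg_left h1 hγ.le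
  rw [mul_add, mul_div_cancel₀ _ hγ.ne'] at h3
  change V M (rep k.2) - _ - _ + _ + _ ≤ _
  linarith

/-- Near-minimizers of the objective whose weight function is rational-valued and depends only on
the cell. -/
lemma Observable.exists_near_minimizer [Nonempty Dec] (hO : Observable Ps V Vmax CV)
    (hCV : 0 < CV) (hPs : Ps.Nonempty) (hne : ∀ P ∈ Ps, P.Nonempty)
    {n : ℕ} {cell : Dec → Fin n} {rep : Fin n → Dec} (hcell : Measurable cell) {s : ℝ} (hs : 0 < s)
    (hrep : ∀ M ∈ powClass Ps, ∀ π, |V M π - V M (rep (cell π))| ≤ s) {γ : ℝ} (hγ : 0 < γ)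
    (w : Measure (Constraint Ps × Dec)) [IsProbabilityMeasure w] :
    ∃ (q : Measure (Dec × Meas)) (B : ℝ) (ζ : Constraint Ps × Fin n → Dec × Meas → Obs → ℚ),
      IsProbabilityMeasure q ∧
      (∀ k, Measurable fun z : (Dec × Meas) × Obs => ζ k z.1 z.2) ∧
      IsWeightBdd B (fun k x o => (ζ k x o : ℝ)) ∧
      ∀ (q' : Measure (Dec × Meas)) (ξ' : Constraint Ps × Dec → Dec × Meas → Obs → ℝ),
        IsProbabilityMeasure q' → IsWeight ξ' →
        exoObj V (hybridInfo Ps) γ w q (fun ψ x o => (ζ (ψ.1, cell ψ.2) x o : ℝ)) ≤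
          exoObj V (hybridInfo Ps) γ w q' ξ' + ((4 * s : ℝ) : EReal) := by
  obtain ⟨φ, -, -⟩ := hO.lipschitz
  obtain ⟨π₀⟩ := (inferInstance : Nonempty Dec)
  obtain ⟨P, hP⟩ := hPs
  obtain ⟨M₀, hM₀⟩ := hne P hP
  have hVb : ∀ {M : Model Dec Meas Obs} (q : Measure (Dec × Meas)) [IsProbabilityMeasure q],
      M ∈ powClass Ps → Integrable (fun x => V M x.1) q ∧ 0 ≤ ∫ x, V M x.1 ∂q ∧
        ∫ x, V M x.1 ∂q ≤ Vmax := by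
    intro M q _ hM
    have hi := hO.integrable hCV (subset_co _ hM) q
    refine ⟨hi, integral_nonneg fun x => (hO.mem_Icc M hM x.1).1, ?_⟩
    exact (integral_mono hi (integrable_const Vmax) fun x => (hO.mem_Icc M hM x.1).2).trans
      (by simp)
  -- Upper bounds of the objective over admissible pairs. Zero weights show that `Vmax` belongs to
  -- `R`; as information gains are at most 1, -Vmax - γ is a lower bound, so the infimum is finite.
  let R : Set ℝ := {r | ∃ (q : Measure (Dec × Meas))
    (ξ : Constraint Ps × Dec → Dec × Meas → Obs → ℝ), IsProbabilityMeasure q ∧ IsWeight ξ ∧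
      exoObj V (hybridInfo Ps) γ w q ξ ≤ r}
  have hRne : R.Nonempty := by
    refine ⟨Vmax, Measure.dirac (π₀, φ π₀), fun _ _ _ => 0, inferInstance,
      ⟨measurable_const, 0, fun _ _ _ => by simp⟩, ?_⟩
    refine iSup_le fun ψ => iSup₂_le fun M hM => EReal.coe_le_coe_iff.mpr ?_
    have hMp : M ∈ powClass Ps := subset_powClass ψ.1.2 hM
    obtain ⟨h1, h2, -⟩ := hVb (Measure.dirac (π₀, φ π₀)) hMp
    have h0 : IsWeightBdd 0 fun (_ : Constraint Ps × Dec) (_ : Dec × Meas) (_ : Obs) => (0 : ℝ) :=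
      ⟨measurable_const, fun _ _ _ => by simp⟩
    rw [h0.exoObjAt_eq _ γ _ M ψ h1]
    have h3 := h0.infoCost_le (w := w) (Measure.dirac (π₀, φ π₀)) M ψ
    simp only [mul_zero, Real.exp_zero] at h3
    have h4 := (hO.mem_Icc M hMp ψ.2).2
    have h5 := mul_le_mul_of_nonneg_left h3 hγ.le
    change V M ψ.2 - _ - _ + _ ≤ _
    linarith
  have hRb : BddBelow R := by
    refine ⟨-Vmax - γ, ?_⟩
    rintro r ⟨q, ξ, hq, ⟨hξm, B, hξB⟩, hle⟩
    have hξ : IsWeightBdd B ξ := ⟨hξm, hξB⟩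
    let ψ₀ : Constraint Ps × Dec := (⟨P, hP⟩, π₀)
    have hMp : M₀ ∈ powClass Ps := subset_powClass hP hM₀
    obtain ⟨h1, -, h2⟩ := hVb q hMp
    have h3 : (exoObjAt V (hybridInfo Ps) γ w q ξ M₀ ψ₀ : EReal) ≤ r :=
      (le_iSup₂ (f := fun (M : Model Dec Meas Obs) (_ : M ∈ (hybridInfo Ps).models ψ₀) =>
        (exoObjAt V (hybridInfo Ps) γ w q ξ M ψ₀ : EReal)) M₀ hM₀).trans
        ((le_iSup (fun ψ' => ⨆ M ∈ (hybridInfo Ps).models ψ',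
          (exoObjAt V (hybridInfo Ps) γ w q ξ M ψ' : EReal)) ψ₀).trans hle)
    have h4 := EReal.coe_le_coe_iff.mp h3
    rw [hξ.exoObjAt_eq _ γ q M₀ ψ₀ h1] at h4
    have h5 := mul_nonneg hγ.le (infoCost_nonneg (w := w) (ξ := ξ) q M₀ ψ₀)
    have h6 : 0 ≤ V M₀ ((hybridInfo Ps).dec ψ₀) := (hO.mem_Icc M₀ hMp _).1
    linarith
  obtain ⟨r, ⟨q, ξ, hq, hξ, hle⟩, hr⟩ := Real.lt_sInf_add_pos hRne hs
  obtain ⟨B, ζ, hζm, hζ, hζle⟩ := hO.exists_cell_approx hCV hcell hs hrep hγ w q hξ hle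
  refine ⟨q, B, ζ, hq, hζm, hζ, fun q' ξ' hq' hξ' => hζle.trans ?_⟩
  have hmem : ∀ r' : ℝ, exoObj V (hybridInfo Ps) γ w q' ξ' ≤ r' → sInf R ≤ r' := fun r' h =>
    csInf_le hRb ⟨q', ξ', hq', hξ', h⟩
  induction hx : exoObj V (hybridInfo Ps) γ w q' ξ' with
  | bot =>
    have := hmem (sInf R - 1) (by rw [hx]; exact bot_le)
    linarith
  | top => rw [EReal.top_add_coe]; exact le_top
  | coe r' =>
    have := hmem r' hx.le
    rw [← EReal.coe_add]
    exact EReal.coe_le_coe_iff.mpr (by linarith)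

/-- The cumulative profile of a history: the running sum of rational weight profiles, each of
which is selected by the profile of the preceding rounds. -/
def profile {K : Type*} (ζ : (K → ℚ) → K → Dec × Meas → Obs → ℚ) :
    ∀ t : ℕ, Hist Dec Meas Obs t → K → ℚ
  | 0, _ => 0
  | t + 1, h => fun k => profile ζ t (Fin.init h) k +
      ζ (profile ζ t (Fin.init h)) k (h (Fin.last t)).1 (h (Fin.last t)).2

/-- Profiles range over the countable type K → ℚ, so no regularity of `ζ` in its first argument is
needed. -/
lemma measurable_profile {K : Type*} [Fintype K] {ζ : (K → ℚ) → K → Dec × Meas → Obs → ℚ}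
    (hζ : ∀ S k, Measurable fun z : (Dec × Meas) × Obs => ζ S k z.1 z.2) (t : ℕ) :
    Measurable (profile ζ t) := by
  induction t with
  | zero => exact measurable_const
  | succ t ih =>
    have h1 : Measurable fun h : Hist Dec Meas Obs (t + 1) => profile ζ t (Fin.init h) :=
      ih.comp (measurable_pi_lambda _ fun s => measurable_pi_apply s.castSucc)
    refine measurable_pi_lambda _ fun k => ?_
    have h2 : Measurable fun p : (K → ℚ) × (Dec × Meas) × Obs => ζ p.1 k p.2.1 p.2.2 :=
      measurable_from_prod_countable_right fun S => hζ S k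
    exact ((measurable_pi_apply k).comp h1).add
      (h2.comp (h1.prodMk (measurable_pi_apply (Fin.last t))))

lemma sum_eq_profile {K : Type*} (ζ : (K → ℚ) → K → Dec × Meas → Obs → ℚ) (t : ℕ)
    (h : Hist Dec Meas Obs t) (k : K) :
    ∑ s : Fin t, (ζ (profile ζ s fun r => h (r.castLE s.isLt.le)) k (h s).1 (h s).2 : ℝ) =
      profile ζ t h k := by
  induction t with
  | zero => simp [profile]
  | succ t ih =>
    rw [Fin.sum_univ_castSucc]
    have h1 := ih (Fin.init h)
    simp only [profile]
    push_cast
    rw [← h1]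
    rfl

/-- Exploration by optimization can be run measurably with any positive tolerance. -/
lemma Observable.exists_isExOPlus [Nonempty Dec] (hO : Observable Ps V Vmax CV)
    (hCV : 0 < CV) (hcomp : IsCompactClass (powClass Ps)) (hPs : Ps.Nonempty)
    (hne : ∀ P ∈ Ps, P.Nonempty) {γ : ℝ} (hγ : 0 < γ)
    (w₁ : ProbabilityMeasure (Constraint Ps × Dec)) {η : ℝ} (hη : 0 < η) (T : ℕ) :
    ∃ A : Alg Dec Meas Obs, IsExOPlus V (hybridInfo Ps) w₁ γ η T A := by
  obtain ⟨n, cell, rep, hcell, hrep⟩ := hO.exists_cells hCV hcomp (by positivity : 0 < η / 4)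
  have hm := measurable_cell (Ps := Ps) hcell
  let K := Constraint Ps × Fin n
  let wt : (K → ℚ) → Measure (Constraint Ps × Dec) := fun S =>
    (w₁ : Measure (Constraint Ps × Dec)).tilted fun ψ => (S (ψ.1, cell ψ.2) : ℝ)
  have hwt : ∀ S, IsProbabilityMeasure (wt S) := by
    intro S
    refine isProbabilityMeasure_tilted ?_
    have h1 : Measurable fun ψ : Constraint Ps × Dec => Real.exp (S (ψ.1, cell ψ.2) : ℝ) :=
      (measurable_of_finite fun k : K => Real.exp (S k : ℝ)).comp hm
    obtain ⟨b, hb⟩ := Finite.bddAbove_range fun k : K => Real.exp (S k : ℝ)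
    exact Integrable.of_bound h1.aestronglyMeasurable b (ae_of_all _ fun ψ => by
      rw [Real.norm_of_nonneg (Real.exp_pos _).le]; exact hb ⟨_, rfl⟩)
  -- One near-minimizer per profile. There are countably many profiles, so an arbitrary choice is
  -- measurable. The losses add up to 4 · η/4 = η.
  choose q B ζ hq hζm hζ hle using fun S => hO.exists_near_minimizer hCV hPs hne hcell
    (by positivity : 0 < η / 4) hrep hγ (wt S)
  let κ : Kernel (K → ℚ) (Dec × Meas) := Kernel.ofFunOfCountable q
  have hκ : IsMarkovKernel κ := ⟨hq⟩
  let A : Alg Dec Meas Obs :=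
    { q := fun t => κ.comap (profile ζ t) (measurable_profile hζm t)
      markov := fun t => inferInstance }
  have hjoint : Measurable fun z : (K → ℚ) × K × (Dec × Meas) × Obs =>
      (ζ z.1 z.2.1 z.2.2.1 z.2.2.2 : ℝ) := by
    refine measurable_from_prod_countable_right fun S => ?_
    exact (hζ S).1
  refine ⟨A, fun t h ψ x o => (ζ (profile ζ t h) (ψ.1, cell ψ.2) x o : ℝ), fun t _ => ⟨?_, ?_⟩⟩
  · exact hjoint.comp (((measurable_profile hζm t).comp measurable_fst).prodMk
      ((hm.comp measurable_snd.fst).prodMk measurable_snd.snd))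
  · intro h
    refine ⟨⟨(hζ (profile ζ t h)).1.comp ((hm.comp measurable_fst).prodMk measurable_snd),
      B (profile ζ t h), fun ψ x o => (hζ (profile ζ t h)).2 _ x o⟩, fun q' ξ' hq' hξ' => ?_⟩
    have hw : expWeights (w₁ : Measure (Constraint Ps × Dec))
        (fun t h ψ x o => (ζ (profile ζ t h) (ψ.1, cell ψ.2) x o : ℝ)) t h =
        wt (profile ζ t h) := by
      simp only [expWeights, wt]
      congr 1
      ext ψ
      exact sum_eq_profile ζ t h (ψ.1, cell ψ.2)
    rw [hw]
    have h1 := hle (profile ζ t h) q' ξ' hq' hξ'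
    rwa [mul_div_cancel₀ _ (four_ne_zero' ℝ)] at h1

end Existence

/-! ### Exponential weights and the likelihood-ratio supermartingale -/

section Interaction

variable {Dec Meas Obs Ψ Label : Type*} [MeasurableSpace Dec] [MeasurableSpace Meas]
  [MeasurableSpace Obs] [MeasurableSpace Ψ] [MeasurableSpace Label]

/-- The exponent of the exponential weights after `t` rounds. -/
def cumWeight (ξ : ∀ t : ℕ, Hist Dec Meas Obs t → Ψ → Dec × Meas → Obs → ℝ) (t : ℕ)
    (h : Hist Dec Meas Obs t) (ψ : Ψ) : ℝ :=
  ∑ s : Fin t, ξ s (fun r => h (r.castLE s.isLt.le)) ψ (h s).1 (h s).2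

/-- The normalizing constant of the exponential weights after `t` rounds. -/
noncomputable def partition (w₁ : Measure Ψ)
    (ξ : ∀ t : ℕ, Hist Dec Meas Obs t → Ψ → Dec × Meas → Obs → ℝ) (t : ℕ)
    (h : Hist Dec Meas Obs t) : ℝ :=
  ∫ ψ, Real.exp (cumWeight ξ t h ψ) ∂w₁

/-- The learner's part of a full-information history. -/
def proj {t : ℕ} (h : Fin t → Label × (Dec × Meas) × Obs) : Hist Dec Meas Obs t := fun s => (h s).2

/-- Admissible weight functions for the first `T` rounds. -/
def Admissible (ξ : ∀ t : ℕ, Hist Dec Meas Obs t → Ψ → Dec × Meas → Obs → ℝ) (T : ℕ) : Prop :=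
  ∀ t < T, (Measurable fun z : Hist Dec Meas Obs t × Ψ × (Dec × Meas) × Obs =>
    ξ t z.1 z.2.1 z.2.2.1 z.2.2.2) ∧ ∀ h, IsWeight (ξ t h)

variable {ξ : ∀ t : ℕ, Hist Dec Meas Obs t → Ψ → Dec × Meas → Obs → ℝ} {T : ℕ}

lemma cumWeight_succ (t : ℕ) (h : Hist Dec Meas Obs (t + 1)) (ψ : Ψ) :
    cumWeight ξ (t + 1) h ψ = cumWeight ξ t (Fin.init h) ψ +
      ξ t (Fin.init h) ψ (h (Fin.last t)).1 (h (Fin.last t)).2 := by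
  rw [cumWeight, Fin.sum_univ_castSucc]
  rfl

lemma measurable_init {α : Type*} [MeasurableSpace α] (t : ℕ) :
    Measurable fun h : Fin (t + 1) → α => (Fin.init h : Fin t → α) :=
  measurable_pi_lambda _ fun s => measurable_pi_apply s.castSucc

lemma Admissible.measurable_cumWeight (hξ : Admissible ξ T) {t : ℕ} (ht : t ≤ T) :
    Measurable fun z : Hist Dec Meas Obs t × Ψ => cumWeight ξ t z.1 z.2 := by
  induction t with
  | zero => simp only [cumWeight, Finset.univ_eq_empty, Finset.sum_empty]; exact measurable_const
  | succ t ih =>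
    simp_rw [cumWeight_succ]
    have h1 : Measurable fun z : Hist Dec Meas Obs (t + 1) × Ψ =>
        (Fin.init z.1 : Hist Dec Meas Obs t) := (measurable_init t).comp measurable_fst
    have h2 : Measurable fun z : Hist Dec Meas Obs (t + 1) × Ψ => z.1 (Fin.last t) :=
      (measurable_pi_apply _).comp measurable_fst
    exact ((ih (by omega)).comp (h1.prodMk measurable_snd)).add
      ((hξ t (by omega)).1.comp (h1.prodMk (measurable_snd.prodMk h2)))

lemma Admissible.exists_bound (hξ : Admissible ξ T) {t : ℕ} (ht : t ≤ T)
    (h : Hist Dec Meas Obs t) : ∃ B, ∀ ψ, |cumWeight ξ t h ψ| ≤ B := by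
  induction t with
  | zero => exact ⟨0, fun ψ => by simp [cumWeight]⟩
  | succ t ih =>
    obtain ⟨B, hB⟩ := ih (by omega) (Fin.init h)
    obtain ⟨-, B', hB'⟩ := (hξ t (by omega)).2 (Fin.init h)
    refine ⟨B + B', fun ψ => ?_⟩
    rw [cumWeight_succ]
    exact (abs_add_le _ _).trans (add_le_add (hB ψ) (hB' _ _ _))

variable {w₁ : Measure Ψ} [IsProbabilityMeasure w₁]

lemma Admissible.integrable_exp (hξ : Admissible ξ T) {t : ℕ} (ht : t ≤ T)
    (h : Hist Dec Meas Obs t) : Integrable (fun ψ => Real.exp (cumWeight ξ t h ψ)) w₁ := by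
  obtain ⟨B, hB⟩ := hξ.exists_bound ht h
  exact Integrable.of_bound ((hξ.measurable_cumWeight ht).comp
    (measurable_const.prodMk measurable_id)).exp.aestronglyMeasurable (Real.exp B)
    (ae_of_all _ fun ψ => by
      rw [Real.norm_of_nonneg (Real.exp_pos _).le]; exact exp_le_of_abs_le (hB ψ))

lemma Admissible.partition_pos (hξ : Admissible ξ T) {t : ℕ} (ht : t ≤ T)
    (h : Hist Dec Meas Obs t) : 0 < partition w₁ ξ t h :=
  integral_exp_pos (hξ.integrable_exp ht h)

lemma Admissible.isProbabilityMeasure_expWeights (hξ : Admissible ξ T) {t : ℕ} (ht : t ≤ T)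
    (h : Hist Dec Meas Obs t) : IsProbabilityMeasure (expWeights w₁ ξ t h) :=
  isProbabilityMeasure_tilted (hξ.integrable_exp ht h)

lemma expMean_expWeights (t : ℕ) (h : Hist Dec Meas Obs t) (z : (Dec × Meas) × Obs) :
    expMean (expWeights w₁ ξ t h) (ξ t h) z =
      (∫ ψ, Real.exp (cumWeight ξ t h ψ + ξ t h ψ z.1 z.2) ∂w₁) / partition w₁ ξ t h := by
  rw [expMean, expWeights, integral_tilted, partition, ← integral_div]
  refine integral_congr_ae (ae_of_all _ fun ψ => ?_)
  simp only [smul_eq_mul, Real.exp_add]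
  rw [div_mul_eq_mul_div]
  rfl

/-- Source of the telescoping: the factors contributed by the rounds multiply to the final partition
function. -/
lemma expMean_expWeights_init (t : ℕ) (h : Hist Dec Meas Obs (t + 1)) :
    expMean (expWeights w₁ ξ t (Fin.init h)) (ξ t (Fin.init h)) (h (Fin.last t)) =
      partition w₁ ξ (t + 1) h / partition w₁ ξ t (Fin.init h) := by
  rw [expMean_expWeights]
  simp_rw [partition, cumWeight_succ]

/-- The per-round cost of `ψ`, as a function of the history and the outcome of the round. -/
noncomputable def roundCost (w₁ : Measure Ψ)
    (ξ : ∀ t : ℕ, Hist Dec Meas Obs t → Ψ → Dec × Meas → Obs → ℝ) (t : ℕ) (ψ : Ψ)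
    (h : Hist Dec Meas Obs t) (z : (Dec × Meas) × Obs) : ℝ :=
  expMean (expWeights w₁ ξ t h) (ξ t h) z * Real.exp (-ξ t h ψ z.1 z.2)

lemma Admissible.measurable_roundCost (hξ : Admissible ξ T) {t : ℕ} (ht : t < T) :
    Measurable fun p : Ψ × Hist Dec Meas Obs t × (Dec × Meas) × Obs =>
      roundCost w₁ ξ t p.1 p.2.1 p.2.2 := by
  simp only [roundCost, expMean_expWeights]
  have hc := hξ.measurable_cumWeight ht.le
  have hm := (hξ t ht).1
  have h1 : Measurable fun p : (Hist Dec Meas Obs t × (Dec × Meas) × Obs) =>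
      ∫ ψ, Real.exp (cumWeight ξ t p.1 ψ + ξ t p.1 ψ p.2.1 p.2.2) ∂w₁ := by
    have : StronglyMeasurable fun p : (Hist Dec Meas Obs t × (Dec × Meas) × Obs) × Ψ =>
        Real.exp (cumWeight ξ t p.1.1 p.2 + ξ t p.1.1 p.2 p.1.2.1 p.1.2.2) :=
      ((hc.comp (measurable_fst.fst.prodMk measurable_snd)).add
        (hm.comp (measurable_fst.fst.prodMk
          (measurable_snd.prodMk measurable_fst.snd)))).exp.stronglyMeasurable
    exact this.integral_prod_right.measurable
  have h2 : Measurable fun h : Hist Dec Meas Obs t => partition w₁ ξ t h :=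
    (hc.exp.stronglyMeasurable.integral_prod_right (ν := w₁)).measurable
  refine ((h1.comp measurable_snd).div (h2.comp measurable_snd.fst)).mul ?_
  exact (hm.comp (measurable_snd.fst.prodMk
    (measurable_fst.prodMk measurable_snd.snd))).neg.exp

lemma Admissible.roundCost_pos (hξ : Admissible ξ T) {t : ℕ} (ht : t < T) (ψ : Ψ)
    (h : Hist Dec Meas Obs t) (z : (Dec × Meas) × Obs) : 0 < roundCost w₁ ξ t ψ h z := by
  have hw := hξ.isProbabilityMeasure_expWeights (w₁ := w₁) ht.le h
  obtain ⟨hm, B, hB⟩ := (hξ t ht).2 h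
  have hW : IsWeightBdd B (ξ t h) := ⟨hm, hB⟩
  exact mul_pos (integral_exp_pos (hW.integrable_exp z)) (Real.exp_pos _)

variable (A : Alg Dec Meas Obs) (𝓔 : Env Dec Meas Obs Label)

/-- The conditional expectation of the per-round cost of `ψ` given the history and the model. -/
noncomputable def meanCost (w₁ : Measure Ψ)
    (ξ : ∀ t : ℕ, Hist Dec Meas Obs t → Ψ → Dec × Meas → Obs → ℝ) (t : ℕ) (ψ : Ψ)
    (h : Hist Dec Meas Obs t) (e : Label) : ℝ :=
  infoCost (expWeights w₁ ξ t h) (A.q t h) (ξ t h) (𝓔.modelOf e) ψ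

/-- The bound on a weight may vary with the history. Writing the mean cost as an iterated lower
integral gives joint measurability without a uniform bound. -/
lemma Admissible.ofReal_meanCost (hξ : Admissible ξ T) {t : ℕ} (ht : t < T) (ψ : Ψ)
    (h : Hist Dec Meas Obs t) (e : Label) :
    ENNReal.ofReal (meanCost A 𝓔 w₁ ξ t ψ h e) =
      ∫⁻ x, ∫⁻ o, ENNReal.ofReal (roundCost w₁ ξ t ψ h (x, o)) ∂𝓔.model (e, x) ∂A.q t h := by
  have hw := hξ.isProbabilityMeasure_expWeights (w₁ := w₁) ht.le h
  obtain ⟨hm, B, hB⟩ := (hξ t ht).2 h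
  have hW : IsWeightBdd B (ξ t h) := ⟨hm, hB⟩
  rw [meanCost, infoCost, ofReal_integral_eq_lintegral_ofReal (hW.integrable_cost ψ _)
    (ae_of_all _ fun z => cost_nonneg ψ z),
    Measure.lintegral_compProd (hW.measurable_cost ψ).ennreal_ofReal]
  rfl

lemma Admissible.measurable_meanCost (hξ : Admissible ξ T) {t : ℕ} (ht : t < T) :
    Measurable fun p : Ψ × Hist Dec Meas Obs t × Label =>
      ENNReal.ofReal (meanCost A 𝓔 w₁ ξ t p.1 p.2.1 p.2.2) := by
  simp_rw [hξ.ofReal_meanCost A 𝓔 ht]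
  let κ₂ : Kernel ((Ψ × Hist Dec Meas Obs t × Label) × (Dec × Meas)) Obs :=
    𝓔.model.comap (fun p => (p.1.2.2, p.2)) (measurable_fst.snd.snd.prodMk measurable_snd)
  let κ₁ : Kernel (Ψ × Hist Dec Meas Obs t × Label) (Dec × Meas) :=
    (A.q t).comap (fun p => p.2.1) measurable_snd.fst
  have h1 : Measurable fun p : ((Ψ × Hist Dec Meas Obs t × Label) × (Dec × Meas)) × Obs =>
      ENNReal.ofReal (roundCost w₁ ξ t p.1.1.1 p.1.1.2.1 (p.1.2, p.2)) := by
    have hg : Measurable fun p : ((Ψ × Hist Dec Meas Obs t × Label) × (Dec × Meas)) × Obs =>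
        ((p.1.1.1, p.1.1.2.1, (p.1.2, p.2)) : Ψ × Hist Dec Meas Obs t × (Dec × Meas) × Obs) :=
      measurable_fst.fst.fst.prodMk (measurable_fst.fst.snd.fst.prodMk
        (measurable_fst.snd.prodMk measurable_snd))
    exact ((hξ.measurable_roundCost (w₁ := w₁) ht).comp hg).ennreal_ofReal
  have h2 := h1.lintegral_kernel_prod_right' (κ := κ₂)
  exact h2.lintegral_kernel_prod_right' (κ := κ₁)

/-- The likelihood-ratio factor of one round. -/
noncomputable def ratio (w₁ : Measure Ψ)
    (ξ : ∀ t : ℕ, Hist Dec Meas Obs t → Ψ → Dec × Meas → Obs → ℝ) (t : ℕ) (ψ : Ψ)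
    (h : Hist Dec Meas Obs t) (z : Label × (Dec × Meas) × Obs) : ENNReal :=
  ENNReal.ofReal (roundCost w₁ ξ t ψ h z.2) / ENNReal.ofReal (meanCost A 𝓔 w₁ ξ t ψ h z.1)

lemma Admissible.measurable_ratio (hξ : Admissible ξ T) {t : ℕ} (ht : t < T) :
    Measurable fun p : Ψ × Hist Dec Meas Obs t × Label × (Dec × Meas) × Obs =>
      ratio A 𝓔 w₁ ξ t p.1 p.2.1 p.2.2 := by
  have hg₁ : Measurable fun p : Ψ × Hist Dec Meas Obs t × Label × (Dec × Meas) × Obs =>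
      ((p.1, p.2.1, p.2.2.2) : Ψ × Hist Dec Meas Obs t × (Dec × Meas) × Obs) :=
    measurable_fst.prodMk (measurable_snd.fst.prodMk measurable_snd.snd.snd)
  have hg₂ : Measurable fun p : Ψ × Hist Dec Meas Obs t × Label × (Dec × Meas) × Obs =>
      ((p.1, p.2.1, p.2.2.1) : Ψ × Hist Dec Meas Obs t × Label) :=
    measurable_fst.prodMk (measurable_snd.fst.prodMk measurable_snd.snd.fst)
  have h1 := ((hξ.measurable_roundCost (w₁ := w₁) ht).comp hg₁).ennreal_ofReal
  have h2 := (hξ.measurable_meanCost (w₁ := w₁) A 𝓔 ht).comp hg₂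
  simp only [ratio, div_eq_mul_inv]
  exact h1.mul h2.inv

lemma measurable_proj {t : ℕ} : Measurable fun h : Fin t → Label × (Dec × Meas) × Obs => proj h :=
  measurable_pi_lambda _ fun s => (measurable_pi_apply s).snd

instance (t : ℕ) : IsMarkovKernel (roundKernel A 𝓔 t) :=
  Kernel.IsMarkovKernel.map _ MeasurableEquiv.prodAssoc.measurable

lemma measurable_snoc {α : Type*} [MeasurableSpace α] (t : ℕ) :
    Measurable fun z : (Fin t → α) × α => (Fin.snoc (α := fun _ => α) z.1 z.2 : Fin (t + 1) → α) := by
  refine measurable_pi_lambda _ fun s => ?_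
  refine Fin.lastCases ?_ (fun s => ?_) s
  · simp only [Fin.snoc_last]; exact measurable_snd
  · simp only [Fin.snoc_castSucc]; exact (measurable_pi_apply s).comp measurable_fst

instance isProbabilityMeasure_law (t : ℕ) : IsProbabilityMeasure (law A 𝓔 t) := by
  induction t with
  | zero => rw [law]; infer_instance
  | succ t ih =>
    rw [law]
    exact Measure.isProbabilityMeasure_map (measurable_snoc t).aemeasurable

/-- Model and decision are independent given the past. With the label fixed, the numerator
integrates exactly to the denominator, and the quotient is at most 1 even in the degenerate case of
mean cost 0. -/
lemma Admissible.lintegral_ratio_le (hξ : Admissible ξ T) {t : ℕ} (ht : t < T) (ψ : Ψ)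
    (h : Fin t → Label × (Dec × Meas) × Obs) :
    ∫⁻ z, ratio A 𝓔 w₁ ξ t ψ (proj h) z ∂(roundKernel A 𝓔 t h) ≤ 1 := by
  have hr : Measurable fun z : Label × (Dec × Meas) × Obs => ratio A 𝓔 w₁ ξ t ψ (proj h) z := by
    have hg : Measurable fun z : Label × (Dec × Meas) × Obs =>
        ((ψ, proj h, z) : Ψ × Hist Dec Meas Obs t × Label × (Dec × Meas) × Obs) :=
      measurable_const.prodMk (measurable_const.prodMk measurable_id)
    have h0 := (hξ.measurable_ratio (w₁ := w₁) A 𝓔 ht).comp hg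
    exact h0
  have hra : Measurable fun z : (Label × (Dec × Meas)) × Obs =>
      ratio A 𝓔 w₁ ξ t ψ (proj h) (z.1.1, z.1.2, z.2) :=
    hr.comp (measurable_fst.fst.prodMk (measurable_fst.snd.prodMk measurable_snd))
  have hra1 : Measurable fun z : Label × (Dec × Meas) =>
      ∫⁻ o, ratio A 𝓔 w₁ ξ t ψ (proj h) (z.1, z.2, o) ∂𝓔.model z :=
    hra.lintegral_kernel_prod_right' (κ := 𝓔.model)
  rw [roundKernel, Kernel.map_apply _ MeasurableEquiv.prodAssoc.measurable,
    lintegral_map hr MeasurableEquiv.prodAssoc.measurable]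
  have h1 : ∀ z : (Label × (Dec × Meas)) × Obs, MeasurableEquiv.prodAssoc z =
      (z.1.1, z.1.2, z.2) := fun z => rfl
  simp_rw [h1]
  rw [Kernel.lintegral_compProd _ _ _ hra, Kernel.prod_apply]
  simp only [Kernel.comap_apply]
  rw [lintegral_prod _ hra1.aemeasurable]
  have h2 : ∀ e, ∫⁻ x, ∫⁻ o, ratio A 𝓔 w₁ ξ t ψ (proj h) (e, x, o) ∂𝓔.model (e, x)
      ∂A.q t (learnerHist h t le_rfl) ≤ 1 := by
    intro e
    have hc : Measurable fun z : (Dec × Meas) × Obs =>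
        ENNReal.ofReal (roundCost w₁ ξ t ψ (proj h) z) := by
      have hg : Measurable fun z : (Dec × Meas) × Obs =>
          ((ψ, proj h, z) : Ψ × Hist Dec Meas Obs t × (Dec × Meas) × Obs) :=
        measurable_const.prodMk (measurable_const.prodMk measurable_id)
      have h0 := ((hξ.measurable_roundCost (w₁ := w₁) ht).comp hg).ennreal_ofReal
      exact h0
    have h3 : ∀ x, ∫⁻ o, ratio A 𝓔 w₁ ξ t ψ (proj h) (e, x, o) ∂𝓔.model (e, x) =
        (∫⁻ o, ENNReal.ofReal (roundCost w₁ ξ t ψ (proj h) (x, o)) ∂𝓔.model (e, x)) *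
          (ENNReal.ofReal (meanCost A 𝓔 w₁ ξ t ψ (proj h) e))⁻¹ := by
      intro x
      have hcx : Measurable fun o => ENNReal.ofReal (roundCost w₁ ξ t ψ (proj h) (x, o)) :=
        hc.comp (measurable_prodMk_left (x := x))
      simp only [ratio, div_eq_mul_inv]
      rw [lintegral_mul_const _ hcx]
    simp_rw [h3]
    have hc2 : Measurable fun x => ∫⁻ o, ENNReal.ofReal (roundCost w₁ ξ t ψ (proj h) (x, o))
        ∂𝓔.model (e, x) := hc.lintegral_kernel_prod_right' (κ := 𝓔.model.sectR e)
    rw [lintegral_mul_const _ hc2]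
    have h4 := hξ.ofReal_meanCost (w₁ := w₁) A 𝓔 ht ψ (proj h) e
    change (∫⁻ x, _ ∂A.q t (proj h)) * _ ≤ 1
    rw [← h4, ← div_eq_mul_inv]
    exact ENNReal.div_self_le_one
  exact (lintegral_mono h2).trans (by simp)

/-- The supermartingale of likelihood ratios. -/
noncomputable def ratioProcess (w₁ : Measure Ψ)
    (ξ : ∀ t : ℕ, Hist Dec Meas Obs t → Ψ → Dec × Meas → Obs → ℝ) (ψ : Ψ) :
    ∀ t : ℕ, (Fin t → Label × (Dec × Meas) × Obs) → ENNReal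
  | 0, _ => 1
  | t + 1, h => ratioProcess w₁ ξ ψ t (Fin.init h) *
      ratio A 𝓔 w₁ ξ t ψ (proj (Fin.init h)) (h (Fin.last t))

lemma Admissible.measurable_ratioProcess (hξ : Admissible ξ T) {t : ℕ} (ht : t ≤ T) :
    Measurable fun p : Ψ × (Fin t → Label × (Dec × Meas) × Obs) =>
      ratioProcess A 𝓔 w₁ ξ p.1 t p.2 := by
  induction t with
  | zero => exact measurable_const
  | succ t ih =>
    have h1 : Measurable fun p : Ψ × (Fin (t + 1) → Label × (Dec × Meas) × Obs) =>
      (Fin.init p.2 : Fin t → Label × (Dec × Meas) × Obs) := (measurable_init t).comp measurable_snd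
    have hg₁ : Measurable fun p : Ψ × (Fin (t + 1) → Label × (Dec × Meas) × Obs) =>
        (p.1, (Fin.init p.2 : Fin t → Label × (Dec × Meas) × Obs)) := measurable_fst.prodMk h1
    have hg₂ : Measurable fun p : Ψ × (Fin (t + 1) → Label × (Dec × Meas) × Obs) =>
        ((p.1, proj (Fin.init p.2 : Fin t → Label × (Dec × Meas) × Obs), p.2 (Fin.last t)) :
          Ψ × Hist Dec Meas Obs t × Label × (Dec × Meas) × Obs) :=
      measurable_fst.prodMk ((measurable_proj.comp h1).prodMk
        ((measurable_pi_apply _).comp measurable_snd))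
    have h2 := (ih (by omega)).comp hg₁
    have h3 := (hξ.measurable_ratio (w₁ := w₁) (t := t) A 𝓔 (by omega)).comp hg₂
    simp only [ratioProcess]
    exact h2.mul h3

lemma Admissible.lintegral_ratioProcess_le (hξ : Admissible ξ T) (ψ : Ψ) {t : ℕ} (ht : t ≤ T) :
    ∫⁻ h, ratioProcess A 𝓔 w₁ ξ ψ t h ∂(law A 𝓔 t) ≤ 1 := by
  induction t with
  | zero => simp [ratioProcess]
  | succ t ih =>
    have hm : Measurable (ratioProcess A 𝓔 w₁ ξ ψ (t + 1)) := by
      have h0 := (hξ.measurable_ratioProcess (w₁ := w₁) A 𝓔 ht).comp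
        (measurable_prodMk_left (x := ψ))
      exact h0
    have hm0 : Measurable (ratioProcess A 𝓔 w₁ ξ ψ t) := by
      have h0 := (hξ.measurable_ratioProcess (w₁ := w₁) (t := t) A 𝓔 (by omega)).comp
        (measurable_prodMk_left (x := ψ))
      exact h0
    have hr : Measurable fun z : (Fin t → Label × (Dec × Meas) × Obs) ×
        Label × (Dec × Meas) × Obs => ratio A 𝓔 w₁ ξ t ψ (proj z.1) z.2 := by
      have hg : Measurable fun z : (Fin t → Label × (Dec × Meas) × Obs) ×
          Label × (Dec × Meas) × Obs =>
          ((ψ, proj z.1, z.2) : Ψ × Hist Dec Meas Obs t × Label × (Dec × Meas) × Obs) :=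
        measurable_const.prodMk ((measurable_proj.comp measurable_fst).prodMk measurable_snd)
      have h0 := (hξ.measurable_ratio (w₁ := w₁) (t := t) A 𝓔 (by omega)).comp hg
      exact h0
    have h1 : ∀ z : (Fin t → Label × (Dec × Meas) × Obs) × Label × (Dec × Meas) × Obs,
        ratioProcess A 𝓔 w₁ ξ ψ (t + 1)
          (Fin.snoc (α := fun _ => Label × (Dec × Meas) × Obs) z.1 z.2) =
        ratioProcess A 𝓔 w₁ ξ ψ t z.1 * ratio A 𝓔 w₁ ξ t ψ (proj z.1) z.2 := by
      intro z
      simp only [ratioProcess, Fin.init_snoc, Fin.snoc_last]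
    rw [law, lintegral_map hm (measurable_snoc t)]
    simp_rw [h1]
    have hm1 : Measurable fun z : (Fin t → Label × (Dec × Meas) × Obs) ×
        Label × (Dec × Meas) × Obs =>
        ratioProcess A 𝓔 w₁ ξ ψ t z.1 * ratio A 𝓔 w₁ ξ t ψ (proj z.1) z.2 := by
      have hg : Measurable fun z : (Fin t → Label × (Dec × Meas) × Obs) ×
          Label × (Dec × Meas) × Obs => z.1 := measurable_fst
      have h0 := hm0.comp hg
      exact h0.mul hr
    have hr1 (h : Fin t → Label × (Dec × Meas) × Obs) :
        Measurable fun z => ratio A 𝓔 w₁ ξ t ψ (proj h) z := by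
      have h0 := hr.comp (measurable_prodMk_left (x := h))
      exact h0
    rw [Measure.lintegral_compProd hm1]
    refine le_trans (lintegral_mono fun h => ?_) (ih (by omega))
    simp only
    rw [lintegral_const_mul _ (hr1 h)]
    have h2 := hξ.lintegral_ratio_le (w₁ := w₁) (t := t) A 𝓔 (by omega) ψ h
    calc _ ≤ ratioProcess A 𝓔 w₁ ξ ψ t h * 1 := mul_le_mul_right h2 _
      _ = _ := mul_one _

/-- The cumulative information gain of `ψ`. -/
noncomputable def infoGain (w₁ : Measure Ψ)
    (ξ : ∀ t : ℕ, Hist Dec Meas Obs t → Ψ → Dec × Meas → Obs → ℝ) (ψ : Ψ) (t : ℕ)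
    (h : Fin t → Label × (Dec × Meas) × Obs) : ℝ :=
  ∑ s : Fin t, (1 - meanCost A 𝓔 w₁ ξ s ψ (learnerHist h s s.isLt.le) (h s).1)

lemma infoGain_succ (ψ : Ψ) (t : ℕ) (h : Fin (t + 1) → Label × (Dec × Meas) × Obs) :
    infoGain A 𝓔 w₁ ξ ψ (t + 1) h = infoGain A 𝓔 w₁ ξ ψ t (Fin.init h) +
      (1 - meanCost A 𝓔 w₁ ξ t ψ (proj (Fin.init h)) (h (Fin.last t)).1) := by
  rw [infoGain, Fin.sum_univ_castSucc]
  rfl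

/-- The costs multiply to Z exp(-L(ψ)) by telescoping, and each reciprocal mean cost satisfies 1/i ≥
e^(1 - i), which turns the denominators into the exponential of the information gain. -/
lemma Admissible.le_ratioProcess (hξ : Admissible ξ T) (ψ : Ψ) {t : ℕ} (ht : t ≤ T)
    (h : Fin t → Label × (Dec × Meas) × Obs) :
    ENNReal.ofReal (partition w₁ ξ t (proj h) * Real.exp (-cumWeight ξ t (proj h) ψ) *
      Real.exp (infoGain A 𝓔 w₁ ξ ψ t h)) ≤ ratioProcess A 𝓔 w₁ ξ ψ t h := by
  induction t with
  | zero => simp [partition, cumWeight, infoGain, ratioProcess]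
  | succ t ih =>
    have hinit : (Fin.init (proj h) : Hist Dec Meas Obs t) = proj (Fin.init h) := rfl
    have hlast : (proj h) (Fin.last t) = (h (Fin.last t)).2 := rfl
    have hZ := hξ.partition_pos (w₁ := w₁) (t := t) (by omega) (proj (Fin.init h))
    have hcost := expMean_expWeights_init (w₁ := w₁) (ξ := ξ) t (proj h)
    rw [hinit, hlast] at hcost
    set c := roundCost w₁ ξ t ψ (proj (Fin.init h)) (h (Fin.last t)).2 with hc
    set i := meanCost A 𝓔 w₁ ξ t ψ (proj (Fin.init h)) (h (Fin.last t)).1 with hi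
    have hc0 : 0 < c := hξ.roundCost_pos (by omega) ψ _ _
    have hw := hξ.isProbabilityMeasure_expWeights (w₁ := w₁) (t := t) (by omega)
      (proj (Fin.init h))
    have hi0 : 0 ≤ i := infoCost_nonneg _ _ _
    have hr : ENNReal.ofReal (c * Real.exp (1 - i)) ≤
        ratio A 𝓔 w₁ ξ t ψ (proj (Fin.init h)) (h (Fin.last t)) := by
      rw [ratio, ← hc, ← hi]
      rcases hi0.eq_or_lt with h0 | h0
      -- With zero mean cost the ratio is infinite, since the cost itself is positive.
      · rw [← h0, ENNReal.ofReal_zero, ENNReal.div_zero (by simpa using hc0)]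
        exact le_top
      · rw [← ENNReal.ofReal_div_of_pos h0]
        refine ENNReal.ofReal_le_ofReal ?_
        rw [le_div_iff₀ h0, mul_assoc]
        refine mul_le_of_le_one_right hc0.le ?_
        have h1 : i ≤ Real.exp (i - 1) := by linarith [Real.add_one_le_exp (i - 1)]
        calc Real.exp (1 - i) * i ≤ Real.exp (1 - i) * Real.exp (i - 1) := by gcongr
          _ = 1 := by rw [← Real.exp_add]; simp
    have heq : partition w₁ ξ (t + 1) (proj h) * Real.exp (-cumWeight ξ (t + 1) (proj h) ψ) *
        Real.exp (infoGain A 𝓔 w₁ ξ ψ (t + 1) h) =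
        partition w₁ ξ t (proj (Fin.init h)) * Real.exp (-cumWeight ξ t (proj (Fin.init h)) ψ) *
          Real.exp (infoGain A 𝓔 w₁ ξ ψ t (Fin.init h)) * (c * Real.exp (1 - i)) := by
      have h2 : c = partition w₁ ξ (t + 1) (proj h) / partition w₁ ξ t (proj (Fin.init h)) *
          Real.exp (-ξ t (proj (Fin.init h)) ψ (h (Fin.last t)).2.1 (h (Fin.last t)).2.2) := by
        rw [hc, roundCost, hcost]
      rw [h2, cumWeight_succ, infoGain_succ, hinit, hlast, neg_add, Real.exp_add, Real.exp_add,
        ← hi]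
      field_simp
    rw [heq, ENNReal.ofReal_mul (by positivity), ratioProcess]
    exact mul_le_mul' (ih (by omega) (Fin.init h)) hr

/-- With high probability, every measurable set of information sets of positive prior weight
contains an element with a small cumulative information gain. -/
lemma Admissible.exists_infoGain_le (hξ : Admissible ξ T) {δ : ℝ} (hδ : 0 < δ)
    {h : Fin T → Label × (Dec × Meas) × Obs}
    (hh : ∫⁻ ψ, ratioProcess A 𝓔 w₁ ξ ψ T h ∂w₁ < ENNReal.ofReal (1 / δ)) {S : Set Ψ}
    (hS0 : w₁ S ≠ 0) :
    ∃ ψ ∈ S, infoGain A 𝓔 w₁ ξ ψ T h ≤ Real.log (1 / δ) + 2 * Real.log (1 / w₁.real S) := by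
  by_contra hcon
  push Not at hcon
  have ha : 0 < w₁.real S := ENNReal.toReal_pos hS0 (measure_ne_top _ _)
  set a := w₁.real S with hadef
  set R := Real.log (1 / δ) + 2 * Real.log (1 / a) with hR
  have heR : Real.exp R * a ^ 2 = 1 / δ := by
    rw [hR, Real.exp_add, Real.exp_log (by positivity), two_mul, Real.exp_add,
      Real.exp_log (by positivity)]
    field_simp
  have hZ := hξ.partition_pos (w₁ := w₁) le_rfl (proj h)
  set Z := partition w₁ ξ T (proj h) with hZdef
  obtain ⟨B, hB⟩ := hξ.exists_bound le_rfl (proj h)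
  have hLm : Measurable fun ψ => cumWeight ξ T (proj h) ψ :=
    (hξ.measurable_cumWeight le_rfl).comp (measurable_prodMk_left (x := proj h))
  have hi1 : Integrable (fun ψ => Z * Real.exp (-cumWeight ξ T (proj h) ψ)) w₁ :=
    (Integrable.of_bound hLm.neg.exp.aestronglyMeasurable (Real.exp B) (ae_of_all _ fun ψ => by
      rw [Real.norm_of_nonneg (Real.exp_pos _).le]
      exact exp_le_of_abs_le (by simpa using hB ψ))).const_mul Z
  have hi2 : Integrable (fun ψ => Real.exp (cumWeight ξ T (proj h) ψ)) w₁ :=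
    hξ.integrable_exp le_rfl (proj h)
  -- Cauchy-Schwarz in linearized form: Z e^(-L) ≥ 2a - (a²/Z) e^L pointwise, and ∫_S e^L ≤ Z, so
  -- the integral is at least 2a² - a².
  have hlow : a ^ 2 ≤ ∫ ψ in S, Z * Real.exp (-cumWeight ξ T (proj h) ψ) ∂w₁ := by
    have h1 : ∫ ψ in S, (2 * a - a ^ 2 / Z * Real.exp (cumWeight ξ T (proj h) ψ)) ∂w₁ ≤
        ∫ ψ in S, Z * Real.exp (-cumWeight ξ T (proj h) ψ) ∂w₁ := by
      refine setIntegral_mono ((integrable_const _).sub (hi2.const_mul _)).integrableOn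
        hi1.integrableOn fun ψ => ?_
      simp only
      set L := cumWeight ξ T (proj h) ψ
      have h2 : Z * Real.exp (-L) - (2 * a - a ^ 2 / Z * Real.exp L) =
          (Z * Real.exp (-L) - a) ^ 2 / (Z * Real.exp (-L)) := by
        rw [Real.exp_neg]
        have := Real.exp_pos L
        field_simp
        ring
      have h3 : 0 ≤ (Z * Real.exp (-L) - a) ^ 2 / (Z * Real.exp (-L)) := by positivity
      linarith
    refine le_trans ?_ h1
    rw [integral_sub (integrable_const _) (hi2.const_mul _).integrableOn, integral_const_mul (a ^ 2 / Z),
      setIntegral_const, smul_eq_mul, ← hadef]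
    have h4 : ∫ ψ in S, Real.exp (cumWeight ξ T (proj h) ψ) ∂w₁ ≤ Z :=
      setIntegral_le_integral hi2 (ae_of_all _ fun ψ => (Real.exp_pos _).le)
    have h5 : a ^ 2 / Z * ∫ ψ in S, Real.exp (cumWeight ξ T (proj h) ψ) ∂w₁ ≤ a ^ 2 / Z * Z := by
      gcongr
    rw [div_mul_cancel₀ _ hZ.ne'] at h5
    nlinarith
  have hge : ENNReal.ofReal (1 / δ) ≤ ∫⁻ ψ, ratioProcess A 𝓔 w₁ ξ ψ T h ∂w₁ := by
    calc ENNReal.ofReal (1 / δ) ≤ ENNReal.ofReal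
          (∫ ψ in S, Real.exp R * (Z * Real.exp (-cumWeight ξ T (proj h) ψ)) ∂w₁) := by
          rw [← heR, integral_const_mul]
          exact ENNReal.ofReal_le_ofReal (mul_le_mul_of_nonneg_left hlow (Real.exp_pos _).le)
      _ = ∫⁻ ψ in S, ENNReal.ofReal
            (Real.exp R * (Z * Real.exp (-cumWeight ξ T (proj h) ψ))) ∂w₁ :=
          ofReal_integral_eq_lintegral_ofReal (hi1.const_mul _).integrableOn
            (ae_of_all _ fun ψ => by positivity)
      _ ≤ ∫⁻ ψ in S, ratioProcess A 𝓔 w₁ ξ ψ T h ∂w₁ := by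
          refine setLIntegral_mono ((hξ.measurable_ratioProcess A 𝓔 le_rfl).comp
            measurable_prodMk_right) fun ψ hψ => ?_
          refine le_trans (ENNReal.ofReal_le_ofReal ?_) (hξ.le_ratioProcess A 𝓔 ψ le_rfl h)
          rw [mul_comm]
          have := Real.exp_le_exp.mpr (hcon ψ hψ).le
          gcongr
      _ ≤ _ := setLIntegral_le_lintegral _ _
  exact absurd hh (not_lt.mpr hge)

/-- Tonelli and Markov. The prior average is taken before Markov's inequality, so one event serves
all `ψ` without a union bound. -/
lemma Admissible.measure_bad_le (hξ : Admissible ξ T) {δ : ℝ} (hδ : 0 < δ) :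
    law A 𝓔 T {h | ENNReal.ofReal (1 / δ) ≤ ∫⁻ ψ, ratioProcess A 𝓔 w₁ ξ ψ T h ∂w₁} ≤
      ENNReal.ofReal δ := by
  have hm := hξ.measurable_ratioProcess (w₁ := w₁) A 𝓔 le_rfl
  have h1 : ∫⁻ h, ∫⁻ ψ, ratioProcess A 𝓔 w₁ ξ ψ T h ∂w₁ ∂(law A 𝓔 T) ≤ 1 := by
    rw [lintegral_lintegral_swap (f := fun h ψ => ratioProcess A 𝓔 w₁ ξ ψ T h)
      (hm.comp measurable_swap).aemeasurable]
    exact (lintegral_mono fun ψ => hξ.lintegral_ratioProcess_le A 𝓔 ψ le_rfl).trans (by simp)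
  have h2 := mul_meas_ge_le_lintegral (μ := law A 𝓔 T)
    (f := fun h => ∫⁻ ψ, ratioProcess A 𝓔 w₁ ξ ψ T h ∂w₁)
    ((hm.comp measurable_swap).lintegral_prod_right') (ENNReal.ofReal (1 / δ))
  have h3 := h2.trans h1
  rw [one_div, ENNReal.ofReal_inv_of_pos hδ] at h3 ⊢
  rw [mul_comm, ← div_eq_mul_inv, ENNReal.div_le_iff (by simpa using hδ) ENNReal.ofReal_ne_top,
    one_mul] at h3
  exact h3

end Interaction

/-! ### From information gain to regret -/

section Regret

variable {Dec Meas Obs : Type*} [MeasurableSpace Dec] [MeasurableSpace Meas] [MeasurableSpace Obs]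
  {Ps : Finset (Set (Model Dec Meas Obs))} {V : Model Dec Meas Obs → Dec → ℝ} {Vmax CV : ℝ}

/-- The product of the uniform law on the constraint sets with any covering distribution of
decisions is an admissible prior; the uniform factor costs `Ps.card`. -/
lemma iInf_priorCover_le (hPs : Ps.Nonempty) (V : Model Dec Meas Obs → Dec → ℝ) (Δ : ℝ) :
    ⨅ w : ProbabilityMeasure (Constraint Ps × Dec), priorCover Ps V (hybridInfo Ps) Δ w ≤
      Ps.card * fracCover V (powClass Ps) Δ := by
  have : Nonempty (Constraint Ps) := hPs.to_subtype
  have hcard : (Ps.card : ENNReal) ≠ 0 := by simpa using hPs.ne_empty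
  rw [fracCover, ENNReal.mul_iInf_of_ne hcard (ENNReal.natCast_ne_top _)]
  refine le_iInf fun p => ?_
  let u : Measure (Constraint Ps) := (PMF.uniformOfFintype (Constraint Ps)).toMeasure
  refine (iInf_le _ ⟨u.prod p, inferInstance⟩).trans ?_
  refine iSup₂_le fun P hP => iSup₂_le fun N hN => ?_
  obtain ⟨P', hP'⟩ : ∃ P' : Constraint Ps, P'.1 = P := ⟨⟨P, hP⟩, rfl⟩
  set S := {π | bestValue V N - V N π ≤ Δ} with hS
  have h1 : ({P'} : Set (Constraint Ps)) ×ˢ S ⊆ {ψ | P ⊆ (hybridInfo Ps).models ψ ∧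
      bestValue V N - V N ((hybridInfo Ps).dec ψ) ≤ Δ} := by
    rintro ⟨Q, π⟩ ⟨hQ, hπ⟩
    have hQ' : Q = P' := hQ
    subst hQ'
    exact ⟨hP'.ge, hπ⟩
  have h2 : u {P'} = (Ps.card : ENNReal)⁻¹ := by
    simp only [u]
    rw [PMF.toMeasure_apply_singleton _ _ (measurableSet_singleton _), PMF.uniformOfFintype_apply]
    congr 2
    exact Fintype.card_coe Ps
  have h3 := measure_mono (μ := u.prod (p : Measure Dec)) h1
  rw [Measure.prod_prod, h2] at h3
  have h4 : (p : Measure Dec) S ≠ ⊤ := measure_ne_top _ _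
  calc _ ≤ ((Ps.card : ENNReal)⁻¹ * (p : Measure Dec) S)⁻¹ := ENNReal.inv_le_inv' h3
    _ = Ps.card * ((p : Measure Dec) S)⁻¹ := by
      rw [ENNReal.mul_inv (Or.inr h4) (Or.inl (by simpa using hPs.ne_empty)), inv_inv]
    _ ≤ _ := by
      gcongr
      exact le_iSup₂ (f := fun (M : Model Dec Meas Obs) (_ : M ∈ powClass Ps) =>
        ((p : Measure Dec) {π | bestValue V M - V M π ≤ Δ})⁻¹) N (co_subset_powClass hP hN)

lemma one_le_fracCover {𝓜 : Set (Model Dec Meas Obs)} (h : 𝓜.Nonempty)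
    (V : Model Dec Meas Obs → Dec → ℝ) (Δ : ℝ) : 1 ≤ fracCover V 𝓜 Δ := by
  obtain ⟨M, hM⟩ := h
  refine le_iInf fun p => le_trans ?_ (le_iSup₂ (f := fun (M : Model Dec Meas Obs) (_ : M ∈ 𝓜) =>
    ((p : Measure Dec) {π | bestValue V M - V M π ≤ Δ})⁻¹) M hM)
  exact ENNReal.one_le_inv.mpr prob_le_one

/-- A round-wise bound on the objective turns a small information gain of a nearly optimal
information set into a small regret. -/
lemma Observable.regret_le [Nonempty Dec] (hO : Observable Ps V Vmax CV) (hCV : 0 < CV)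
    {Label : Type*} [MeasurableSpace Label] {A : Alg Dec Meas Obs} {𝓔 : Env Dec Meas Obs Label}
    {w₁ : Measure (Constraint Ps × Dec)} [IsProbabilityMeasure w₁] {T : ℕ} (hT : 1 ≤ T)
    {ξ : ∀ t : ℕ, Hist Dec Meas Obs t → Constraint Ps × Dec → Dec × Meas → Obs → ℝ}
    (hξ : Admissible ξ T) {γ v : ℝ} (hγ : 0 < γ)
    (hv : ∀ t < T, ∀ h, exoObj V (hybridInfo Ps) γ (expWeights w₁ ξ t h) (A.q t h) (ξ t h) ≤ v)
    {P : Set (Model Dec Meas Obs)} (hP : P ∈ Ps) (h𝓔 : ∀ e, 𝓔.modelOf e ∈ P)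
    (h : Fin T → Label × (Dec × Meas) × Obs) {N : Model Dec Meas Obs}
    (hN : ∀ π, V N π = (T : ℝ)⁻¹ * ∑ t : Fin T, V (𝓔.modelOf (h t).1) π)
    {ψ : Constraint Ps × Dec} (hψ : P ⊆ ψ.1.1) {Δ R : ℝ} (hΔ : bestValue V N - V N ψ.2 ≤ Δ)
    (hR : infoGain A 𝓔 w₁ ξ ψ T h ≤ R) :
    regret V A 𝓔 T h / T ≤ Δ + v + γ * R / T := by
  have hT0 : (0 : ℝ) < T := by exact_mod_cast hT
  have hmem : ∀ e, 𝓔.modelOf e ∈ powClass Ps := fun e => subset_powClass hP (h𝓔 e)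
  have hsum : ∀ π, ∑ t : Fin T, V (𝓔.modelOf (h t).1) π = T * V N π := fun π => by
    rw [hN, mul_inv_cancel_left₀ hT0.ne']
  -- The comparator term of the regret is `T` times the best value of the average model.
  have hsup : ⨆ π, ∑ t : Fin T, V (𝓔.modelOf (h t).1) π = T * bestValue V N := by
    simp_rw [hsum]
    exact (Real.mul_iSup_of_nonneg hT0.le _).symm
  have hround : ∀ t : Fin T, V (𝓔.modelOf (h t).1) ψ.2 -
      ∫ x, V (𝓔.modelOf (h t).1) x.1 ∂(A.q t (learnerHist h t t.isLt.le)) ≤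
      v + γ * (1 - meanCost A 𝓔 w₁ ξ t ψ (learnerHist h t t.isLt.le) (h t).1) := by
    intro t
    obtain ⟨hm, B, hB⟩ := (hξ t t.isLt).2 (learnerHist h t t.isLt.le)
    have hW : IsWeightBdd B (ξ t (learnerHist h t t.isLt.le)) := ⟨hm, hB⟩
    have hw := hξ.isProbabilityMeasure_expWeights (w₁ := w₁) t.isLt.le
      (learnerHist h t t.isLt.le)
    set w := expWeights w₁ ξ t (learnerHist h t t.isLt.le)
    set q := A.q t (learnerHist h t t.isLt.le)
    set M := 𝓔.modelOf (h t).1 with hM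
    have h1 : (exoObjAt V (hybridInfo Ps) γ w q (ξ t (learnerHist h t t.isLt.le)) M ψ : EReal) ≤
        v :=
      (le_iSup₂ (f := fun (M : Model Dec Meas Obs) (_ : M ∈ (hybridInfo Ps).models ψ) =>
        (exoObjAt V (hybridInfo Ps) γ w q (ξ t (learnerHist h t t.isLt.le)) M ψ : EReal)) M
          (hψ (h𝓔 _))).trans
        ((le_iSup (fun ψ => ⨆ M ∈ (hybridInfo Ps).models ψ,
          (exoObjAt V (hybridInfo Ps) γ w q (ξ t (learnerHist h t t.isLt.le)) M ψ : EReal))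
            ψ).trans (hv t t.isLt _))
    have h2 := EReal.coe_le_coe_iff.mp h1
    rw [hW.exoObjAt_eq _ γ q M ψ (hO.integrable hCV (subset_co _ (hmem _)) q)] at h2
    have h3 : meanCost A 𝓔 w₁ ξ t ψ (learnerHist h t t.isLt.le) (h t).1 =
      infoCost w q (ξ t (learnerHist h t t.isLt.le)) M ψ := rfl
    have h4 : (hybridInfo Ps).dec ψ = ψ.2 := rfl
    rw [h4] at h2
    rw [h3]
    linarith
  have h1 := Finset.sum_le_sum fun t (_ : t ∈ Finset.univ) => hround t
  rw [Finset.sum_sub_distrib, Finset.sum_add_distrib, ← Finset.mul_sum, hsum] at h1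
  simp only [Finset.sum_const, Finset.card_univ, Fintype.card_fin, nsmul_eq_mul] at h1
  have h2 : γ * ∑ t : Fin T, (1 - meanCost A 𝓔 w₁ ξ t ψ (learnerHist h t t.isLt.le) (h t).1) ≤
      γ * R := mul_le_mul_of_nonneg_left hR hγ.le
  have h3 : (T : ℝ) * bestValue V N ≤ T * (V N ψ.2 + Δ) :=
    mul_le_mul_of_nonneg_left (by linarith) hT0.le
  rw [regret, hsup, div_le_iff₀ hT0, add_mul, add_mul, div_mul_cancel₀ _ hT0.ne']
  linarith

/-- For each history, the uniform mixture `N` of the realized models lies in the hull of the true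
constraint set, so the prior charges the set `S` of information sets that are Δ-optimal for `N`. As
`N` varies with the history, the information bound must hold for all sets simultaneously. Only an
inclusion in the bad event is shown, so measurability of the regret is not needed. -/
lemma Observable.measure_regret_le [Nonempty Dec] (hO : Observable Ps V Vmax CV) (hCV : 0 < CV)
    {Label : Type*} [MeasurableSpace Label] {A : Alg Dec Meas Obs} {𝓔 : Env Dec Meas Obs Label}
    (h𝓔 : 𝓔.ConstrainedBy Ps)
    {w₁ : Measure (Constraint Ps × Dec)} [IsProbabilityMeasure w₁] {T : ℕ} (hT : 1 ≤ T)
    {ξ : ∀ t : ℕ, Hist Dec Meas Obs t → Constraint Ps × Dec → Dec × Meas → Obs → ℝ}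
    (hξ : Admissible ξ T) {γ v : ℝ} (hγ : 0 < γ)
    (hv : ∀ t < T, ∀ h, exoObj V (hybridInfo Ps) γ (expWeights w₁ ξ t h) (A.q t h) (ξ t h) ≤ v)
    {Δ δ K : ℝ} (hδ : 0 < δ) (hK : 0 < K)
    (hcover : priorCover Ps V (hybridInfo Ps) Δ w₁ ≤ ENNReal.ofReal K) :
    law A 𝓔 T {h | ¬ regret V A 𝓔 T h / T ≤
      Δ + v + γ * (Real.log (1 / δ) + 2 * Real.log K) / T} ≤ ENNReal.ofReal δ := by
  obtain ⟨P, hP, h𝓔P⟩ := h𝓔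
  have hT0 : (T : NNReal) ≠ 0 := by exact_mod_cast (by omega : T ≠ 0)
  refine (measure_mono fun h hh => ?_).trans (hξ.measure_bad_le (w₁ := w₁) A 𝓔 hδ)
  by_contra hgood
  refine hh ?_
  have ha : ∑ _t : Fin T, (T : NNReal)⁻¹ = 1 := by simp [hT0]
  obtain ⟨N, hN⟩ := exists_mixture (fun _ : Fin T => (T : NNReal)⁻¹) ha
    fun t => 𝓔.modelOf (h t).1
  have hNP : N ∈ co P := mem_co_of_eq_sum ha hN fun t => h𝓔P _
  have hVN : ∀ π, V N π = (T : ℝ)⁻¹ * ∑ t : Fin T, V (𝓔.modelOf (h t).1) π := by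
    intro π
    rw [hO.affine_fintype ha (fun t => subset_powClass hP (h𝓔P _)) (co_subset_powClass hP hNP) hN π,
      Finset.mul_sum]
    simp
  set S := {ψ | P ⊆ (hybridInfo Ps).models ψ ∧
    bestValue V N - V N ((hybridInfo Ps).dec ψ) ≤ Δ} with hS
  have hSK : (w₁ S)⁻¹ ≤ ENNReal.ofReal K := by
    refine le_trans ?_ hcover
    refine le_trans ?_ (le_iSup₂ (f := fun P (_ : P ∈ Ps) => ⨆ N ∈ co P,
      (w₁ {ψ | P ⊆ (hybridInfo Ps).models ψ ∧
        bestValue V N - V N ((hybridInfo Ps).dec ψ) ≤ Δ})⁻¹) P hP)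
    exact le_iSup₂ (f := fun (N : Model Dec Meas Obs) (_ : N ∈ co P) =>
      (w₁ {ψ | P ⊆ (hybridInfo Ps).models ψ ∧
        bestValue V N - V N ((hybridInfo Ps).dec ψ) ≤ Δ})⁻¹) N hNP
  have hS0 : w₁ S ≠ 0 := by
    intro h0
    rw [h0, ENNReal.inv_zero, top_le_iff] at hSK
    exact ENNReal.ofReal_ne_top hSK
  have hSr : 1 / w₁.real S ≤ K := by
    have h1 := ENNReal.toReal_mono ENNReal.ofReal_ne_top hSK
    rwa [ENNReal.toReal_inv, ENNReal.toReal_ofReal hK.le, ← one_div] at h1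
  obtain ⟨ψ, hψ, hψR⟩ := hξ.exists_infoGain_le A 𝓔 hδ (not_le.mp hgood) hS0
  refine hO.regret_le hCV hT hξ hγ hv hP h𝓔P h hVN hψ.1 hψ.2 (hψR.trans ?_)
  have h1 : 0 < w₁.real S := ENNReal.toReal_pos hS0 (measure_ne_top _ _)
  have := Real.log_le_log (by positivity) hSr
  linarith

end Regret

/-! ### Calibration of scales and constants -/

/-- The number of dyadic scales above `ε` is logarithmic in `T` when `T * ε ^ 2` is bounded below. -/
lemma exists_sqrt_scale_le {L : ℝ} (hL : 0 < L) :
    ∃ K : ℝ, 0 < K ∧ ∀ (T : ℕ) (ε : ℝ), 1 ≤ T → 0 < ε → L ≤ T * ε ^ 2 →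
      ∃ n : ℕ, 2 ≤ 2 ^ n * ε ∧ Real.sqrt (n + 1) ≤ K * Real.sqrt (Real.log (T + 1)) := by
  have hl2 := Real.log_pos one_lt_two
  set a := |Real.log (4 / L)| with ha
  have ha0 : 0 ≤ a := abs_nonneg _
  refine ⟨Real.sqrt ((a / Real.log 2 + 1) / (2 * Real.log 2) + 2 / Real.log 2), by positivity,
    fun T ε hT hε hTε => ?_⟩
  have hT0 : (1 : ℝ) ≤ T := by exact_mod_cast hT
  set l := Real.log (T + 1) with hl
  have hll : Real.log 2 ≤ l := Real.log_le_log two_pos (by linarith)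
  have hl0 : 0 < l := hl2.trans_le hll
  -- The requirement 2 ≤ 2^n ε reads n log 2 ≥ log(2/ε), and (2/ε)² ≤ (4/L) (T + 1) by the lower
  -- bound on T ε².
  set b := (a + l) / (2 * Real.log 2) with hb
  have hb0 : 0 ≤ b := by positivity
  refine ⟨⌈b⌉₊, ?_, ?_⟩
  · rw [← div_le_iff₀ hε, ← Real.log_le_log_iff (by positivity) (by positivity), Real.log_pow]
    have h1 : 2 * Real.log (2 / ε) ≤ a + l := by
      have h2 : 2 * Real.log (2 / ε) = Real.log ((2 / ε) ^ 2) := by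
        rw [Real.log_pow]; norm_num
      have h3 : (2 / ε) ^ 2 ≤ 4 / L * (T + 1) := by
        rw [div_pow, div_mul_eq_mul_div, div_le_div_iff₀ (by positivity) hL]
        nlinarith [sq_nonneg ε]
      rw [h2]
      refine (Real.log_le_log (by positivity) h3).trans ?_
      rw [Real.log_mul (by positivity) (by positivity)]
      exact add_le_add (le_abs_self _) le_rfl
    have h4 : b * Real.log 2 ≤ ⌈b⌉₊ * Real.log 2 :=
      mul_le_mul_of_nonneg_right (Nat.le_ceil b) hl2.le
    have h5 : b * Real.log 2 = (a + l) / 2 := by rw [hb]; field_simp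
    linarith
  · rw [← Real.sqrt_mul (by positivity)]
    refine Real.sqrt_le_sqrt ?_
    have h1 := (Nat.ceil_lt_add_one hb0).le
    have h2 : b + 2 ≤ ((a / Real.log 2 + 1) / (2 * Real.log 2) + 2 / Real.log 2) * l := by
      have h3 : a ≤ a / Real.log 2 * l := by
        rw [div_mul_eq_mul_div, le_div_iff₀ hl2]
        exact mul_le_mul_of_nonneg_left hll ha0
      have h4 : 2 ≤ 2 / Real.log 2 * l := by
        rw [div_mul_eq_mul_div, le_div_iff₀ hl2]
        linarith
      have h5 : b ≤ (a / Real.log 2 + 1) / (2 * Real.log 2) * l := by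
        rw [hb, div_mul_eq_mul_div]
        gcongr
        linarith
      linarith
    linarith

/-- Everything is a multiple of N D ε: 5 from the objective, 2 from the two slacks CV ε, and 64 K
from the information term, as 2γ ε² = 64 N D ε. -/
lemma regret_bound_le {T ε r c CV N D γ K R B : ℝ} (hT : 0 < T) (hε : 0 < ε) (hr : 0 ≤ r)
    (hc : 1 ≤ c) (hCV : 0 < CV) (hN : 1 ≤ N) (hK : 0 ≤ K) (hD : D = c * r / ε + CV)
    (hγ : γ = 32 * D * N / ε) (hR : R ≤ K * (T * ε ^ 2)) (hNB : N ≤ B) (hB : 0 ≤ B) :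
    5 * N * (D * ε) + CV * ε + CV * ε + 2 * γ * R / T ≤
      (7 + 64 * K) * (B * (c * (r + CV * ε))) := by
  have hDε : D * ε = c * r + CV * ε := by rw [hD]; field_simp
  have hD0 : 0 < D := by rw [hD]; positivity
  have hCVε : 0 < CV * ε := by positivity
  have hγ0 : 0 < γ := by rw [hγ]; positivity
  have hinfo : 2 * γ * R / T ≤ 64 * K * (N * (D * ε)) := by
    rw [div_le_iff₀ hT]
    refine (mul_le_mul_of_nonneg_left hR (by positivity)).trans_eq ?_
    rw [hγ]
    field_simp
    ring
  have hCVD : CV * ε ≤ N * (D * ε) := by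
    have h1 : CV * ε ≤ D * ε := by
      rw [hDε]
      linarith [mul_nonneg (zero_le_one.trans hc) hr]
    exact h1.trans (le_mul_of_one_le_left (by positivity) hN)
  have hfin : N * (D * ε) ≤ B * (c * (r + CV * ε)) := by
    refine mul_le_mul hNB ?_ (by positivity) hB
    rw [hDε, mul_add]
    linarith [le_mul_of_one_le_left hCVε.le hc]
  have hfin' := mul_le_mul_of_nonneg_left hfin (by positivity : 0 ≤ 7 + 64 * K)
  linarith

end HybridDMSO

/-! ### The regret bound -/

theorem mainTheorem4 (δ₀ : ℝ) (hδ₀ : δ₀ < 1) (c : ℝ) (hc : 1 ≤ c) :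
    ∃ C : ℝ, 0 < C ∧
      ∀ (Dec Meas Obs : Type*) [MeasurableSpace Dec] [MeasurableSpace Meas] [MeasurableSpace Obs]
        [Nonempty Dec] [MeasurableSpace.CountableOrCountablyGenerated (Dec × Meas) Obs]
        (Ps : Finset (Set (HybridDMSO.Model Dec Meas Obs)))
        (V : HybridDMSO.Model Dec Meas Obs → Dec → ℝ) (Vmax CV Δ δ : ℝ) (T : ℕ),
        Ps.Nonempty → (∀ P ∈ Ps, P.Nonempty) → 0 < CV → 0 ≤ Δ → 0 < δ → δ ≤ δ₀ → 1 ≤ T →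
        HybridDMSO.IsCompactClass (HybridDMSO.powClass Ps) →
        HybridDMSO.Observable Ps V Vmax CV →
        HybridDMSO.ModerateDecay c
          (fun ε => (HybridDMSO.rDec V (HybridDMSO.powClass Ps) ε).toReal) →
        HybridDMSO.fracCover V (HybridDMSO.powClass Ps) Δ ≠ ⊤ →
        ∃ γ η : ℝ, 0 < γ ∧ 0 < η ∧
          ∀ w₁ : MeasureTheory.ProbabilityMeasure (HybridDMSO.Constraint Ps × Dec),
            HybridDMSO.priorCover Ps V (HybridDMSO.hybridInfo Ps) Δ w₁ ≤
              2 * (⨅ w : MeasureTheory.ProbabilityMeasure (HybridDMSO.Constraint Ps × Dec),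
                HybridDMSO.priorCover Ps V (HybridDMSO.hybridInfo Ps) Δ w) →
            (∀ η' : ℝ, 0 < η' → ∃ A : HybridDMSO.Alg Dec Meas Obs,
              HybridDMSO.IsExOPlus V (HybridDMSO.hybridInfo Ps) w₁ γ η' T A) ∧
            ∀ A : HybridDMSO.Alg Dec Meas Obs,
              HybridDMSO.IsExOPlus V (HybridDMSO.hybridInfo Ps) w₁ γ η T A →
              ∀ (Label : Type*) [MeasurableSpace Label]
                (𝓔 : HybridDMSO.Env Dec Meas Obs Label), 𝓔.ConstrainedBy Ps →
                HybridDMSO.law A 𝓔 T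
                  {h | ¬ HybridDMSO.regret V A 𝓔 T h / T ≤
                    Δ + C * Real.sqrt (Real.log (T + 1)) *
                      ((HybridDMSO.rDec V (HybridDMSO.powClass Ps)
                          (HybridDMSO.epsBar Ps V Δ δ T)).toReal +
                        CV * HybridDMSO.epsBar Ps V Δ δ T)} ≤ ENNReal.ofReal δ := by
  -- For δ₀ ≤ 0 no `δ` is admissible. Otherwise δ₀ < 1 makes `L` positive, and it bounds T ε² from
  -- below.
  rcases le_or_gt δ₀ 0 with hδ₀' | hδ₀'
  · refine ⟨1, one_pos, ?_⟩
    intro Dec Meas Obs _ _ _ _ _ Ps V Vmax CV Δ δ T _ _ _ _ hδ hδδ₀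
    exact absurd (hδ.trans_le hδδ₀) (not_lt.mpr hδ₀')
  have hL : 0 < Real.log (1 / δ₀) := Real.log_pos (by rw [lt_div_iff₀ hδ₀']; linarith)
  set L := Real.log (1 / δ₀) with hLdef
  obtain ⟨K, hK, hKn⟩ := HybridDMSO.exists_sqrt_scale_le hL
  have hl2 := Real.log_pos one_lt_two
  -- The 2 comes from the double logarithm of the prior mass. The second summand absorbs 2 log 2,
  -- caused by the factor-2 optimal prior, using L ≤ T ε².
  set K₂ := 2 + 2 * Real.log 2 / L with hK₂
  have hK₂0 : 0 < K₂ := by positivity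
  refine ⟨(7 + 64 * K₂) * K * c, by positivity, ?_⟩
  intro Dec Meas Obs _ _ _ _ _ Ps V Vmax CV Δ δ T hPs hne hCV hΔ hδ hδδ₀ hT hcomp hO hd hfrac
  have hT0 : (0 : ℝ) < T := by exact_mod_cast hT
  have hcard : (1 : ℝ) ≤ Ps.card := by exact_mod_cast hPs.card_pos
  set F := (HybridDMSO.fracCover V (HybridDMSO.powClass Ps) Δ).toReal with hF
  have hF1 : 1 ≤ F := by
    obtain ⟨P, hP⟩ := hPs
    obtain ⟨M, hM⟩ := hne P hP
    have h1 := HybridDMSO.one_le_fracCover ⟨M, HybridDMSO.subset_powClass hP hM⟩ V Δ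
    simpa using ENNReal.toReal_mono hfrac h1
  set ε := HybridDMSO.epsBar Ps V Δ δ T with hεdef
  have hlog1 : Real.log (Ps.card / δ) = Real.log Ps.card + Real.log (1 / δ) := by
    rw [div_eq_mul_one_div, Real.log_mul (by positivity) (by positivity)]
  have hlogδ : L ≤ Real.log (1 / δ) :=
    Real.log_le_log (by positivity) (one_div_le_one_div_of_le hδ hδδ₀)
  have hlogcard : 0 ≤ Real.log Ps.card := Real.log_nonneg hcard
  have hlogF : 0 ≤ Real.log F := Real.log_nonneg hF1
  have hTε : T * ε ^ 2 = Real.log Ps.card + Real.log (1 / δ) + Real.log F := by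
    rw [hεdef, HybridDMSO.epsBar, Real.sq_sqrt, hlog1, mul_div_cancel₀ _ hT0.ne']
    rw [hlog1]
    exact div_nonneg (by linarith) hT0.le
  have hε : 0 < ε := by
    rw [hεdef, HybridDMSO.epsBar, Real.sqrt_pos, hlog1]
    exact div_pos (by linarith) hT0
  obtain ⟨n, hn, hnK⟩ := hKn T ε hT hε (by linarith)
  set r := (HybridDMSO.rDec V (HybridDMSO.powClass Ps) ε).toReal with hr
  have hr0 : 0 ≤ r := ENNReal.toReal_nonneg
  set D := c * r / ε + CV with hD
  have hDε : D * ε = c * r + CV * ε := by rw [hD]; field_simp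
  have hD0 : 0 < D := by positivity
  set N := Real.sqrt (n + 1) with hN
  have hN1 : 1 ≤ N := Real.one_le_sqrt.mpr (by linarith [(Nat.cast_nonneg n : (0 : ℝ) ≤ n)])
  set γ := 32 * D * N / ε with hγ
  have hγ0 : 0 < γ := by positivity
  -- The tolerance is of the order of the target. A second CV ε appears in `hv` as the slack of the
  -- minimax bound.
  refine ⟨2 * γ, CV * ε, by positivity, by positivity, fun w₁ hw₁ =>
    ⟨fun η' hη' => hO.exists_isExOPlus hCV hcomp hPs hne (by positivity) _ hη' T, ?_⟩⟩
  intro A hA Label _ 𝓔 h𝓔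
  obtain ⟨ξ, hξ⟩ := hA
  have hadm : HybridDMSO.Admissible ξ T := fun t ht => ⟨(hξ t ht).1, fun h => ((hξ t ht).2 h).1⟩
  have hv : ∀ t < T, ∀ h, HybridDMSO.exoObj V (HybridDMSO.hybridInfo Ps) (2 * γ)
      (HybridDMSO.expWeights w₁ ξ t h) (A.q t h) (ξ t h) ≤
        ((5 * N * (D * ε) + CV * ε + CV * ε : ℝ) : EReal) := by
    intro t ht h
    have hw := hadm.isProbabilityMeasure_expWeights
      (w₁ := (w₁ : MeasureTheory.Measure (HybridDMSO.Constraint Ps × Dec))) ht.le h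
    obtain ⟨q', ξ', hq', hξ', hle⟩ := hO.exists_exoObj_le hCV hcomp hne hc hd hε hn hD hγ
      (HybridDMSO.expWeights w₁ ξ t h) (s := CV * ε) (by positivity)
    refine (((hξ t ht).2 h).2 q' ξ' hq' hξ').trans ?_
    rw [EReal.coe_add (5 * N * (D * ε) + CV * ε)]
    gcongr
  have hcover : HybridDMSO.priorCover Ps V (HybridDMSO.hybridInfo Ps) Δ w₁ ≤
      ENNReal.ofReal (2 * (Ps.card * F)) := by
    refine hw₁.trans ?_
    rw [ENNReal.ofReal_mul two_pos.le, ENNReal.ofReal_mul (Nat.cast_nonneg _), hF,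
      ENNReal.ofReal_toReal hfrac, ENNReal.ofReal_natCast, ENNReal.ofReal_ofNat]
    gcongr
    exact HybridDMSO.iInf_priorCover_le hPs V Δ
  refine (MeasureTheory.measure_mono ?_).trans
    (hO.measure_regret_le hCV h𝓔 hT hadm (by positivity) hv hδ (by positivity) hcover)
  refine fun h hh hle => hh (hle.trans ?_)
  have hlog2 : Real.log (2 * (Ps.card * F)) = Real.log 2 + Real.log Ps.card + Real.log F := by
    rw [Real.log_mul two_ne_zero (by positivity), Real.log_mul (by positivity) (by positivity),
      add_assoc]
  have hR : Real.log (1 / δ) + 2 * Real.log (2 * (Ps.card * F)) ≤ K₂ * (T * ε ^ 2) := by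
    have h1 : 2 * Real.log 2 ≤ 2 * Real.log 2 / L * (T * ε ^ 2) := by
      rw [div_mul_eq_mul_div, le_div_iff₀ hL]
      exact mul_le_mul_of_nonneg_left (by linarith) (by positivity)
    rw [hlog2, hK₂, add_mul]
    linarith
  have h1 := HybridDMSO.regret_bound_le (c := c) hT0 hε hr0 hc hCV hN1 hK₂0.le hD hγ hR hnK
    (by positivity)
  linarith
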